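/- **Setting.** Let $H$ be a symmetric doubly stochastic $k\times k$ matrix and $0<f\le 1$. For every $n$ let there be given: a class in $[k]$ for each of the $n$ nodes, a degree $d_v$ for each node $v$, a $k\times k$ matrix $M_n$, and a number $s_n(c)$ of labelled nodes for each class $c$. Let $(G_n,S_n)$ be uniformly distributed over all pairs of a simple graph on the $n$ nodes in which every $v$ has degree $d_v$ and in which there are exactly $M_n(c,e)$ ordered pairs of adjacent nodes of classes $c$ and $e$ (for all $c,e$), and a set $S_n$ of nodes (the labelled ones) with $s_n(c)$ members in each class $c$. For an integer $p$ and a probability distribution $\mu$ on $\{0,1,2,\dots\}$ with finite $p$-th moment and $\mu(\{2,3,\dots\})>0$, call the sequence *$p$-regular with degree law $\mu$* if, as $n\to\infty$: such pairs exist for all large $n$; each class contains a fraction tending to $1/k$ of the nodes; the row-normalization of $M_n$ tends to $H$, and $M_n(c,e)=0$ for all large $n$ whenever $H_{ce}=0$; in each class the fraction of labelled nodes tends to $f$; and in each class the empirical distribution of the degrees tends to $\mu$ pointwise, and its $p$-th moment tends to that of $\mu$. Write $m_q=\sum_j j^q\mu(j)$ and $d=m_1$ (the limiting mean degree). Let $W$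 be the adjacency matrix of $G_n$, $W_{NB}^{(\ell)}$ the matrix whose $(i,j)$ entry is the number of non-backtracking paths $(u_0,\dots,u_\ell)$ from $i$ to $j$ (consecutive nodes adjacent, $u_t\ne u_{t+2}$; nodes may otherwise repeat), and $X$ the $n\times k$ matrix with $X_{vc}=1$ if $v\in S_n$ has class $c$, and $0$ otherwise. Let $\hat P^{(\ell)}$ and $\hat P_{NB}^{(\ell)}$ be obtained from $X^{T}W^\ell X$ and $X^{T}W_{NB}^{(\ell)}X$ by dividing each row by its sum. Convergence below is entrywise convergence in probability as $n\to\infty$. **Theorem (Consistency of the statistics $\hat P_{NB}^{(\ell)}$).** 1. If the sequence is $2$-regular, then $\hat P_{NB}^{(\ell)}\to H^\ell$ for every $\ell\ge1$. 2. Let $\ell\ge2$, $p=\lfloor \ell/2\rfloor+1$ and $K\in\mathbb R$. There are constants $a,b>0$, depending only on $k,H,f,\ell,K$, such that for every $p$-regular sequence with $m_p\le K\,d^{\,p}$: - $\hat P^{(\ell)}$ does not converge to $H^\ell$, provided that $H^2\ne I$ if $\ell$ is even, and $H^3\neq H$ if $\ell$ is odd; - $\hat P^{(\ell)}$ converges to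 a deterministic matrix $B$ with $|B_{ce}-(H^\ell)_{ce}|\le b/d$ for all $c,e$; if $H^{\ell-2}\ne H^\ell$, then $|B_{ce}-(H^\ell)_{ce}|\ge a/d$ for some $c,e$; - if $\ell$ is even, then moreover $B_{cc}\ge (H^\ell)_{cc}$ for all $c$, and $B_{cc}-(H^\ell)_{cc}\ge a/d$ for every $c$ with $(H^{\ell-2})_{cc}\neq (H^\ell)_{cc}$. -/

import Mathlib

open Filter Topology

noncomputable section

namespace CompatEst

/-! ### Path statistics of a partially labelled graph -/

open Classical in
/-- The `0/1` matrix whose entry `(v, c)` is `1` iff `v` is one of the labelled (seed) nodes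
and has class `c`; unlabelled nodes have a zero row. -/
def labelMatrix {V : Type*} {k : ℕ} (label : V → Fin k) (S : Finset V) :
    Matrix V (Fin k) ℝ :=
  Matrix.of fun v c => if v ∈ S ∧ label v = c then 1 else 0

open Classical in
/-- The adjacency matrix of a simple graph, with real entries. -/
def adjacency {V : Type*} (G : SimpleGraph V) : Matrix V V ℝ := G.adjMatrix ℝ

/-- `u 0, u 1, …, u ℓ` is a path of length `ℓ` (vertices may repeat) that never traverses the
same edge twice in a row. -/
def IsNonBacktracking {V : Type*} (G : SimpleGraph V) (ℓ : ℕ) (u : Fin (ℓ + 1) → V) : Prop :=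
  (∀ t : Fin ℓ, G.Adj (u t.castSucc) (u t.succ)) ∧
    ∀ s t : Fin (ℓ + 1), (t : ℕ) = (s : ℕ) + 2 → u s ≠ u t

/-- Entry `(i, j)` is the number of non-backtracking paths of length `ℓ` from `i` to `j`. -/
def nbMatrix {V : Type*} (G : SimpleGraph V) (ℓ : ℕ) : Matrix V V ℝ :=
  Matrix.of fun i j =>
    (({u : Fin (ℓ + 1) → V |
        IsNonBacktracking G ℓ u ∧ u 0 = i ∧ u (Fin.last ℓ) = j}.ncard : ℕ) : ℝ)

/-- Divide every row of a matrix by its sum. -/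
def rowNormalize {k : ℕ} (M : Matrix (Fin k) (Fin k) ℝ) : Matrix (Fin k) (Fin k) ℝ :=
  Matrix.of fun c e => M c e / ∑ e', M c e'

/-- `Xᵀ A X`: the entries of `A` summed over pairs of labelled nodes of given classes. -/
def classCounts {V : Type*} [Fintype V] {k : ℕ} (label : V → Fin k) (S : Finset V)
    (A : Matrix V V ℝ) : Matrix (Fin k) (Fin k) ℝ :=
  (labelMatrix label S).transpose * A * labelMatrix label S

open Classical in
/-- The row-normalized statistic built from all paths of length `ℓ`. -/
def pathStatistic {V : Type*} [Fintype V] {k : ℕ} (label : V → Fin k) (ℓ : ℕ)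
    (G : SimpleGraph V) (S : Finset V) : Matrix (Fin k) (Fin k) ℝ :=
  rowNormalize (classCounts label S (adjacency G ^ ℓ))

/-- The row-normalized statistic built from the non-backtracking paths of length `ℓ`. -/
def nbStatistic {V : Type*} [Fintype V] {k : ℕ} (label : V → Fin k) (ℓ : ℕ)
    (G : SimpleGraph V) (S : Finset V) : Matrix (Fin k) (Fin k) ℝ :=
  rowNormalize (classCounts label S (nbMatrix G ℓ))

/-! ### The random graph: uniform, given classes, degrees and edge counts between classes -/

/-- Parameters, for every number `n` of nodes, of a random partially labelled graph. -/
structure Planted (k : ℕ) where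
  /-- the class of every node -/
  label : ∀ n : ℕ, Fin n → Fin k
  /-- the prescribed degree of every node -/
  deg : ∀ n : ℕ, Fin n → ℕ
  /-- entry `(c, e)` is the prescribed number of ordered pairs of adjacent nodes
  of classes `c` and `e` -/
  edgeCounts : ℕ → Matrix (Fin k) (Fin k) ℝ
  /-- the prescribed number of labelled nodes of every class -/
  seeds : ℕ → Fin k → ℕ

variable {k : ℕ}

/-- Number of nodes of class `c`. -/
def Planted.classSize (P : Planted k) (n : ℕ) (c : Fin k) : ℕ :=
  {v : Fin n | P.label n v = c}.ncard

/-- All pairs of a simple graph on `n` nodes with the prescribed degrees and the prescribed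
edge counts between classes, and a set of labelled nodes with the prescribed number of
members in each class. -/
def Planted.outcomes (P : Planted k) (n : ℕ) : Set (SimpleGraph (Fin n) × Finset (Fin n)) :=
  {ω | (∀ v, (ω.1.neighborSet v).ncard = P.deg n v) ∧
    classCounts (P.label n) Finset.univ (adjacency ω.1) = P.edgeCounts n ∧
    ∀ c, {v : Fin n | v ∈ ω.2 ∧ P.label n v = c}.ncard = P.seeds n c}

/-- Probability of an event when all outcomes are equally likely. -/
def Planted.prob (P : Planted k) (n : ℕ)
    (A : Set (SimpleGraph (Fin n) × Finset (Fin n))) : ℝ :=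
  ((P.outcomes n ∩ A).ncard : ℝ) / ((P.outcomes n).ncard : ℝ)

/-- The matrix statistic `T` converges in probability to `L`, entry by entry. -/
def Planted.ConvergesInProb (P : Planted k)
    (T : ∀ n : ℕ, SimpleGraph (Fin n) → Finset (Fin n) → Matrix (Fin k) (Fin k) ℝ)
    (L : Matrix (Fin k) (Fin k) ℝ) : Prop :=
  ∀ c e : Fin k, ∀ ε : ℝ, 0 < ε →
    Tendsto (fun n => P.prob n {ω | ε ≤ |T n ω.1 ω.2 c e - L c e|}) atTop (𝓝 0)

/-- The `p`-th moment of a probability distribution on `ℕ` (meaningful if finite). -/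
def degMoment (μ : PMF ℕ) (p : ℕ) : ℝ := ∑' j : ℕ, (j : ℝ) ^ p * (μ j).toReal

/-- The asymptotic assumptions: balanced classes, planted compatibility matrix `H`, fraction
`f` of labelled nodes, degree distribution `μ` with moments up to order `p`. -/
structure Planted.IsRegular (P : Planted k) (H : Matrix (Fin k) (Fin k) ℝ) (f : ℝ)
    (μ : PMF ℕ) (p : ℕ) : Prop where
  /-- the prescribed data are realizable -/
  nonempty : ∀ᶠ n in atTop, (P.outcomes n).Nonempty
  /-- the classes are asymptotically of equal size -/
  balanced : ∀ c, Tendsto (fun n : ℕ => (P.classSize n c : ℝ) / n) atTop (𝓝 (1 / (k : ℝ)))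
  /-- the relative frequencies of classes among neighbors tend to `H` -/
  planted : ∀ c e, Tendsto (fun n => rowNormalize (P.edgeCounts n) c e) atTop (𝓝 (H c e))
  /-- there are no edges between incompatible classes -/
  planted_zero : ∀ c e, H c e = 0 → ∀ᶠ n in atTop, P.edgeCounts n c e = 0
  /-- in each class, the fraction of labelled nodes tends to `f` -/
  labelled : ∀ c,
    Tendsto (fun n => (P.seeds n c : ℝ) / (P.classSize n c : ℝ)) atTop (𝓝 f)
  /-- in each class, the empirical degree distribution tends to `μ` -/
  degrees : ∀ c j,
    Tendsto (fun n => (({v : Fin n | P.label n v = c ∧ P.deg n v = j}.ncard : ℕ) : ℝ) /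
      (P.classSize n c : ℝ)) atTop (𝓝 (μ j).toReal)
  /-- the `p`-th moment of `μ` is finite -/
  moment_finite : Summable fun j : ℕ => (j : ℝ) ^ p * (μ j).toReal
  /-- in each class, the `p`-th moment of the empirical degree distribution tends to that
  of `μ` -/
  moment : ∀ c,
    Tendsto (fun n => (∑ v : Fin n, if P.label n v = c then (P.deg n v : ℝ) ^ p else 0) /
      (P.classSize n c : ℝ)) atTop (𝓝 (degMoment μ p))
  /-- a positive fraction of the nodes has degree at least two -/
  degree_two : ∃ j, 2 ≤ j ∧ μ j ≠ 0

end CompatEst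

end

/-! Sort the walks of length `ℓ` by their pattern, that is, by which steps reach a new node and to
which visited node each other step goes. The steps to new nodes form a spanning tree of the `m + 1`
nodes of a pattern. If every step follows an edge of this tree, the number of such walks divided by
`n` converges to an explicit constant: a product of factorial moments of the degree law over `d ^
m`, times a factor `f` for each distinct endpoint. Classes along tree edges are governed by `H`, and
branches off the path between the endpoints sum out because rows of `H` sum to one. The endpoint
classes therefore contribute `(H ^ r) c e / k`, with `r` the tree distance of the endpoints. If some
step leaves the tree, the pattern contains a cycle or a loop and contributes only `o(n)`.

Hence both normalized statistics converge to weighted means of powers `H ^ r`. A non-backtracking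
walk inside a tree is a straight path, so only `r = ℓ` survives and the non-backtracking statistic
is consistent. Among all walks those that turn back contribute `r = ℓ - 2, ℓ - 4, …`, and these
cause the bias.

The probabilistic input is switching: replacing edges `a b`, `a' b'` with `a`, `a'` of the same
class by `a b'`, `a' b` permutes the outcomes. Double counting of switchings bounds the probability
that prescribed edges are present, which disposes of cycles and of nodes of large degree.
Antisymmetry under switching gives a second moment bound (`IsSwitchClosed.second_moment_le`): a new
leaf attached to a copy of a tree looks like the end of a random edge leaving the given class.
Induction over trees then gives all tree counts (`meanLim_treeSum`), first with truncated degrees.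
Exchanging a labelled and an unlabelled node handles the labelled set in the same way. The `p`-th
moment suffices for `p = ⌊ℓ/2⌋ + 1` because no node of the tree of an `ℓ`-step walk has larger
degree; for reduced walks `p = 2` is enough.

For the bias, `(H ^ (2 s)) c c` is the squared norm of a row of `H ^ s`. It does not increase with
`s`, and equality at one step freezes the row (`pow_add_two_apply_of_diag_eq`). For even `ℓ` this
applies to the diagonal of the limit. For odd `ℓ` the limit is paired with `H`, which produces
traces of even powers. The non-straight walks have a share of order `1 / d`: turning back in the
last step alone gives at least `d / m₂`, and a pattern with `m + 1` nodes has weight at most a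
constant times `d ^ m`. Mere inconsistency needs less, since the walk alternating between two nodes
has positive weight and brings in `H ^ 0` or `H ^ 1`. -/

namespace CompatEst

/-! ### Indicators -/

open Classical in
/-- The real number `1` if `p` holds, and `0` otherwise. -/
noncomputable def ind (p : Prop) : ℝ := if p then 1 else 0

theorem ind_of {p : Prop} (h : p) : ind p = 1 := if_pos h
theorem ind_of_not {p : Prop} (h : ¬ p) : ind p = 0 := if_neg h
theorem ind_nonneg (p : Prop) : 0 ≤ ind p := by unfold ind; split_ifs <;> norm_num
theorem ind_le_one (p : Prop) : ind p ≤ 1 := by unfold ind; split_ifs <;> norm_num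
theorem ind_and (p q : Prop) : ind (p ∧ q) = ind p * ind q := by
  unfold ind; by_cases p <;> by_cases q <;> simp [*]
theorem ind_not (p : Prop) : ind (¬ p) = 1 - ind p := by
  unfold ind; by_cases p <;> simp [*]
theorem ind_mono {p q : Prop} (h : p → q) : ind p ≤ ind q := by
  by_cases hp : p
  · rw [ind_of hp, ind_of (h hp)]
  · rw [ind_of_not hp]; exact ind_nonneg q
theorem ind_congr {p q : Prop} (h : p ↔ q) : ind p = ind q := by rw [propext h]
theorem ind_or_le (p q : Prop) : ind (p ∨ q) ≤ ind p + ind q := by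
  unfold ind; by_cases p <;> by_cases q <;> simp [*]
theorem ind_mul_self (p : Prop) : ind p * ind p = ind p := by
  unfold ind; by_cases p <;> simp [*]

theorem ind_exists_le {ι : Type*} [Fintype ι] (p : ι → Prop) :
    ind (∃ i, p i) ≤ ∑ i, ind (p i) := by
  by_cases h : ∃ i, p i
  · obtain ⟨i, hi⟩ := h
    calc ind (∃ i, p i) ≤ 1 := ind_le_one _
      _ = ind (p i) := (ind_of hi).symm
      _ ≤ _ := Finset.single_le_sum (f := fun i => ind (p i)) (fun i _ => ind_nonneg _)
        (Finset.mem_univ i)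
  · rw [ind_of_not h]; exact Finset.sum_nonneg fun i _ => ind_nonneg _

theorem sum_ind_eq_ncard {α : Type*} [Fintype α] (p : α → Prop) :
    ∑ a, ind (p a) = ({a | p a}.ncard : ℝ) := by
  classical
  rw [Set.ncard_eq_toFinset_card', Set.toFinset_ofPred, Finset.card_filter]
  push_cast
  exact Finset.sum_congr rfl fun a _ => by unfold ind; split_ifs <;> rfl

theorem sum_ind_eq_mul {α : Type*} [Fintype α] (a : α) (f : α → ℝ) :
    ∑ x, ind (x = a) * f x = f a := by
  classical
  rw [Finset.sum_eq_single a]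
  · simp [ind_of]
  · intro b _ hb; simp [ind_of_not hb]
  · simp

theorem sum_ind_eq_mul' {α : Type*} [Fintype α] (a : α) (f : α → ℝ) :
    ∑ x, ind (a = x) * f x = f a := by
  rw [← sum_ind_eq_mul a f]
  exact Finset.sum_congr rfl fun x _ => by rw [ind_congr (eq_comm)]

theorem sum_ind_eq {α : Type*} [Fintype α] (a : α) : ∑ x, ind (x = a) = 1 := by
  simpa using sum_ind_eq_mul a fun _ => 1

theorem sum_ind_eq' {α : Type*} [Fintype α] (a : α) : ∑ x, ind (a = x) = 1 := by
  simpa using sum_ind_eq_mul' a fun _ => 1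

/-! ### Switching two edges -/

variable {V : Type*}

/-- Edges `a b` and `a' b'` of `G` that may be replaced by `a b'` and `a' b`. -/
structure Switchable (G : SimpleGraph V) (a b a' b' : V) : Prop where
  adj : G.Adj a b
  adj' : G.Adj a' b'
  ne : a ≠ b'
  ne' : a' ≠ b
  not_adj : ¬ G.Adj a b'
  not_adj' : ¬ G.Adj a' b

/-- Replace the edges `a b` and `a' b'` by `a b'` and `a' b`. -/
def switch (G : SimpleGraph V) (a b a' b' : V) : SimpleGraph V where
  Adj x y := x ≠ y ∧ ((G.Adj x y ∧ s(x, y) ≠ s(a, b) ∧ s(x, y) ≠ s(a', b')) ∨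
    s(x, y) = s(a, b') ∨ s(x, y) = s(a', b))
  symm := ⟨fun x y h => ⟨h.1.symm, by rw [Sym2.eq_swap (a := y) (b := x), G.adj_comm]; exact h.2⟩⟩
  loopless := ⟨fun _ h => h.1 rfl⟩

variable {G : SimpleGraph V} {a b a' b' : V}

theorem Switchable.left_ne (h : Switchable G a b a' b') : a ≠ a' := by
  rintro rfl; exact h.not_adj h.adj'

theorem Switchable.right_ne (h : Switchable G a b a' b') : b ≠ b' := by
  rintro rfl; exact h.not_adj h.adj

/-- The inverse operation has the same form with `b` and `b'` exchanged. This symmetry makes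
switching an involution and drives every double count below. -/
theorem Switchable.switched (h : Switchable G a b a' b') :
    Switchable (switch G a b a' b') a b' a' b := by
  have h1 := h.left_ne
  have h2 := h.right_ne
  have h3 := h.adj.ne
  have h4 := h.adj'.ne
  have h5 := h.ne
  have h6 := h.ne'
  refine ⟨⟨h5, Or.inr (Or.inl rfl)⟩, ⟨h6, Or.inr (Or.inr rfl)⟩, h3, h4, ?_, ?_⟩
  · rintro ⟨-, h | h | h⟩
    · exact h.2.1 rfl
    · simp only [Sym2.eq_iff] at h; grind
    · simp only [Sym2.eq_iff] at h; grind
  · rintro ⟨-, h | h | h⟩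
    · exact h.2.2 rfl
    · simp only [Sym2.eq_iff] at h; grind
    · simp only [Sym2.eq_iff] at h; grind

theorem Switchable.switch_switch (h : Switchable G a b a' b') :
    switch (switch G a b a' b') a b' a' b = G := by
  have h1 := h.left_ne
  have h2 := h.right_ne
  have h3 := h.adj.ne
  have h4 := h.adj'.ne
  have h5 := h.ne
  have h6 := h.ne'
  have e1 : s(a, b) ≠ s(a, b') := by simp only [ne_eq, Sym2.eq_iff]; grind
  have e2 : s(a, b) ≠ s(a', b) := by simp only [ne_eq, Sym2.eq_iff]; grind
  have e3 : s(a', b') ≠ s(a, b') := by simp only [ne_eq, Sym2.eq_iff]; grind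
  have e4 : s(a', b') ≠ s(a', b) := by simp only [ne_eq, Sym2.eq_iff]; grind
  have key : ∀ z : Sym2 V, z ∈ G.edgeSet ↔
      ((z ∈ G.edgeSet ∧ z ≠ s(a, b) ∧ z ≠ s(a', b') ∨ z = s(a, b') ∨ z = s(a', b)) ∧
        z ≠ s(a, b') ∧ z ≠ s(a', b)) ∨ z = s(a, b) ∨ z = s(a', b') := by
    intro z
    have m1 : s(a, b) ∈ G.edgeSet := h.adj
    have m2 : s(a', b') ∈ G.edgeSet := h.adj'
    have m3 : s(a, b') ∉ G.edgeSet := h.not_adj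
    have m4 : s(a', b) ∉ G.edgeSet := h.not_adj'
    grind
  ext x y
  have := key s(x, y)
  rw [SimpleGraph.mem_edgeSet] at this
  simp only [switch]
  constructor
  · rintro ⟨hne, h⟩
    rw [this]; tauto
  · intro hxy
    have hne := hxy.ne
    rw [this] at hxy; tauto

/-- Each of the four edges involved has `b` or `b'` as an endpoint, so `a` and `a'` need not be
avoided. This matters later, where `a` belongs to the configuration that has to survive. -/
theorem switch_adj_iff_of_ne {x y : V} (hb : x ≠ b ∧ y ≠ b) (hb' : x ≠ b' ∧ y ≠ b') :
    (switch G a b a' b').Adj x y ↔ G.Adj x y := by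
  obtain ⟨h1, h2⟩ := hb
  obtain ⟨h3, h4⟩ := hb'
  have e1 : s(x, y) ≠ s(a, b) := by simp only [ne_eq, Sym2.eq_iff]; grind
  have e2 : s(x, y) ≠ s(a', b) := by simp only [ne_eq, Sym2.eq_iff]; grind
  have e3 : s(x, y) ≠ s(a, b') := by simp only [ne_eq, Sym2.eq_iff]; grind
  have e4 : s(x, y) ≠ s(a', b') := by simp only [ne_eq, Sym2.eq_iff]; grind
  simp only [switch, ne_eq, e1, not_false_eq_true, e4, and_self, and_true, e3, e2, or_self, or_false,
    and_iff_right_iff_imp]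
  exact fun h => h.ne

theorem switch_adj_iff_of_left_ne {x y : V} (h : x ≠ a ∧ x ≠ b ∧ x ≠ a' ∧ x ≠ b') :
    (switch G a b a' b').Adj x y ↔ G.Adj x y := by
  obtain ⟨h1, h2, h3, h4⟩ := h
  have e1 : s(x, y) ≠ s(a, b) := by simp only [ne_eq, Sym2.eq_iff]; grind
  have e2 : s(x, y) ≠ s(a', b) := by simp only [ne_eq, Sym2.eq_iff]; grind
  have e3 : s(x, y) ≠ s(a, b') := by simp only [ne_eq, Sym2.eq_iff]; grind
  have e4 : s(x, y) ≠ s(a', b') := by simp only [ne_eq, Sym2.eq_iff]; grind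
  simp only [switch, ne_eq, e1, not_false_eq_true, e4, and_self, and_true, e3, e2, or_self, or_false,
    and_iff_right_iff_imp]
  exact fun h => h.ne

theorem mem_edgeSet_switch {z : Sym2 V} (hz : z ∈ G.edgeSet) (h1 : z ≠ s(a, b))
    (h2 : z ≠ s(a', b')) : z ∈ (switch G a b a' b').edgeSet := by
  induction z with
  | h x y => exact ⟨G.ne_of_adj hz, Or.inl ⟨hz, h1, h2⟩⟩

theorem ind_sym2_eq {x y a b : V} (h : a ≠ b) :
    ind (s(x, y) = s(a, b)) = ind (x = a) * ind (y = b) + ind (x = b) * ind (y = a) := by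
  unfold ind
  by_cases h1 : x = a <;> by_cases h2 : y = b <;> by_cases h3 : x = b <;> by_cases h4 : y = a <;>
    simp_all

theorem Switchable.ind_adj (h : Switchable G a b a' b') (x y : V) :
    ind ((switch G a b a' b').Adj x y) = ind (G.Adj x y) - ind (s(x, y) = s(a, b)) -
      ind (s(x, y) = s(a', b')) + ind (s(x, y) = s(a, b')) + ind (s(x, y) = s(a', b)) := by
  have h1 := h.left_ne
  have h2 := h.right_ne
  have h3 := h.adj.ne
  have h4 := h.adj'.ne
  have h5 := h.ne
  have h6 := h.ne'
  have e1 : s(a, b) ≠ s(a, b') := by simp only [ne_eq, Sym2.eq_iff]; grind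
  have e2 : s(a, b) ≠ s(a', b) := by simp only [ne_eq, Sym2.eq_iff]; grind
  have e3 : s(a', b') ≠ s(a, b') := by simp only [ne_eq, Sym2.eq_iff]; grind
  have e4 : s(a', b') ≠ s(a', b) := by simp only [ne_eq, Sym2.eq_iff]; grind
  have e5 : s(a, b) ≠ s(a', b') := by simp only [ne_eq, Sym2.eq_iff]; grind
  have e6 : s(a, b') ≠ s(a', b) := by simp only [ne_eq, Sym2.eq_iff]; grind
  have key : ∀ z : Sym2 V, ind ((z ∈ G.edgeSet ∧ z ≠ s(a, b) ∧ z ≠ s(a', b')) ∨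
      z = s(a, b') ∨ z = s(a', b)) = ind (z ∈ G.edgeSet) - ind (z = s(a, b)) -
      ind (z = s(a', b')) + ind (z = s(a, b')) + ind (z = s(a', b)) := by
    intro z
    have m1 : s(a, b) ∈ G.edgeSet := h.adj
    have m2 : s(a', b') ∈ G.edgeSet := h.adj'
    have m3 : s(a, b') ∉ G.edgeSet := h.not_adj
    have m4 : s(a', b) ∉ G.edgeSet := h.not_adj'
    by_cases c1 : z = s(a, b)
    · subst c1; simp [ind, e1, e2, e5, m1]
    by_cases c2 : z = s(a', b')
    · subst c2; simp [ind, e3, e4, e5.symm, m2]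
    by_cases c3 : z = s(a, b')
    · subst c3; simp [ind, e1.symm, e3.symm, e6, m3]
    by_cases c4 : z = s(a', b)
    · subst c4; simp [ind, e2.symm, e4.symm, e6.symm, m4]
    rw [ind_of_not c1, ind_of_not c2, ind_of_not c3, ind_of_not c4,
      ind_congr (show _ ↔ z ∈ G.edgeSet by tauto)]
    ring
  rw [← SimpleGraph.mem_edgeSet G, ← key s(x, y)]
  refine ind_congr ?_
  simp only [switch]
  constructor
  · exact fun h => h.2
  · intro hh
    refine ⟨?_, hh⟩
    rintro rfl
    rcases hh with hh | hh | hh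
    · exact G.loopless.irrefl _ hh.1
    · simp only [Sym2.eq_iff] at hh; grind
    · simp only [Sym2.eq_iff] at hh; grind

theorem sum_mul_ind_sym2 [Fintype V] (f : V → V → ℝ) (h : a ≠ b) :
    ∑ x, ∑ y, f x y * ind (s(x, y) = s(a, b)) = f a b + f b a := by
  have e : ∀ x y, f x y * ind (s(x, y) = s(a, b)) =
      ind (x = a) * (ind (y = b) * f x y) + ind (x = b) * (ind (y = a) * f x y) := by
    intro x y; rw [ind_sym2_eq h]; ring
  simp only [e, Finset.sum_add_distrib, ← Finset.mul_sum, sum_ind_eq_mul]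

/-- Invariance of the degrees and of the class counts are both instances, for suitable `f`. -/
theorem Switchable.sum_mul_ind_adj [Fintype V] (h : Switchable G a b a' b') (f : V → V → ℝ) :
    ∑ x, ∑ y, f x y * ind ((switch G a b a' b').Adj x y) =
      ∑ x, ∑ y, f x y * ind (G.Adj x y) - (f a b + f b a) - (f a' b' + f b' a') +
        (f a b' + f b' a) + (f a' b + f b a') := by
  rw [← sum_mul_ind_sym2 f h.adj.ne, ← sum_mul_ind_sym2 f h.adj'.ne, ← sum_mul_ind_sym2 f h.ne,
    ← sum_mul_ind_sym2 f h.ne']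
  simp only [← Finset.sum_sub_distrib, ← Finset.sum_add_distrib]
  refine Finset.sum_congr rfl fun x _ => Finset.sum_congr rfl fun y _ => ?_
  rw [h.ind_adj]; ring

theorem ncard_neighborSet [Fintype V] (G : SimpleGraph V) (v : V) :
    ((G.neighborSet v).ncard : ℝ) = ∑ w, ind (G.Adj v w) :=
  (sum_ind_eq_ncard _).symm

theorem Switchable.ncard_neighborSet_switch [Fintype V] (h : Switchable G a b a' b') (v : V) :
    ((switch G a b a' b').neighborSet v).ncard = (G.neighborSet v).ncard := by
  have := h.sum_mul_ind_adj fun x _ => ind (x = v)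
  simp only [← Finset.mul_sum, sum_ind_eq_mul] at this
  have h2 : ((((switch G a b a' b').neighborSet v).ncard : ℕ) : ℝ) = (G.neighborSet v).ncard := by
    rw [ncard_neighborSet, ncard_neighborSet, this]; ring
  exact_mod_cast h2

theorem labelMatrix_apply {k : ℕ} (label : V → Fin k) (S : Finset V) (v : V) (c : Fin k) :
    labelMatrix label S v c = ind (v ∈ S ∧ label v = c) := by
  simp only [labelMatrix, Matrix.of_apply, ind]
  congr

theorem classCounts_apply [Fintype V] {k : ℕ} (label : V → Fin k) (S : Finset V)
    (A : Matrix V V ℝ) (c e : Fin k) :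
    classCounts label S A c e =
      ∑ x, ∑ y, ind (x ∈ S ∧ label x = c) * ind (y ∈ S ∧ label y = e) * A x y := by
  simp only [classCounts, Matrix.mul_apply, Matrix.transpose_apply, labelMatrix_apply]
  rw [Finset.sum_comm]
  refine Finset.sum_congr rfl fun x _ => ?_
  rw [Finset.sum_mul]
  refine Finset.sum_congr rfl fun y _ => ?_
  ring

theorem adjacency_apply (G : SimpleGraph V) (x y : V) : adjacency G x y = ind (G.Adj x y) := by
  simp [adjacency, ind, SimpleGraph.adjMatrix_apply]

/-- Since `a` and `a'` have the same class, the two removed edges and the two added edges join the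
same pairs of classes. -/
theorem Switchable.classCounts_switch [Fintype V] {k : ℕ} (label : V → Fin k)
    (h : Switchable G a b a' b') (hl : label a = label a') :
    classCounts label Finset.univ (adjacency (switch G a b a' b')) =
      classCounts label Finset.univ (adjacency G) := by
  ext c e
  simp only [classCounts_apply, adjacency_apply, h.sum_mul_ind_adj, hl, Finset.mem_univ, true_and]
  ring

end CompatEst

/-! ### Families of graphs closed under switching, and elementary edge counts -/

namespace CompatEst

set_option linter.unusedSectionVars false

variable {V : Type*}

theorem ind_mul_eq_ite (p : Prop) [Decidable p] (x : ℝ) : ind p * x = if p then x else 0 := by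
  unfold ind; split_ifs <;> simp

theorem sum_ind_le_of_injOn {α : Type*} (A : Finset α) (p q : α → Prop) (τ : α → α)
    (h1 : ∀ x ∈ A, p x → τ x ∈ A ∧ q (τ x))
    (h2 : ∀ x ∈ A, ∀ y ∈ A, p x → p y → τ x = τ y → x = y) :
    ∑ x ∈ A, ind (p x) ≤ ∑ x ∈ A, ind (q x) := by
  classical
  have e : ∀ r : α → Prop, ∑ x ∈ A, ind (r x) = ((A.filter r).card : ℝ) := by
    intro r
    rw [Finset.card_filter]; push_cast
    exact Finset.sum_congr rfl fun x _ => by simpa using ind_mul_eq_ite (r x) 1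
  rw [e, e]
  norm_cast
  refine Finset.card_le_card_of_injOn τ ?_ ?_
  · intro x hx
    have hx := Finset.mem_filter.1 hx
    exact Finset.mem_filter.2 (h1 x hx.1 hx.2)
  · intro x hx y hy
    have hx := Finset.mem_filter.1 hx
    have hy := Finset.mem_filter.1 hy
    exact h2 x hx.1 y hy.1 hx.2 hy.2

/-- A set of pairs of a graph and a set of nodes, with prescribed degrees, that is invariant under
switching two edges with starting points in the same class. -/
structure IsSwitchClosed [Fintype V] {k : ℕ} (label : V → Fin k) (deg : V → ℕ)
    (Ω : Finset (SimpleGraph V × Finset V)) : Prop where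
  degree : ∀ ω ∈ Ω, ∀ v, ∑ w, ind (ω.1.Adj v w) = deg v
  switch_mem : ∀ ω ∈ Ω, ∀ a b a' b', label a = label a' → Switchable ω.1 a b a' b' →
    (switch ω.1 a b a' b', ω.2) ∈ Ω

/-- The sum of the degrees of the nodes of class `c`. -/
noncomputable def degSum [Fintype V] {k : ℕ} (label : V → Fin k) (deg : V → ℕ) (c : Fin k) : ℝ :=
  ∑ v, ind (label v = c) * deg v

section Counting

variable [Fintype V] {G : SimpleGraph V} {deg : V → ℕ} {Δ : ℝ}

theorem sum_ind_adj_mul_left (hG : ∀ v, ∑ w, ind (G.Adj v w) = deg v) (f : V → ℝ) :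
    ∑ v, ∑ w, f v * ind (G.Adj v w) = ∑ v, f v * deg v := by
  simp only [← Finset.mul_sum, hG]

theorem sum_ind_adj_mul_right (hG : ∀ v, ∑ w, ind (G.Adj v w) = deg v) (f : V → ℝ) :
    ∑ v, ∑ w, f w * ind (G.Adj v w) = ∑ w, f w * deg w := by
  rw [Finset.sum_comm]
  simp only [G.adj_comm]
  exact sum_ind_adj_mul_left hG f

/-- The sum counts walks `a`, `w`, `v` of length two from `a`. -/
theorem sum_sum_ind_adj_common_le (hG : ∀ v, ∑ w, ind (G.Adj v w) = deg v)
    (hΔ : ∀ v, (deg v : ℝ) ≤ Δ) (a : V) :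
    ∑ v, ∑ w, ind (G.Adj a w) * ind (G.Adj v w) ≤ Δ ^ 2 := by
  have h0 : 0 ≤ Δ := (Nat.cast_nonneg _).trans (hΔ a)
  rw [sum_ind_adj_mul_right hG]
  calc ∑ w, ind (G.Adj a w) * deg w ≤ ∑ w, ind (G.Adj a w) * Δ :=
        Finset.sum_le_sum fun w _ => mul_le_mul_of_nonneg_left (hΔ w) (ind_nonneg _)
    _ = deg a * Δ := by rw [← Finset.sum_mul, hG]
    _ ≤ Δ ^ 2 := by rw [sq]; exact mul_le_mul_of_nonneg_right (hΔ a) h0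

theorem sum_sum_ind_adj_common_le' (hG : ∀ v, ∑ w, ind (G.Adj v w) = deg v)
    (hΔ : ∀ v, (deg v : ℝ) ≤ Δ) (a : V) :
    ∑ v, ∑ w, ind (G.Adj v a) * ind (G.Adj v w) ≤ Δ ^ 2 := by
  rw [Finset.sum_comm]
  simpa only [G.adj_comm] using sum_sum_ind_adj_common_le hG hΔ a

theorem sum_ind_sym2_mem_le (D : Finset (Sym2 V)) :
    ∑ v, ∑ w, ind (s(v, w) ∈ D) ≤ 2 * D.card := by
  classical
  induction D using Finset.induction_on with
  | empty => simp [ind]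
  | insert z D hz ih =>
    have h1 : ∑ v, ∑ w, ind (s(v, w) = z) ≤ 2 := by
      induction z with
      | h a b =>
        have : ∀ v w, ind (s(v, w) = s(a, b)) ≤
            ind (v = a) * ind (w = b) + ind (v = b) * ind (w = a) := by
          intro v w
          rw [← ind_and, ← ind_and]
          refine le_trans (ind_mono fun h => ?_) (ind_or_le _ _)
          simpa [Sym2.eq_iff] using h
        calc _ ≤ ∑ v, ∑ w, (ind (v = a) * ind (w = b) + ind (v = b) * ind (w = a)) :=
              Finset.sum_le_sum fun v _ => Finset.sum_le_sum fun w _ => this v w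
          _ = 2 := by
              simp only [Finset.sum_add_distrib, ← Finset.mul_sum, sum_ind_eq, mul_one]
              norm_num
    calc ∑ v, ∑ w, ind (s(v, w) ∈ insert z D)
        ≤ ∑ v, ∑ w, (ind (s(v, w) = z) + ind (s(v, w) ∈ D)) :=
          Finset.sum_le_sum fun v _ => Finset.sum_le_sum fun w _ => by
            rw [Finset.mem_insert]; exact ind_or_le _ _
      _ ≤ 2 + 2 * D.card := by
          simp only [Finset.sum_add_distrib]; exact add_le_add h1 ih
      _ = _ := by rw [Finset.card_insert_of_notMem hz]; push_cast; ring

theorem sum_ind_forall_ne_le {ι : Type*} [Fintype ι] (hG : ∀ v, ∑ w, ind (G.Adj v w) = deg v)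
    (hΔ : ∀ v, (deg v : ℝ) ≤ Δ) (u : ι → V) :
    ∑ v, ∑ w, ind (∃ i, u i = v) * ind (G.Adj v w) ≤ Fintype.card ι * Δ := by
  rw [sum_ind_adj_mul_left hG]
  calc ∑ v, ind (∃ i, u i = v) * (deg v : ℝ) ≤ ∑ v, ∑ i, ind (u i = v) * (deg v : ℝ) := by
        refine Finset.sum_le_sum fun v _ => ?_
        rw [← Finset.sum_mul]
        exact mul_le_mul_of_nonneg_right (ind_exists_le _) (Nat.cast_nonneg _)
    _ = ∑ i, (deg (u i) : ℝ) := by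
        rw [Finset.sum_comm]; simp only [sum_ind_eq_mul']
    _ ≤ ∑ _i : ι, Δ := Finset.sum_le_sum fun i _ => hΔ _
    _ = _ := by simp

theorem sum_ind_forall_ne_le' {ι : Type*} [Fintype ι] (hG : ∀ v, ∑ w, ind (G.Adj v w) = deg v)
    (hΔ : ∀ v, (deg v : ℝ) ≤ Δ) (u : ι → V) :
    ∑ v, ∑ w, ind (∃ i, u i = w) * ind (G.Adj v w) ≤ Fintype.card ι * Δ := by
  rw [Finset.sum_comm]
  simpa only [G.adj_comm] using sum_ind_forall_ne_le hG hΔ u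

end Counting

/-! ### The probability of a prescribed set of edges -/

/-- The product of the degrees of the endpoints of an edge. -/
noncomputable def endpointWeight (deg : V → ℕ) (z : Sym2 V) : ℝ :=
  (z.map fun v => (deg v : ℝ)).mul

theorem endpointWeight_nonneg (deg : V → ℕ) (z : Sym2 V) : 0 ≤ endpointWeight deg z := by
  induction z with
  | h a b => simp [endpointWeight]; positivity

variable [Fintype V] {k : ℕ} {label : V → Fin k} {deg : V → ℕ} {Δ : ℝ}
  {Ω : Finset (SimpleGraph V × Finset V)}

/-- Double counting: in a graph containing `a b` and `D`, at least `Q` edges `v w` can be switched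
with `a b` without touching `D`. In the resulting graph `w` is a neighbor of `a` and `v` one of `b`,
so each such graph arises at most `deg a * deg b` times. The subtracted term counts the forbidden
edges: those with `v = b` or `w = a`, those blocked by an existing edge `a w` or `v b`, and those in
`D`. -/
theorem IsSwitchClosed.sum_ind_subset_step (hΩ : IsSwitchClosed label deg Ω)
    (hΔ : ∀ v, (deg v : ℝ) ≤ Δ) {Q : ℝ} {D : Finset (Sym2 V)}
    (hQ : ∀ c, Q ≤ degSum label deg c - (2 * Δ + 2 * Δ ^ 2 + 2 * D.card))
    {a b : V} (hD : s(a, b) ∉ D) :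
    (∑ ω ∈ Ω, ind (s(a, b) ∈ ω.1.edgeSet ∧ ∀ z ∈ D, z ∈ ω.1.edgeSet)) * Q ≤
      (∑ ω ∈ Ω, ind (∀ z ∈ D, z ∈ ω.1.edgeSet)) * (deg a * deg b) := by
  classical
  set A : SimpleGraph V × Finset V → Prop :=
    fun ω => s(a, b) ∈ ω.1.edgeSet ∧ ∀ z ∈ D, z ∈ ω.1.edgeSet with hA
  set good : SimpleGraph V × Finset V → V → V → Prop := fun ω v w =>
    label a = label v ∧ ω.1.Adj v w ∧ v ≠ b ∧ a ≠ w ∧ ¬ ω.1.Adj a w ∧ ¬ ω.1.Adj v b ∧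
      s(v, w) ∉ D with hgood
  have step1 : ∀ ω ∈ Ω, Q ≤ ∑ v, ∑ w, ind (good ω v w) := by
    intro ω hω
    have hG := hΩ.degree ω hω
    have pt : ∀ v w, ind (label v = label a) * ind (ω.1.Adj v w) ≤ ind (good ω v w) +
        (ind (v = b) * ind (ω.1.Adj v w) + ind (w = a) * ind (ω.1.Adj v w) +
          ind (ω.1.Adj a w) * ind (ω.1.Adj v w) + ind (ω.1.Adj v b) * ind (ω.1.Adj v w) +
          ind (s(v, w) ∈ D)) := by
      intro v w
      simp only [← ind_and]
      refine le_trans (ind_mono (q := good ω v w ∨ (((((v = b ∧ ω.1.Adj v w) ∨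
        (w = a ∧ ω.1.Adj v w)) ∨ (ω.1.Adj a w ∧ ω.1.Adj v w)) ∨ (ω.1.Adj v b ∧ ω.1.Adj v w)) ∨
        s(v, w) ∈ D)) fun h => ?_) ?_
      · simp only [hgood]; grind
      · refine (ind_or_le _ _).trans (add_le_add le_rfl ?_)
        refine (ind_or_le _ _).trans (add_le_add ?_ le_rfl)
        refine (ind_or_le _ _).trans (add_le_add ?_ le_rfl)
        refine (ind_or_le _ _).trans (add_le_add (ind_or_le _ _) le_rfl)
    have sm := Finset.sum_le_sum fun v (_ : v ∈ Finset.univ) =>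
      Finset.sum_le_sum fun w (_ : w ∈ Finset.univ) => pt v w
    simp only [Finset.sum_add_distrib] at sm
    have e1 := sum_ind_adj_mul_left hG fun v => ind (label v = label a)
    have e2 := sum_ind_adj_mul_left hG fun v => ind (v = b)
    have e3 := sum_ind_adj_mul_right hG fun v => ind (v = a)
    have e4 := sum_sum_ind_adj_common_le hG hΔ a
    have e5 := sum_sum_ind_adj_common_le' hG hΔ b
    have e6 := sum_ind_sym2_mem_le D
    rw [sum_ind_eq_mul] at e2 e3
    have := hQ (label a)
    unfold degSum at this
    have := hΔ a
    have := hΔ b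
    linarith
  have step2 : (∑ ω ∈ Ω, ind (A ω)) * Q ≤
      ∑ ω ∈ Ω, ∑ v, ∑ w, ind (A ω ∧ good ω v w) := by
    rw [Finset.sum_mul]
    refine Finset.sum_le_sum fun ω hω => ?_
    simp only [ind_and (A ω), ← Finset.mul_sum]
    exact mul_le_mul_of_nonneg_left (step1 ω hω) (ind_nonneg _)
  refine step2.trans ?_
  -- The switch is injective once the pair `(v, w)` is remembered, because it can be undone.
  have step3 : ∑ q ∈ Ω ×ˢ (Finset.univ : Finset (V × V)), ind (A q.1 ∧ good q.1 q.2.1 q.2.2) ≤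
      ∑ q ∈ Ω ×ˢ (Finset.univ : Finset (V × V)),
        ind ((∀ z ∈ D, z ∈ q.1.1.edgeSet) ∧ q.1.1.Adj a q.2.2 ∧ q.1.1.Adj b q.2.1) := by
    have sw : ∀ q : (SimpleGraph V × Finset V) × V × V, A q.1 → good q.1 q.2.1 q.2.2 →
        Switchable q.1.1 a b q.2.1 q.2.2 := fun q h1 h2 =>
      ⟨h1.1, h2.2.1, h2.2.2.2.1, h2.2.2.1, h2.2.2.2.2.1, h2.2.2.2.2.2.1⟩
    refine sum_ind_le_of_injOn _ _ _ (fun q => ((switch q.1.1 a b q.2.1 q.2.2, q.1.2), q.2)) ?_ ?_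
    · rintro q hq ⟨h1, h2⟩
      have hs := sw q h1 h2
      refine ⟨?_, fun z hz => ?_, hs.switched.adj, hs.switched.adj'.symm⟩
      · simp only [Finset.mem_product, Finset.mem_univ, and_true] at hq ⊢
        exact hΩ.switch_mem _ hq _ _ _ _ h2.1 hs
      · refine mem_edgeSet_switch (h1.2 z hz) ?_ ?_
        · rintro rfl; exact hD hz
        · rintro rfl; exact h2.2.2.2.2.2.2 hz
    · rintro ⟨⟨G, S⟩, v, w⟩ hq ⟨⟨G', S'⟩, v', w'⟩ hq' ⟨h1, h2⟩ ⟨h1', h2'⟩ he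
      simp only [Prod.mk.injEq] at he
      obtain ⟨⟨he, rfl⟩, rfl, rfl⟩ := he
      have := (sw _ h1 h2).switch_switch
      simp only at this
      rw [he, (sw _ h1' h2').switch_switch] at this
      simp only at this
      rw [this]
  simp only [Finset.sum_product, ← Finset.univ_product_univ] at step3
  refine step3.trans (le_of_eq ?_)
  rw [Finset.sum_mul]
  refine Finset.sum_congr rfl fun ω hω => ?_
  simp only [ind_and, ← Finset.mul_sum]
  congr 1
  simp only [← Finset.sum_mul, ← Finset.mul_sum, hΩ.degree ω hω]

/-- Iterating the one-edge step shows that the probability of containing `D` is at most the product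
over its edges of `deg a * deg b / Q`. The fixed bound `r` on the size keeps one `Q` valid
throughout. -/
theorem IsSwitchClosed.sum_ind_subset_mul_pow_le (hΩ : IsSwitchClosed label deg Ω)
    (hΔ : ∀ v, (deg v : ℝ) ≤ Δ) {Q : ℝ} (hQ0 : 0 ≤ Q) {r : ℕ}
    (hQ : ∀ c, Q ≤ degSum label deg c - (2 * Δ + 2 * Δ ^ 2 + 2 * r))
    (D : Finset (Sym2 V)) (hr : D.card ≤ r) :
    (∑ ω ∈ Ω, ind (∀ z ∈ D, z ∈ ω.1.edgeSet)) * Q ^ D.card ≤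
      Ω.card * ∏ z ∈ D, endpointWeight deg z := by
  classical
  induction D using Finset.induction_on with
  | empty => simp [ind_of]
  | insert z D hz ih =>
    rw [Finset.card_insert_of_notMem hz] at hr ⊢
    have hD : (D.card : ℝ) ≤ r := by exact_mod_cast (Nat.le_succ _).trans hr
    have ih := ih ((Nat.le_succ _).trans hr)
    simp only [Finset.forall_mem_insert]
    rw [Finset.prod_insert hz]
    induction z with
    | h a b =>
      have st := hΩ.sum_ind_subset_step hΔ (Q := Q) (D := D) (fun c => by linarith [hQ c]) hz
      have e : endpointWeight deg s(a, b) = deg a * deg b := rfl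
      have h0 := endpointWeight_nonneg deg s(a, b)
      rw [pow_succ', ← mul_assoc]
      calc _ ≤ _ := mul_le_mul_of_nonneg_right st (pow_nonneg hQ0 _)
        _ = (∑ ω ∈ Ω, ind (∀ z ∈ D, z ∈ ω.1.edgeSet)) * Q ^ D.card *
            endpointWeight deg s(a, b) := by rw [e]; ring
        _ ≤ _ := mul_le_mul_of_nonneg_right ih h0
        _ = _ := by ring

/-- The number of members of a set of unordered pairs that contain `i`. -/
noncomputable def pairDegree {ι : Type*} (E : Finset (Sym2 ι)) (i : ι) : ℕ := by
  classical exact (E.filter fun z => i ∈ z).card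

theorem pairDegree_eq {ι : Type*} [DecidableEq ι] (E : Finset (Sym2 ι)) (i : ι) :
    pairDegree E i = (E.filter fun z => i ∈ z).card := by
  unfold pairDegree; congr!

theorem prod_endpointWeight_map {ι : Type*} [Fintype ι] (E : Finset (Sym2 ι))
    (hE : ∀ z ∈ E, ¬ z.IsDiag) (x : ι → V) :
    ∏ z ∈ E, endpointWeight deg (z.map x) = ∏ i, (deg (x i) : ℝ) ^ pairDegree E i := by
  classical
  have e : ∀ z ∈ E, endpointWeight deg (z.map x) =
      ∏ i, if i ∈ z then (deg (x i) : ℝ) else 1 := by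
    intro z hz
    induction z with
    | h a b =>
      have hab : a ≠ b := by simpa using hE _ hz
      rw [← Finset.prod_filter]
      have : (Finset.univ.filter fun i => i ∈ s(a, b)) = {a, b} := by
        ext i; simp
      rw [this, Finset.prod_pair hab]; rfl
  rw [Finset.prod_congr rfl e, Finset.prod_comm]
  refine Finset.prod_congr rfl fun i _ => ?_
  rw [← Finset.prod_filter, Finset.prod_const, pairDegree]

/-- `x` is injective and maps the pairs in `E` to edges of `G`. -/
def IsCopy {ι : Type*} (E : Finset (Sym2 ι)) (G : SimpleGraph V) (x : ι → V) : Prop :=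
  Function.Injective x ∧ ∀ z ∈ E, z.map x ∈ G.edgeSet

/-- For a fixed injective `x` the edge bound is a product over nodes, each node entering with the
power of its degree given by the pattern. Enlarging the sum to all maps `x` turns it into a product
of sums over single nodes. -/
theorem IsSwitchClosed.sum_isCopy_le (hΩ : IsSwitchClosed label deg Ω)
    (hΔ : ∀ v, (deg v : ℝ) ≤ Δ) {ι : Type*} [Fintype ι] [DecidableEq ι]
    (E : Finset (Sym2 ι)) (hE : ∀ z ∈ E, ¬ z.IsDiag) {Q : ℝ} (hQ0 : 0 ≤ Q)
    (hQ : ∀ c, Q ≤ degSum label deg c - (2 * Δ + 2 * Δ ^ 2 + 2 * E.card))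
    (h : ι → V → ℝ) (hh : ∀ i v, 0 ≤ h i v) :
    (∑ ω ∈ Ω, ∑ x : ι → V, ind (IsCopy E ω.1 x) * ∏ i, h i (x i)) * Q ^ E.card ≤
      Ω.card * ∏ i, ∑ v, h i v * (deg v : ℝ) ^ pairDegree E i := by
  classical
  rw [Finset.prod_univ_sum, Fintype.piFinset_univ, Finset.sum_comm, Finset.sum_mul, Finset.mul_sum]
  refine Finset.sum_le_sum fun x _ => ?_
  rw [← Finset.sum_mul, Finset.prod_mul_distrib]
  have hx0 : 0 ≤ ∏ i, h i (x i) := Finset.prod_nonneg fun i _ => hh _ _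
  by_cases hx : Function.Injective x
  · have hinj : Function.Injective (Sym2.map x) := Sym2.map.injective hx
    have := hΩ.sum_ind_subset_mul_pow_le hΔ hQ0 hQ (E.image (Sym2.map x))
      (Finset.card_image_le)
    rw [Finset.card_image_of_injective _ hinj, Finset.prod_image hinj.injOn,
      prod_endpointWeight_map E hE] at this
    have e : ∀ ω : SimpleGraph V × Finset V, ind (IsCopy E ω.1 x) =
        ind (∀ z ∈ E.image (Sym2.map x), z ∈ ω.1.edgeSet) := by
      intro ω; refine ind_congr ?_
      simp [IsCopy, hx]
    simp only [e]
    calc _ = (∑ ω ∈ Ω, ind (∀ z ∈ E.image (Sym2.map x), z ∈ ω.1.edgeSet)) * Q ^ E.card *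
          ∏ i, h i (x i) := by ring
      _ ≤ _ := mul_le_mul_of_nonneg_right this hx0
      _ = _ := by ring
  · have e : ∀ ω : SimpleGraph V × Finset V, ind (IsCopy E ω.1 x) = 0 :=
      fun ω => ind_of_not fun h => hx h.1
    simp only [e, Finset.sum_const_zero, zero_mul]
    exact mul_nonneg (Nat.cast_nonneg _) (mul_nonneg hx0 (Finset.prod_nonneg fun i _ => by positivity))

/-! ### The second moment bound -/

section SecondMoment

variable {ι : Type*} [Fintype ι] [DecidableEq ι]

/-- `u` is related to `G`, and `w` is a neighbor of `u p` outside the range of `u`. -/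
def Extends (R : SimpleGraph V → (ι → V) → Prop) (p : ι) (G : SimpleGraph V) (u : ι → V) (w : V) :
    Prop :=
  R G u ∧ G.Adj (u p) w ∧ ∀ i, u i ≠ w

/-- The relation between `G` and `u` depends only on the adjacencies inside the range of `u`. -/
def IsLocal (R : SimpleGraph V → (ι → V) → Prop) : Prop :=
  ∀ (G G' : SimpleGraph V) u, (∀ i j, G.Adj (u i) (u j) ↔ G'.Adj (u i) (u j)) → R G u → R G' u

/-- The edge `v' w'` may be switched with the edge from `u p` to `w` without
affecting the range of `u`. -/
structure GoodPair (label : V → Fin k) (R : SimpleGraph V → (ι → V) → Prop) (p : ι)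
    (G : SimpleGraph V) (u : ι → V) (w v' w' : V) : Prop where
  ext : Extends R p G u w
  label_eq : label (u p) = label v'
  adj : G.Adj v' w'
  left_notMem : ∀ i, u i ≠ v'
  right_notMem : ∀ i, u i ≠ w'
  ne : v' ≠ w
  not_adj : ¬ G.Adj (u p) w'
  not_adj' : ¬ G.Adj v' w

variable {R : SimpleGraph V → (ι → V) → Prop} {p : ι} {G : SimpleGraph V} {u : ι → V} {w v' w' : V}

theorem GoodPair.switchable (h : GoodPair label R p G u w v' w') :
    Switchable G (u p) w v' w' :=
  ⟨h.ext.2.1, h.adj, h.right_notMem p, h.ne, h.not_adj, h.not_adj'⟩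

/-- All changed edges contain `w` or `w'`, neither of which is in the range of `u`. So `u` remains a
valid configuration, now extended by `w'`. -/
theorem GoodPair.switched (hR : IsLocal R) (h : GoodPair label R p G u w v' w') :
    GoodPair label R p (switch G (u p) w v' w') u w' v' w := by
  have hs := h.switchable.switched
  refine ⟨⟨hR G _ u (fun i j => ?_) h.ext.1, hs.adj, h.right_notMem⟩, h.label_eq, hs.adj',
    h.left_notMem, h.ext.2.2, hs.ne', hs.not_adj, hs.not_adj'⟩
  exact (switch_adj_iff_of_ne ⟨h.ext.2.2 i, h.ext.2.2 j⟩
    ⟨h.right_notMem i, h.right_notMem j⟩).symm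

/-- The sum of `g u * φ w` over all extensions. -/
noncomputable def extSum (R : SimpleGraph V → (ι → V) → Prop) (p : ι) (g : Finset V → (ι → V) → ℝ)
    (φ : Finset V → V → ℝ) (ω : SimpleGraph V × Finset V) : ℝ :=
  ∑ u, ∑ w, ind (Extends R p ω.1 u w) * (g ω.2 u * φ ω.2 w)

/-- The sum of `φ w'` over all edges `v' w'` with `v'` of class `c`. -/
noncomputable def edgeSum (label : V → Fin k) (c : Fin k) (φ : Finset V → V → ℝ)
    (ω : SimpleGraph V × Finset V) : ℝ :=
  ∑ v', ∑ w', ind (label v' = c ∧ ω.1.Adj v' w') * φ ω.2 w'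

/-- The switch, combined with the exchange of `w` and `w'`, is an involution of the index set that
reverses the sign of `φ w - φ w'`. -/
theorem IsSwitchClosed.sum_goodPair_antisymm (hΩ : IsSwitchClosed label deg Ω) (hR : IsLocal R)
    (g : Finset V → (ι → V) → ℝ) (φ : Finset V → V → ℝ)
    (Y : SimpleGraph V × Finset V → ℝ) :
    ∑ ω ∈ Ω, ∑ u, ∑ w, ∑ v', ∑ w', ind (GoodPair label R p ω.1 u w v' w') *
        (g ω.2 u * (φ ω.2 w - φ ω.2 w') * Y ω) =
      -∑ ω ∈ Ω, ∑ u, ∑ w, ∑ v', ∑ w', ind (GoodPair label R p ω.1 u w v' w') *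
        (g ω.2 u * (φ ω.2 w - φ ω.2 w') * Y (switch ω.1 (u p) w v' w', ω.2)) := by
  classical
  have conv : ∀ F : (SimpleGraph V × Finset V) → (ι → V) → V → V → V → ℝ,
      ∑ ω ∈ Ω, ∑ u, ∑ w, ∑ v', ∑ w', ind (GoodPair label R p ω.1 u w v' w') * F ω u w v' w' =
      ∑ q ∈ (Ω ×ˢ (Finset.univ : Finset ((ι → V) × V × V × V))).filter
        (fun q => GoodPair label R p q.1.1 q.2.1 q.2.2.1 q.2.2.2.1 q.2.2.2.2),
        F q.1 q.2.1 q.2.2.1 q.2.2.2.1 q.2.2.2.2 := by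
    intro F
    rw [Finset.sum_filter]
    simp only [Finset.sum_product, ← Finset.univ_product_univ, ← ind_mul_eq_ite]
  rw [conv (fun ω u w v' w' => g ω.2 u * (φ ω.2 w - φ ω.2 w') * Y ω),
    conv (fun ω u w v' w' => g ω.2 u * (φ ω.2 w - φ ω.2 w') *
      Y (switch ω.1 (u p) w v' w', ω.2)), ← Finset.sum_neg_distrib]
  let τ : (SimpleGraph V × Finset V) × (ι → V) × V × V × V →
      (SimpleGraph V × Finset V) × (ι → V) × V × V × V := fun q =>
    ((switch q.1.1 (q.2.1 p) q.2.2.1 q.2.2.2.1 q.2.2.2.2, q.1.2), q.2.1, q.2.2.2.2, q.2.2.2.1,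
      q.2.2.1)
  have hτ : ∀ q, GoodPair label R p q.1.1 q.2.1 q.2.2.1 q.2.2.2.1 q.2.2.2.2 → τ (τ q) = q := by
    rintro ⟨⟨G, S⟩, u, w, v', w'⟩ h
    simp only [τ]
    rw [h.switchable.switch_switch]
  have hτm : ∀ q ∈ (Ω ×ˢ (Finset.univ : Finset ((ι → V) × V × V × V))).filter
        (fun q => GoodPair label R p q.1.1 q.2.1 q.2.2.1 q.2.2.2.1 q.2.2.2.2),
      τ q ∈ (Ω ×ˢ (Finset.univ : Finset ((ι → V) × V × V × V))).filter
        (fun q => GoodPair label R p q.1.1 q.2.1 q.2.2.1 q.2.2.2.1 q.2.2.2.2) := by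
    rintro ⟨⟨G, S⟩, u, w, v', w'⟩ h
    simp only [Finset.mem_filter, Finset.mem_product, Finset.mem_univ, and_true, τ] at h ⊢
    exact ⟨hΩ.switch_mem _ h.1 _ _ _ _ h.2.label_eq h.2.switchable, h.2.switched hR⟩
  refine Finset.sum_nbij' τ τ hτm hτm (fun q hq => hτ q (Finset.mem_filter.1 hq).2)
    (fun q hq => hτ q (Finset.mem_filter.1 hq).2) ?_
  rintro ⟨⟨G, S⟩, u, w, v', w'⟩ h
  have h := (Finset.mem_filter.1 h).2
  simp only [τ]
  rw [h.switchable.switch_switch]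
  ring

/-- If the leaf `w` were the end of a uniformly chosen edge out of class `c`, the first factor would
be zero on average. It is a sum of `g u * (φ w - φ w')` over extensions and comparison edges `v'
w'`. For good pairs, antisymmetry replaces `extSum - y` by half its change under one switch, which
is at most `Lip`. The pairs that are not good are few, at most `B` for each extension. -/
theorem IsSwitchClosed.second_moment_le (hΩ : IsSwitchClosed label deg Ω) (hR : IsLocal R)
    {g : Finset V → (ι → V) → ℝ} {φ : Finset V → V → ℝ} {c : Fin k} {y N B Lip b Y : ℝ}
    (hφ : ∀ S v, |φ S v| ≤ b) (hg : ∀ S u, g S u ≠ 0 → label (u p) = c)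
    (hLip0 : 0 ≤ Lip) (hb0 : 0 ≤ b) (hN0 : 0 ≤ N) (hB0 : 0 ≤ B)
    (hN : ∀ ω ∈ Ω, ∑ u, ∑ w, ind (Extends R p ω.1 u w) * |g ω.2 u| ≤ N)
    (hB : ∀ ω ∈ Ω, ∀ u w, Extends R p ω.1 u w → ∑ v', ∑ w', ind ((label (u p) = label v' ∧
      ω.1.Adj v' w') ∧ ¬ GoodPair label R p ω.1 u w v' w') ≤ B)
    (hLip : ∀ ω ∈ Ω, ∀ u w v' w', GoodPair label R p ω.1 u w v' w' →
      |extSum R p g φ ω - extSum R p g φ (switch ω.1 (u p) w v' w', ω.2)| ≤ Lip)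
    (hY : ∀ ω ∈ Ω, |extSum R p g φ ω - y| ≤ Y) :
    ∑ ω ∈ Ω, (degSum label deg c * extSum R p g φ ω -
        extSum R p g (fun _ _ => 1) ω * edgeSum label c φ ω) * (extSum R p g φ ω - y) ≤
      Ω.card * (N * degSum label deg c * b * Lip + N * B * (2 * b) * Y) := by
  classical
  set Z := extSum R p g φ with hZ
  set M := degSum label deg c with hM
  set good : SimpleGraph V × Finset V → ℝ := fun ω => ∑ u, ∑ w, ∑ v', ∑ w',
    ind (GoodPair label R p ω.1 u w v' w') * (g ω.2 u * (φ ω.2 w - φ ω.2 w')) with hgood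
  have hM0 : 0 ≤ M := Finset.sum_nonneg fun v _ => mul_nonneg (ind_nonneg _) (Nat.cast_nonneg _)
  have hdiff : ∀ S v w, |φ S v - φ S w| ≤ 2 * b := fun S v w => by
    have := abs_sub (φ S v) (φ S w); linarith [hφ S v, hφ S w]
  have hMsum : ∀ ω ∈ Ω, ∑ v', ∑ w', ind (label v' = c ∧ ω.1.Adj v' w') = M := fun ω hω => by
    simp only [ind_and]; exact sum_ind_adj_mul_left (hΩ.degree ω hω) _
  have split : ∀ ω ∈ Ω, |(M * Z ω - extSum R p g (fun _ _ => 1) ω * edgeSum label c φ ω) -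
      good ω| ≤ N * B * (2 * b) := by
    intro ω hω
    have e1 : M * Z ω - extSum R p g (fun _ _ => 1) ω * edgeSum label c φ ω =
        ∑ u, ∑ w, ind (Extends R p ω.1 u w) * g ω.2 u * ∑ v', ∑ w',
          ind (label (u p) = label v' ∧ ω.1.Adj v' w') * (φ ω.2 w - φ ω.2 w') := by
      rw [hZ, extSum, extSum, Finset.mul_sum, Finset.sum_mul, ← Finset.sum_sub_distrib]
      refine Finset.sum_congr rfl fun u _ => ?_
      rw [Finset.mul_sum, Finset.sum_mul, ← Finset.sum_sub_distrib]
      refine Finset.sum_congr rfl fun w _ => ?_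
      by_cases h0 : g ω.2 u = 0
      · simp [h0]
      have hc := hg _ _ h0
      have : ∑ v', ∑ w', ind (label (u p) = label v' ∧ ω.1.Adj v' w') * (φ ω.2 w - φ ω.2 w') =
          M * φ ω.2 w - edgeSum label c φ ω := by
        rw [← hMsum ω hω, edgeSum]
        simp only [mul_sub, Finset.sum_sub_distrib, Finset.sum_mul, hc, eq_comm (a := c)]
      rw [this]; ring
    have e2 : M * Z ω - extSum R p g (fun _ _ => 1) ω * edgeSum label c φ ω - good ω =
        ∑ u, ∑ w, ind (Extends R p ω.1 u w) * (g ω.2 u * ∑ v', ∑ w',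
          ind ((label (u p) = label v' ∧ ω.1.Adj v' w') ∧ ¬ GoodPair label R p ω.1 u w v' w') *
            (φ ω.2 w - φ ω.2 w')) := by
      rw [e1, hgood]
      simp only [← Finset.sum_sub_distrib, Finset.mul_sum]
      refine Finset.sum_congr rfl fun u _ => Finset.sum_congr rfl fun w _ =>
        Finset.sum_congr rfl fun v' _ => Finset.sum_congr rfl fun w' _ => ?_
      by_cases hgp : GoodPair label R p ω.1 u w v' w'
      · simp [ind_of hgp, ind_of hgp.ext, ind_of hgp.label_eq, ind_of hgp.adj, ind_and, ind_not]
      · rw [ind_and (_ ∧ _), ind_of hgp, ind_of_not hgp]; ring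
    rw [e2]
    calc _ ≤ ∑ u, ∑ w, ind (Extends R p ω.1 u w) * |g ω.2 u| * (B * (2 * b)) := by
          refine (Finset.abs_sum_le_sum_abs _ _).trans (Finset.sum_le_sum fun u _ => ?_)
          refine (Finset.abs_sum_le_sum_abs _ _).trans (Finset.sum_le_sum fun w _ => ?_)
          rw [abs_mul, abs_of_nonneg (ind_nonneg _), abs_mul, mul_assoc]
          by_cases hE : Extends R p ω.1 u w
          · refine mul_le_mul_of_nonneg_left (mul_le_mul_of_nonneg_left ?_ (abs_nonneg _))
              (ind_nonneg _)
            refine le_trans ?_ (mul_le_mul_of_nonneg_right (hB ω hω u w hE)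
              (mul_nonneg two_pos.le hb0))
            rw [Finset.sum_mul]
            refine (Finset.abs_sum_le_sum_abs _ _).trans (Finset.sum_le_sum fun v' _ => ?_)
            rw [Finset.sum_mul]
            refine (Finset.abs_sum_le_sum_abs _ _).trans (Finset.sum_le_sum fun w' _ => ?_)
            rw [abs_mul, abs_of_nonneg (ind_nonneg _)]
            exact mul_le_mul_of_nonneg_left (hdiff _ _ _) (ind_nonneg _)
          · simp [ind_of_not hE]
      _ ≤ N * B * (2 * b) := by
          have := mul_le_mul_of_nonneg_right (hN ω hω) (mul_nonneg hB0 (mul_nonneg two_pos.le hb0))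
          simp only [Finset.sum_mul] at this
          rwa [mul_assoc N]
  have part1 : ∑ ω ∈ Ω, good ω * (Z ω - y) ≤ Ω.card * (N * M * b * Lip) := by
    have anti := hΩ.sum_goodPair_antisymm (p := p) hR g φ fun ω => Z ω - y
    have e1 : ∑ ω ∈ Ω, good ω * (Z ω - y) = ∑ ω ∈ Ω, ∑ u, ∑ w, ∑ v', ∑ w',
        ind (GoodPair label R p ω.1 u w v' w') *
          (g ω.2 u * (φ ω.2 w - φ ω.2 w') * (Z ω - y)) := by
      simp only [hgood, Finset.sum_mul, mul_assoc]
    -- Averaging the sum with its antisymmetric image leaves only the difference of `Z` before and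
    -- after the switch; the constant `y` cancels.
    have e2 : 2 * ∑ ω ∈ Ω, good ω * (Z ω - y) = ∑ ω ∈ Ω, ∑ u, ∑ w, ∑ v', ∑ w',
        ind (GoodPair label R p ω.1 u w v' w') * (g ω.2 u * (φ ω.2 w - φ ω.2 w') *
          (Z ω - Z (switch ω.1 (u p) w v' w', ω.2))) := by
      rw [two_mul, e1]
      nth_rw 2 [anti]
      rw [← sub_eq_add_neg]
      simp only [← Finset.sum_sub_distrib]
      refine Finset.sum_congr rfl fun ω _ => Finset.sum_congr rfl fun u _ =>
        Finset.sum_congr rfl fun w _ =>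
        Finset.sum_congr rfl fun v' _ => Finset.sum_congr rfl fun w' _ => ?_
      ring
    have e3 : 2 * ∑ ω ∈ Ω, good ω * (Z ω - y) ≤ ∑ ω ∈ Ω, N * (M * (2 * b * Lip)) := by
      rw [e2]
      refine Finset.sum_le_sum fun ω hω => ?_
      have hC : 0 ≤ M * (2 * b * Lip) :=
        mul_nonneg hM0 (mul_nonneg (mul_nonneg two_pos.le hb0) hLip0)
      refine le_trans ?_ (mul_le_mul_of_nonneg_right (hN ω hω) hC)
      rw [Finset.sum_mul]
      refine Finset.sum_le_sum fun u _ => ?_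
      rw [Finset.sum_mul]
      refine Finset.sum_le_sum fun w _ => ?_
      by_cases h0 : g ω.2 u = 0
      · simp [h0]
      have hc := hg _ _ h0
      rw [← hMsum ω hω, Finset.sum_mul, Finset.mul_sum]
      refine Finset.sum_le_sum fun v' _ => ?_
      rw [Finset.sum_mul, Finset.mul_sum]
      refine Finset.sum_le_sum fun w' _ => ?_
      by_cases hgp : GoodPair label R p ω.1 u w v' w'
      · rw [ind_of hgp, ind_of hgp.ext, ind_of ⟨hgp.label_eq.symm.trans hc, hgp.adj⟩]
        simp only [one_mul]
        refine (le_abs_self _).trans ?_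
        rw [abs_mul, abs_mul, mul_assoc]
        refine mul_le_mul_of_nonneg_left ?_ (abs_nonneg _)
        exact mul_le_mul (hdiff _ _ _) (hLip ω hω u w v' w' hgp) (abs_nonneg _)
          (mul_nonneg two_pos.le hb0)
      · rw [ind_of_not hgp, zero_mul]
        exact mul_nonneg (mul_nonneg (ind_nonneg _) (abs_nonneg _)) (mul_nonneg (ind_nonneg _)
          (mul_nonneg (mul_nonneg two_pos.le hb0) hLip0))
    rw [Finset.sum_const, nsmul_eq_mul] at e3
    nlinarith [e3]
  have part2 : ∑ ω ∈ Ω, ((M * Z ω - extSum R p g (fun _ _ => 1) ω * edgeSum label c φ ω) -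
      good ω) * (Z ω - y) ≤ Ω.card * (N * B * (2 * b) * Y) := by
    rw [← nsmul_eq_mul, ← Finset.sum_const]
    refine Finset.sum_le_sum fun ω hω => (le_abs_self _).trans ?_
    rw [abs_mul]
    exact mul_le_mul (split ω hω) (hY ω hω) (abs_nonneg _)
      (mul_nonneg (mul_nonneg hN0 hB0) (mul_nonneg two_pos.le hb0))
  have e : ∀ ω, (M * Z ω - extSum R p g (fun _ _ => 1) ω * edgeSum label c φ ω) * (Z ω - y) =
      good ω * (Z ω - y) + ((M * Z ω - extSum R p g (fun _ _ => 1) ω * edgeSum label c φ ω) -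
      good ω) * (Z ω - y) := fun ω => by ring
  simp only [e, Finset.sum_add_distrib]
  rw [mul_add]
  exact add_le_add part1 part2

/-- A pair fails only if `v'` or `w'` lies in the range of `u`, if `v' = w`, or if one of the two
edges to be inserted is already present. The last two cases are walks of length two. -/
theorem IsSwitchClosed.sum_not_goodPair_le (hΩ : IsSwitchClosed label deg Ω)
    (hΔ : ∀ v, (deg v : ℝ) ≤ Δ) {ω : SimpleGraph V × Finset V} (hω : ω ∈ Ω) {u : ι → V} {w : V}
    (h : Extends R p ω.1 u w) :
    ∑ v', ∑ w', ind ((label (u p) = label v' ∧ ω.1.Adj v' w') ∧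
      ¬ GoodPair label R p ω.1 u w v' w') ≤ 2 * Fintype.card ι * Δ + Δ + 2 * Δ ^ 2 := by
  have hG := hΩ.degree ω hω
  have pt : ∀ v' w', ind ((label (u p) = label v' ∧ ω.1.Adj v' w') ∧
      ¬ GoodPair label R p ω.1 u w v' w') ≤ ind (∃ i, u i = v') * ind (ω.1.Adj v' w') +
      ind (∃ i, u i = w') * ind (ω.1.Adj v' w') + ind (v' = w) * ind (ω.1.Adj v' w') +
      ind (ω.1.Adj (u p) w') * ind (ω.1.Adj v' w') +
      ind (ω.1.Adj v' w) * ind (ω.1.Adj v' w') := by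
    intro v' w'
    simp only [← ind_and]
    refine le_trans (ind_mono (q := (((((∃ i, u i = v') ∧ ω.1.Adj v' w') ∨
      ((∃ i, u i = w') ∧ ω.1.Adj v' w')) ∨ (v' = w ∧ ω.1.Adj v' w')) ∨
      (ω.1.Adj (u p) w' ∧ ω.1.Adj v' w')) ∨ (ω.1.Adj v' w ∧ ω.1.Adj v' w')) fun hh => ?_) ?_
    · obtain ⟨⟨h1, h2⟩, h3⟩ := hh
      by_contra hc
      simp only [h2, and_true, not_or, not_exists] at hc
      exact h3 ⟨h, h1, h2, hc.1.1.1.1, hc.1.1.1.2, hc.1.1.2, hc.1.2, hc.2⟩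
    · refine (ind_or_le _ _).trans (add_le_add ?_ le_rfl)
      refine (ind_or_le _ _).trans (add_le_add ?_ le_rfl)
      refine (ind_or_le _ _).trans (add_le_add (ind_or_le _ _) le_rfl)
  have sm := Finset.sum_le_sum fun v (_ : v ∈ Finset.univ) =>
    Finset.sum_le_sum fun w (_ : w ∈ Finset.univ) => pt v w
  simp only [Finset.sum_add_distrib] at sm
  have e1 := sum_ind_forall_ne_le hG hΔ u
  have e2 := sum_ind_forall_ne_le' hG hΔ u
  have e3 := sum_ind_adj_mul_left hG fun v => ind (v = w)
  have e4 := sum_sum_ind_adj_common_le hG hΔ (u p)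
  have e5 := sum_sum_ind_adj_common_le' hG hΔ w
  rw [sum_ind_eq_mul] at e3
  have := hΔ w
  linarith

theorem extends_switch_iff (hR : IsLocal R) {a b a' b' : V}
    (h : ∀ i, u i ≠ a ∧ u i ≠ b ∧ u i ≠ a' ∧ u i ≠ b') :
    Extends R p (switch G a b a' b') u w ↔ Extends R p G u w := by
  have e : ∀ i x, (switch G a b a' b').Adj (u i) x ↔ G.Adj (u i) x :=
    fun i x => switch_adj_iff_of_left_ne (h i)
  unfold Extends
  rw [e]
  exact ⟨fun hh => ⟨hR _ _ _ (fun i j => e i _) hh.1, hh.2⟩,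
    fun hh => ⟨hR _ _ _ (fun i j => (e i _).symm) hh.1, hh.2⟩⟩

/-- Only configurations meeting one of the four nodes of the switch are affected. The factor `8`
comes from four nodes in each of two graphs, and `C` bounds the configurations through a given node
at a given position. -/
theorem IsSwitchClosed.abs_extSum_sub_switch_le (hΩ : IsSwitchClosed label deg Ω) (hR : IsLocal R)
    {g : Finset V → (ι → V) → ℝ} {φ : Finset V → V → ℝ} {b C : ℝ} (hφ : ∀ S v, |φ S v| ≤ b)
    (hb0 : 0 ≤ b)
    (hC : ∀ ω ∈ Ω, ∀ i a, ∑ u, ∑ w, ind (Extends R p ω.1 u w ∧ u i = a) * |g ω.2 u| ≤ C)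
    {ω : SimpleGraph V × Finset V} (hω : ω ∈ Ω) (h : GoodPair label R p ω.1 u w v' w') :
    |extSum R p g φ ω - extSum R p g φ (switch ω.1 (u p) w v' w', ω.2)| ≤
      8 * Fintype.card ι * C * b := by
  set ω' : SimpleGraph V × Finset V := (switch ω.1 (u p) w v' w', ω.2) with hω'
  have hmem : ω' ∈ Ω := hΩ.switch_mem _ hω _ _ _ _ h.label_eq h.switchable
  -- The number of incidences of `x` with the four nodes; it is at least one wherever the two
  -- indicators can differ.
  set near : (ι → V) → ℝ := fun x =>
    ∑ i, (ind (x i = u p) + ind (x i = w) + ind (x i = v') + ind (x i = w')) with hnear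
  have hnear0 : ∀ x, 0 ≤ near x := fun x => Finset.sum_nonneg fun i _ => by
    have := ind_nonneg (x i = u p); have := ind_nonneg (x i = w)
    have := ind_nonneg (x i = v'); have := ind_nonneg (x i = w')
    linarith
  have pt : ∀ x z, |ind (Extends R p ω.1 x z) - ind (Extends R p ω'.1 x z)| ≤
      (ind (Extends R p ω.1 x z) + ind (Extends R p ω'.1 x z)) * near x := by
    intro x z
    have h1 := ind_nonneg (Extends R p ω.1 x z)
    have h2 := ind_nonneg (Extends R p ω'.1 x z)
    by_cases hx : ∀ i, x i ≠ u p ∧ x i ≠ w ∧ x i ≠ v' ∧ x i ≠ w'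
    · rw [ind_congr (extends_switch_iff hR hx), sub_self, abs_zero]
      exact mul_nonneg (add_nonneg h1 h1) (hnear0 x)
    · have h3 : 1 ≤ near x := by
        push Not at hx
        obtain ⟨i, hi⟩ := hx
        refine le_trans ?_ (Finset.single_le_sum (f := fun i => ind (x i = u p) + ind (x i = w) +
          ind (x i = v') + ind (x i = w')) (fun i _ => by
            have := ind_nonneg (x i = u p); have := ind_nonneg (x i = w)
            have := ind_nonneg (x i = v'); have := ind_nonneg (x i = w')
            linarith) (Finset.mem_univ i))
        have p1 := ind_nonneg (x i = u p); have p2 := ind_nonneg (x i = w)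
        have p3 := ind_nonneg (x i = v'); have p4 := ind_nonneg (x i = w')
        by_cases c1 : x i = u p
        · rw [ind_of c1]; linarith
        by_cases c2 : x i = w
        · rw [ind_of c2]; linarith
        by_cases c3 : x i = v'
        · rw [ind_of c3]; linarith
        rw [ind_of (hi c1 c2 c3)]; linarith
      rw [abs_le]
      constructor <;> nlinarith
  have cnt : ∀ η ∈ Ω, ∑ x, ∑ z, ind (Extends R p η.1 x z) * near x * |g η.2 x| ≤
      4 * Fintype.card ι * C := by
    intro η hη
    have e : ∀ x z, ind (Extends R p η.1 x z) * near x * |g η.2 x| =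
        ∑ i, (ind (Extends R p η.1 x z ∧ x i = u p) * |g η.2 x| +
          ind (Extends R p η.1 x z ∧ x i = w) * |g η.2 x| +
          ind (Extends R p η.1 x z ∧ x i = v') * |g η.2 x| +
          ind (Extends R p η.1 x z ∧ x i = w') * |g η.2 x|) := by
      intro x z
      rw [hnear, Finset.mul_sum, Finset.sum_mul]
      exact Finset.sum_congr rfl fun i _ => by simp only [ind_and]; ring
    have e' : ∑ x, ∑ z, ind (Extends R p η.1 x z) * near x * |g η.2 x| = ∑ i, (
        ∑ x, ∑ z, ind (Extends R p η.1 x z ∧ x i = u p) * |g η.2 x| +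
        ∑ x, ∑ z, ind (Extends R p η.1 x z ∧ x i = w) * |g η.2 x| +
        ∑ x, ∑ z, ind (Extends R p η.1 x z ∧ x i = v') * |g η.2 x| +
        ∑ x, ∑ z, ind (Extends R p η.1 x z ∧ x i = w') * |g η.2 x|) := by
      simp only [e, ← Finset.sum_add_distrib]
      rw [Finset.sum_congr rfl fun x _ => Finset.sum_comm, Finset.sum_comm]
    rw [e']
    calc _ ≤ ∑ _i : ι, (C + C + C + C) := Finset.sum_le_sum fun i _ =>
          add_le_add (add_le_add (add_le_add (hC η hη i _) (hC η hη i _)) (hC η hη i _))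
            (hC η hη i _)
      _ = _ := by rw [Finset.sum_const, Finset.card_univ, nsmul_eq_mul]; ring
  calc _ = |∑ x, ∑ z, (ind (Extends R p ω.1 x z) - ind (Extends R p ω'.1 x z)) *
          (g ω.2 x * φ ω.2 z)| := by
        simp only [extSum, ← Finset.sum_sub_distrib, sub_mul, hω']
    _ ≤ ∑ x, ∑ z, (ind (Extends R p ω.1 x z) * near x * |g ω.2 x| +
          ind (Extends R p ω'.1 x z) * near x * |g ω'.2 x|) * b := by
        refine (Finset.abs_sum_le_sum_abs _ _).trans (Finset.sum_le_sum fun x _ => ?_)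
        refine (Finset.abs_sum_le_sum_abs _ _).trans (Finset.sum_le_sum fun z _ => ?_)
        rw [abs_mul, abs_mul]
        calc _ ≤ (ind (Extends R p ω.1 x z) + ind (Extends R p ω'.1 x z)) * near x *
              (|g ω.2 x| * b) := by
              refine mul_le_mul (pt x z) (mul_le_mul_of_nonneg_left (hφ _ _) (abs_nonneg _))
                (by positivity) (mul_nonneg (add_nonneg (ind_nonneg _) (ind_nonneg _)) (hnear0 x))
          _ = _ := by rw [hω']; ring
    _ ≤ (4 * Fintype.card ι * C + 4 * Fintype.card ι * C) * b := by
        simp only [← Finset.sum_mul]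
        refine mul_le_mul_of_nonneg_right ?_ hb0
        simp only [Finset.sum_add_distrib]
        exact add_le_add (cnt ω hω) (cnt ω' hmem)
    _ = _ := by ring

end SecondMoment

end CompatEst

namespace CompatEst

set_option linter.unusedSectionVars false

/-! ### Random labelled sets -/

section Seeds

variable {V : Type*} [Fintype V] {k : ℕ} {label : V → Fin k}
  {Ω : Finset (SimpleGraph V × Finset V)}

open Classical in
/-- Replace the element `v` of `S` by `w`. -/
noncomputable def replaceElement (S : Finset V) (v w : V) : Finset V := insert w (S.erase v)

theorem mem_replaceElement {S : Finset V} {v w x : V} :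
    x ∈ replaceElement S v w ↔ x = w ∨ (x ≠ v ∧ x ∈ S) := by
  simp [replaceElement]

theorem replaceElement_replaceElement {S : Finset V} {v w : V} (hv : v ∈ S) (hw : w ∉ S) :
    replaceElement (replaceElement S v w) w v = S := by
  ext x; simp only [mem_replaceElement]; grind

/-- The argument for switchings, with the exchange of a labelled and an unlabelled node of the same
class. One exchange changes the sum by exactly `ψ w - ψ v`, so antisymmetry leaves half the sum of
`(ψ v - ψ w) ^ 2`. -/
theorem sum_seeds_le
    (hswap : ∀ ω ∈ Ω, ∀ v ∈ ω.2, ∀ w ∉ ω.2, label v = label w →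
      (ω.1, replaceElement ω.2 v w) ∈ Ω)
    {c : Fin k} {s : ℝ} (hs : ∀ ω ∈ Ω, ∑ v, ind (label v = c ∧ v ∈ ω.2) = s)
    {ψ : V → ℝ} {b : ℝ} (hψ : ∀ v, |ψ v| ≤ b) (y : ℝ) :
    ∑ ω ∈ Ω, ((∑ v, ind (label v = c)) * ∑ v, ind (label v = c ∧ v ∈ ω.2) * ψ v -
        s * ∑ v, ind (label v = c) * ψ v) *
        (∑ v, ind (label v = c ∧ v ∈ ω.2) * ψ v - y) ≤
      Ω.card * (2 * b ^ 2 * (∑ v, ind (label v = c)) ^ 2) := by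
  classical
  set Z : SimpleGraph V × Finset V → ℝ := fun ω => ∑ v, ind (label v = c ∧ v ∈ ω.2) * ψ v with hZ
  set N : ℝ := ∑ v, ind (label v = c) with hN
  set A : SimpleGraph V × Finset V → V → V → Prop := fun ω v w =>
    (label v = c ∧ v ∈ ω.2) ∧ label w = c ∧ w ∉ ω.2 with hA
  have e1 : ∀ ω ∈ Ω, N * Z ω - s * ∑ v, ind (label v = c) * ψ v =
      ∑ v, ∑ w, ind (A ω v w) * (ψ v - ψ w) := by
    intro ω hω
    have a1 : N * Z ω - s * ∑ v, ind (label v = c) * ψ v =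
        ∑ v, ∑ w, ind (label v = c ∧ v ∈ ω.2) * ind (label w = c) * (ψ v - ψ w) := by
      rw [← hs ω hω, hN, hZ, mul_comm, Finset.sum_mul_sum, Finset.sum_mul_sum,
        ← Finset.sum_sub_distrib]
      refine Finset.sum_congr rfl fun v _ => ?_
      rw [← Finset.sum_sub_distrib]
      exact Finset.sum_congr rfl fun w _ => by ring
    -- Pairs of two labelled nodes cancel, which leaves the pairs that can be exchanged.
    have a2 : ∑ v, ∑ w, ind (label v = c ∧ v ∈ ω.2) * ind (label w = c ∧ w ∈ ω.2) *
        (ψ v - ψ w) = 0 := by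
      have : ∑ v, ∑ w, ind (label v = c ∧ v ∈ ω.2) * ind (label w = c ∧ w ∈ ω.2) *
          (ψ v - ψ w) = -∑ v, ∑ w, ind (label v = c ∧ v ∈ ω.2) *
          ind (label w = c ∧ w ∈ ω.2) * (ψ v - ψ w) := by
        nth_rw 1 [Finset.sum_comm]
        simp only [← Finset.sum_neg_distrib]
        exact Finset.sum_congr rfl fun v _ => Finset.sum_congr rfl fun w _ => by ring
      linarith
    rw [a1, ← sub_zero (∑ v, ∑ w, _), ← a2]
    simp only [← Finset.sum_sub_distrib]
    refine Finset.sum_congr rfl fun v _ => Finset.sum_congr rfl fun w _ => ?_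
    rw [hA]; simp only [ind_and, ind_not]; ring
  have conv : ∀ F : (SimpleGraph V × Finset V) → V → V → ℝ,
      ∑ ω ∈ Ω, ∑ v, ∑ w, ind (A ω v w) * F ω v w =
      ∑ q ∈ (Ω ×ˢ (Finset.univ : Finset (V × V))).filter (fun q => A q.1 q.2.1 q.2.2),
        F q.1 q.2.1 q.2.2 := by
    intro F
    rw [Finset.sum_filter]
    simp only [Finset.sum_product, ← Finset.univ_product_univ, ← ind_mul_eq_ite]
  have hZ' : ∀ ω v w, A ω v w → Z (ω.1, replaceElement ω.2 v w) = Z ω - ψ v + ψ w := by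
    rintro ω v w ⟨⟨h1, h2⟩, h3, h4⟩
    have pt : ∀ x, ind (label x = c ∧ x ∈ replaceElement ω.2 v w) * ψ x =
        ind (label x = c ∧ x ∈ ω.2) * ψ x - ind (x = v) * ψ x + ind (x = w) * ψ x := by
      intro x
      have hvw : v ≠ w := by rintro rfl; exact h4 h2
      by_cases c1 : x = v
      · subst c1; simp [ind, mem_replaceElement, h1, h2, hvw]
      by_cases c2 : x = w
      · subst c2; simp [ind, mem_replaceElement, h3, h4, c1]
      simp [ind, mem_replaceElement, c1, c2]
    simp only [hZ, pt, Finset.sum_add_distrib, Finset.sum_sub_distrib, sum_ind_eq_mul]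
  have anti : ∑ ω ∈ Ω, ∑ v, ∑ w, ind (A ω v w) * ((ψ v - ψ w) * (Z ω - y)) =
      -∑ ω ∈ Ω, ∑ v, ∑ w, ind (A ω v w) * ((ψ v - ψ w) * (Z ω - y - (ψ v - ψ w))) := by
    rw [conv (fun ω v w => (ψ v - ψ w) * (Z ω - y)),
      conv (fun ω v w => (ψ v - ψ w) * (Z ω - y - (ψ v - ψ w))), ← Finset.sum_neg_distrib]
    let τ : (SimpleGraph V × Finset V) × V × V → (SimpleGraph V × Finset V) × V × V := fun q =>
      ((q.1.1, replaceElement q.1.2 q.2.1 q.2.2), q.2.2, q.2.1)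
    have hτ : ∀ q, A q.1 q.2.1 q.2.2 → τ (τ q) = q := by
      rintro ⟨⟨G, S⟩, v, w⟩ h
      simp only [τ]
      rw [replaceElement_replaceElement h.1.2 h.2.2]
    have hτm : ∀ q ∈ (Ω ×ˢ (Finset.univ : Finset (V × V))).filter
        (fun q => A q.1 q.2.1 q.2.2), τ q ∈ (Ω ×ˢ (Finset.univ : Finset (V × V))).filter
        (fun q => A q.1 q.2.1 q.2.2) := by
      rintro ⟨⟨G, S⟩, v, w⟩ h
      simp only [Finset.mem_filter, Finset.mem_product, Finset.mem_univ, and_true, τ] at h ⊢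
      obtain ⟨h0, ⟨h1, h2⟩, h3, h4⟩ := h
      refine ⟨hswap _ h0 v h2 w h4 (h1.trans h3.symm), ⟨h3, ?_⟩, h1, ?_⟩
      · exact mem_replaceElement.2 (Or.inl rfl)
      · simp only [mem_replaceElement]
        rintro (rfl | h)
        · exact h4 h2
        · exact h.1 rfl
    refine Finset.sum_nbij' τ τ hτm hτm (fun q hq => hτ q (Finset.mem_filter.1 hq).2)
      (fun q hq => hτ q (Finset.mem_filter.1 hq).2) ?_
    rintro ⟨⟨G, S⟩, v, w⟩ h
    have h := (Finset.mem_filter.1 h).2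
    simp only [τ]
    rw [hZ' _ _ _ h]
    ring
  have e2 : ∑ ω ∈ Ω, (N * Z ω - s * ∑ v, ind (label v = c) * ψ v) * (Z ω - y) =
      ∑ ω ∈ Ω, ∑ v, ∑ w, ind (A ω v w) * ((ψ v - ψ w) * (Z ω - y)) := by
    refine Finset.sum_congr rfl fun ω hω => ?_
    rw [e1 ω hω]
    simp only [Finset.sum_mul, mul_assoc]
  rw [e2]
  have e3 : 2 * ∑ ω ∈ Ω, ∑ v, ∑ w, ind (A ω v w) * ((ψ v - ψ w) * (Z ω - y)) =
      ∑ ω ∈ Ω, ∑ v, ∑ w, ind (A ω v w) * (ψ v - ψ w) ^ 2 := by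
    rw [two_mul]
    nth_rw 2 [anti]
    rw [← sub_eq_add_neg]
    simp only [← Finset.sum_sub_distrib]
    exact Finset.sum_congr rfl fun ω _ => Finset.sum_congr rfl fun v _ =>
      Finset.sum_congr rfl fun w _ => by ring
  have e4 : ∑ ω ∈ Ω, ∑ v, ∑ w, ind (A ω v w) * (ψ v - ψ w) ^ 2 ≤
      ∑ ω ∈ Ω, N ^ 2 * (2 * b) ^ 2 := by
    refine Finset.sum_le_sum fun ω _ => ?_
    rw [sq N, hN, Finset.sum_mul_sum, Finset.sum_mul]
    refine Finset.sum_le_sum fun v _ => ?_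
    rw [Finset.sum_mul]
    refine Finset.sum_le_sum fun w _ => ?_
    rw [← ind_and]
    refine mul_le_mul (ind_mono fun h => ⟨h.1.1, h.2.1⟩) ?_ (sq_nonneg _) (ind_nonneg _)
    rw [sq_le_sq]
    have h1 := abs_sub (ψ v) (ψ w)
    have h2 := le_abs_self (2 * b)
    linarith [hψ v, hψ w]
  rw [Finset.sum_const, nsmul_eq_mul] at e4
  nlinarith [e3, e4]

end Seeds

/-! ### Trees -/

/-- Trees with node set `Fin (m + 1)` in which every node is attached to an earlier one. -/
inductive Tree : ℕ → Type
  | single : Tree 0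
  | attach {m : ℕ} (T : Tree m) (p : Fin (m + 1)) : Tree (m + 1)

namespace Tree

/-- The set of edges of a tree. -/
def pairs : {m : ℕ} → Tree m → Finset (Sym2 (Fin (m + 1)))
  | _, single => ∅
  | _, attach T p => insert s(p.castSucc, Fin.last _) (T.pairs.image (Sym2.map Fin.castSucc))

/-- The degrees of the nodes of a tree. -/
def degree : {m : ℕ} → Tree m → Fin (m + 1) → ℕ
  | _, single => fun _ => 0
  | _, attach T p => Fin.snoc (α := fun _ => ℕ) (fun i => T.degree i + if i = p then 1 else 0) 1

/-- The distance between two nodes of a tree. -/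
def dist : {m : ℕ} → Tree m → Fin (m + 1) → Fin (m + 1) → ℕ
  | _, single => fun _ _ => 0
  | _, attach T p => Fin.snoc (α := fun _ => Fin _ → ℕ)
      (fun i => Fin.snoc (α := fun _ => ℕ) (fun j => T.dist i j) (T.dist i p + 1))
      (Fin.snoc (α := fun _ => ℕ) (fun j => T.dist p j + 1) 0)

variable {m : ℕ} (T : Tree m) (p : Fin (m + 1))

@[simp] theorem degree_attach_castSucc (i : Fin (m + 1)) :
    (T.attach p).degree i.castSucc = T.degree i + if i = p then 1 else 0 := by
  simp [degree]

@[simp] theorem degree_attach_last : (T.attach p).degree (Fin.last _) = 1 := by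
  simp [degree]

@[simp] theorem dist_attach_castSucc_castSucc (i j : Fin (m + 1)) :
    (T.attach p).dist i.castSucc j.castSucc = T.dist i j := by
  simp [dist]

@[simp] theorem dist_attach_castSucc_last (i : Fin (m + 1)) :
    (T.attach p).dist i.castSucc (Fin.last _) = T.dist i p + 1 := by
  simp [dist]

@[simp] theorem dist_attach_last_castSucc (j : Fin (m + 1)) :
    (T.attach p).dist (Fin.last _) j.castSucc = T.dist p j + 1 := by
  simp [dist]

@[simp] theorem dist_attach_last_last : (T.attach p).dist (Fin.last _) (Fin.last _) = 0 := by
  simp [dist]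

theorem last_notMem_map_castSucc {m : ℕ} (z : Sym2 (Fin m)) :
    Fin.last m ∉ z.map Fin.castSucc := by
  simp [Sym2.mem_map]

theorem pair_notMem_image : s(p.castSucc, Fin.last _) ∉
    T.pairs.image (Sym2.map Fin.castSucc) := by
  intro h
  obtain ⟨z, -, hz⟩ := Finset.mem_image.1 h
  exact last_notMem_map_castSucc z (hz ▸ Sym2.mem_mk_right _ _)

theorem card_pairs : {m : ℕ} → (T : Tree m) → T.pairs.card = m
  | _, single => rfl
  | _, attach T p => by
    rw [pairs, Finset.card_insert_of_notMem (T.pair_notMem_image p),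
      Finset.card_image_of_injective _ (Sym2.map.injective (Fin.castSucc_injective _)),
      card_pairs T]

theorem not_isDiag : {m : ℕ} → (T : Tree m) → ∀ z ∈ T.pairs, ¬ z.IsDiag
  | _, single => by simp [pairs]
  | _, attach T p => by
    intro z hz
    rw [pairs, Finset.mem_insert, Finset.mem_image] at hz
    rcases hz with rfl | ⟨y, hy, rfl⟩
    · simp
    · rw [Sym2.isDiag_map (Fin.castSucc_injective _)]
      exact not_isDiag T y hy

theorem castSucc_mem_map {m : ℕ} (i : Fin m) (z : Sym2 (Fin m)) :
    i.castSucc ∈ z.map Fin.castSucc ↔ i ∈ z := by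
  simp [Sym2.mem_map]

/-- Connects the recursive degree, suited to induction over trees, with the exponent in the copy
bound. -/
theorem pairDegree_pairs : {m : ℕ} → (T : Tree m) → ∀ i, pairDegree T.pairs i = T.degree i
  | _, single => by simp [pairDegree, pairs, degree]
  | _, attach (m := m) T p => by
    intro i
    have hinj : Function.Injective (Sym2.map (Fin.castSucc (n := m + 1))) :=
      Sym2.map.injective (Fin.castSucc_injective _)
    have hn := T.pair_notMem_image p
    simp only [pairDegree_eq, pairs, Finset.filter_insert]
    induction i using Fin.lastCases with
    | last =>
      rw [if_pos (Sym2.mem_mk_right _ _), Finset.filter_false_of_mem]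
      · simp
      · intro z hz
        obtain ⟨y, -, rfl⟩ := Finset.mem_image.1 hz
        exact last_notMem_map_castSucc y
    | cast i =>
      have e : ((T.pairs.image (Sym2.map Fin.castSucc)).filter fun z => i.castSucc ∈ z).card =
          T.degree i := by
        rw [← pairDegree_pairs T i, pairDegree_eq, Finset.filter_image,
          Finset.card_image_of_injective _ hinj]
        simp only [castSucc_mem_map]
      by_cases hi : i = p
      · subst hi
        rw [if_pos (Sym2.mem_mk_left _ _), Finset.card_insert_of_notMem
          (fun h => hn (Finset.mem_filter.1 h).1)]
        rw [degree_attach_castSucc, if_pos rfl, ← e]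
      · rw [if_neg, degree_attach_castSucc, if_neg hi, add_zero, ← e]
        simp only [Sym2.mem_iff, not_or]
        exact ⟨fun h => hi (Fin.castSucc_injective _ h), (Fin.castSucc_lt_last i).ne⟩

end Tree

theorem sum_snoc {α : Type*} [Fintype α] {m : ℕ} (F : (Fin (m + 1) → α) → ℝ) :
    ∑ x, F x = ∑ u : Fin m → α, ∑ w, F (Fin.snoc (α := fun _ => α) u w) := by
  rw [← Equiv.sum_comp (Fin.snocEquiv fun _ : Fin (m + 1) => α) F, Fintype.sum_prod_type,
    Finset.sum_comm]
  rfl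

/-! ### Copies of trees: recursion and bounds for nodes of bounded degree -/

section Copies

variable {V : Type*}

theorem isLocal_isCopy {ι : Type*} (E : Finset (Sym2 ι)) :
    IsLocal (fun (G : SimpleGraph V) (x : ι → V) => IsCopy E G x) := by
  intro G G' u h hu
  refine ⟨hu.1, fun z hz => ?_⟩
  have := hu.2 z hz
  induction z with
  | h i j => exact (h i j).1 this

/-- This identification lets `extSum` carry out the induction over trees. -/
theorem isCopy_attach_iff {m : ℕ} (T : Tree m) (p : Fin (m + 1)) (G : SimpleGraph V)
    (u : Fin (m + 1) → V) (w : V) :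
    IsCopy (T.attach p).pairs G (Fin.snoc (α := fun _ => V) u w) ↔
      Extends (fun G x => IsCopy T.pairs G x) p G u w := by
  have e : ∀ z : Sym2 (Fin (m + 1)), (z.map Fin.castSucc).map
      (Fin.snoc (α := fun _ => V) u w) = z.map u := by
    intro z
    rw [Sym2.map_map]
    congr 1
    funext i
    simp
  simp only [IsCopy, Extends, Tree.pairs, Finset.forall_mem_insert, Finset.forall_mem_image, e,
    Fin.snoc_injective_iff, Sym2.map_mk, Fin.snoc_castSucc, Fin.snoc_last,
    SimpleGraph.mem_edgeSet, Set.mem_range, not_exists]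
  tauto

variable [Fintype V] {k : ℕ} {label : V → Fin k} {deg : V → ℕ}
  {Ω : Finset (SimpleGraph V × Finset V)}

/-- With one node prescribed and all degrees at most `t`, each of the `m` remaining nodes has at
most `t` choices once a neighbor is placed. -/
theorem sum_isCopy_through_le {G : SimpleGraph V} (hG : ∀ v, ∑ w, ind (G.Adj v w) = deg v)
    (t : ℕ) : {m : ℕ} → (T : Tree m) → ∀ (i : Fin (m + 1)) (a : V),
    ∑ x : Fin (m + 1) → V, ind (IsCopy T.pairs G x ∧ (∀ j, deg (x j) ≤ t) ∧ x i = a) ≤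
      (t : ℝ) ^ m
  | _, .single => by
    intro i a
    rw [← (Equiv.funUnique (Fin 1) V).symm.sum_comp, pow_zero, ← sum_ind_eq a]
    refine Finset.sum_le_sum fun x _ => ind_mono fun h => ?_
    simpa using h.2.2
  | _, .attach (m := m) T p => by
    intro i a
    have ih := sum_isCopy_through_le hG t T
    have ht : (0 : ℝ) ≤ t := Nat.cast_nonneg _
    rw [sum_snoc]
    simp only [isCopy_attach_iff]
    have low : ∀ (u : Fin (m + 1) → V) w,
        (∀ j, deg ((Fin.snoc (α := fun _ => V) u w : Fin (m + 2) → V) j) ≤ t) ↔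
        (∀ j, deg (u j) ≤ t) ∧ deg w ≤ t := by
      intro u w
      rw [Fin.forall_fin_succ']
      simp
    simp only [low]
    induction i using Fin.lastCases with
    | last =>
      simp only [Fin.snoc_last]
      -- When the prescribed node is the new leaf, the sum is split according to the image `z` of
      -- its parent, one of at most `t` neighbors of `a`.
      calc _ ≤ ∑ u : Fin (m + 1) → V, ∑ w, ind (w = a) * ∑ z, ind (deg a ≤ t ∧ G.Adj a z) *
            ind (IsCopy T.pairs G u ∧ (∀ j, deg (u j) ≤ t) ∧ u p = z) := by
            refine Finset.sum_le_sum fun u _ => Finset.sum_le_sum fun w _ => ?_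
            rw [Finset.mul_sum]
            refine le_trans (ind_mono (q := w = a ∧ (deg a ≤ t ∧ G.Adj a (u p)) ∧
              (IsCopy T.pairs G u ∧ (∀ j, deg (u j) ≤ t) ∧ u p = u p)) ?_) ?_
            · rintro ⟨h1, ⟨h2, h3⟩, rfl⟩
              exact ⟨rfl, ⟨h3, h1.2.1.symm⟩, h1.1, h2, rfl⟩
            · rw [ind_and, ind_and]
              exact Finset.single_le_sum (f := fun z => ind (w = a) * (ind (deg a ≤ t ∧
                G.Adj a z) * ind (IsCopy T.pairs G u ∧ (∀ j, deg (u j) ≤ t) ∧ u p = z)))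
                (fun z _ => mul_nonneg (ind_nonneg _) (mul_nonneg (ind_nonneg _) (ind_nonneg _)))
                (Finset.mem_univ _)
        _ = ∑ z, ind (deg a ≤ t ∧ G.Adj a z) * ∑ u : Fin (m + 1) → V,
            ind (IsCopy T.pairs G u ∧ (∀ j, deg (u j) ≤ t) ∧ u p = z) := by
            simp only [← Finset.sum_mul, sum_ind_eq, one_mul]
            rw [Finset.sum_comm]
            simp only [Finset.mul_sum]
        _ ≤ ∑ z, ind (deg a ≤ t ∧ G.Adj a z) * (t : ℝ) ^ m :=
            Finset.sum_le_sum fun z _ => mul_le_mul_of_nonneg_left (ih p z) (ind_nonneg _)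
        _ ≤ t * (t : ℝ) ^ m := by
            rw [← Finset.sum_mul]
            refine mul_le_mul_of_nonneg_right ?_ (by positivity)
            simp only [ind_and, ← Finset.mul_sum, hG]
            by_cases h : deg a ≤ t
            · rw [ind_of h, one_mul]; exact_mod_cast h
            · rw [ind_of_not h, zero_mul]; exact ht
        _ = _ := by rw [pow_succ]; ring
    | cast i =>
      simp only [Fin.snoc_castSucc]
      calc _ ≤ ∑ u : Fin (m + 1) → V, ∑ w,
            ind (IsCopy T.pairs G u ∧ (∀ j, deg (u j) ≤ t) ∧ u i = a) * ind (G.Adj (u p) w) := by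
            refine Finset.sum_le_sum fun u _ => Finset.sum_le_sum fun w _ => ?_
            rw [← ind_and]
            exact ind_mono fun h => ⟨⟨h.1.1, h.2.1.1, h.2.2⟩, h.1.2.1⟩
        _ ≤ ∑ u : Fin (m + 1) → V,
            ind (IsCopy T.pairs G u ∧ (∀ j, deg (u j) ≤ t) ∧ u i = a) * (t : ℝ) := by
            refine Finset.sum_le_sum fun u _ => ?_
            rw [← Finset.mul_sum, hG]
            by_cases h : IsCopy T.pairs G u ∧ (∀ j, deg (u j) ≤ t) ∧ u i = a
            · exact mul_le_mul_of_nonneg_left (by exact_mod_cast h.2.1 p) (ind_nonneg _)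
            · simp [ind_of_not h]
        _ ≤ (t : ℝ) ^ m * t := by
            rw [← Finset.sum_mul]; exact mul_le_mul_of_nonneg_right (ih i a) ht
        _ = _ := (pow_succ _ _).symm

theorem sum_extends_through_le {G : SimpleGraph V} (hG : ∀ v, ∑ w, ind (G.Adj v w) = deg v)
    {t m : ℕ} (T : Tree m) (p i : Fin (m + 1)) (a : V) {g : (Fin (m + 1) → V) → ℝ} {b : ℝ}
    (hb0 : 0 ≤ b) (hg : ∀ u, |g u| ≤ b * ind (∀ j, deg (u j) ≤ t)) :
    ∑ u, ∑ w, ind (Extends (fun G x => IsCopy T.pairs G x) p G u w ∧ u i = a) * |g u| ≤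
      b * (t : ℝ) ^ (m + 1) := by
  have ht : (0 : ℝ) ≤ t := Nat.cast_nonneg _
  calc _ ≤ ∑ u : Fin (m + 1) → V, ∑ w, b *
        ind (IsCopy T.pairs G u ∧ (∀ j, deg (u j) ≤ t) ∧ u i = a) * ind (G.Adj (u p) w) := by
        refine Finset.sum_le_sum fun u _ => Finset.sum_le_sum fun w _ => ?_
        refine (mul_le_mul_of_nonneg_left (hg u) (ind_nonneg _)).trans ?_
        rw [mul_left_comm, mul_assoc, ← ind_and, ← ind_and]
        exact mul_le_mul_of_nonneg_left (ind_mono fun h => ⟨⟨h.1.1.1, h.2, h.1.2⟩, h.1.1.2.1⟩) hb0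
    _ ≤ ∑ u : Fin (m + 1) → V, b *
        (ind (IsCopy T.pairs G u ∧ (∀ j, deg (u j) ≤ t) ∧ u i = a) * (t : ℝ)) := by
        refine Finset.sum_le_sum fun u _ => ?_
        rw [← Finset.mul_sum, hG, mul_assoc]
        refine mul_le_mul_of_nonneg_left ?_ hb0
        by_cases h : IsCopy T.pairs G u ∧ (∀ j, deg (u j) ≤ t) ∧ u i = a
        · exact mul_le_mul_of_nonneg_left (by exact_mod_cast h.2.1 p) (ind_nonneg _)
        · simp [ind_of_not h]
    _ ≤ b * ((t : ℝ) ^ m * t) := by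
        rw [← Finset.mul_sum, ← Finset.sum_mul]
        exact mul_le_mul_of_nonneg_left
          (mul_le_mul_of_nonneg_right (sum_isCopy_through_le hG t T i a) ht) hb0
    _ = _ := by rw [pow_succ]

theorem sum_extends_le {G : SimpleGraph V} (hG : ∀ v, ∑ w, ind (G.Adj v w) = deg v)
    {t m : ℕ} (T : Tree m) (p : Fin (m + 1)) {g : (Fin (m + 1) → V) → ℝ} {b : ℝ}
    (hb0 : 0 ≤ b) (hg : ∀ u, |g u| ≤ b * ind (∀ j, deg (u j) ≤ t)) :
    ∑ u, ∑ w, ind (Extends (fun G x => IsCopy T.pairs G x) p G u w) * |g u| ≤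
      Fintype.card V * (b * (t : ℝ) ^ (m + 1)) := by
  calc _ = ∑ a : V, ∑ u, ∑ w,
        ind (Extends (fun G x => IsCopy T.pairs G x) p G u w ∧ u p = a) * |g u| := by
        symm
        rw [Finset.sum_comm]
        refine Finset.sum_congr rfl fun u _ => ?_
        rw [Finset.sum_comm]
        refine Finset.sum_congr rfl fun w _ => ?_
        rw [← Finset.sum_mul]
        congr 1
        simp only [ind_and, ← Finset.mul_sum, sum_ind_eq', mul_one]
    _ ≤ ∑ _a : V, b * (t : ℝ) ^ (m + 1) :=
        Finset.sum_le_sum fun a _ => sum_extends_through_le hG T p p a hb0 hg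
    _ = _ := by rw [Finset.sum_const, Finset.card_univ, nsmul_eq_mul]

theorem abs_extSum_le (hΩ : IsSwitchClosed label deg Ω) {t m : ℕ} (T : Tree m) (p : Fin (m + 1))
    {g : Finset V → (Fin (m + 1) → V) → ℝ} {φ : Finset V → V → ℝ} {b b' : ℝ}
    (hb0 : 0 ≤ b) (hb0' : 0 ≤ b') (hφ : ∀ S v, |φ S v| ≤ b')
    (hg : ∀ S u, |g S u| ≤ b * ind (∀ j, deg (u j) ≤ t)) {ω} (hω : ω ∈ Ω) :
    |extSum (fun G x => IsCopy T.pairs G x) p g φ ω| ≤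
      Fintype.card V * (b * (t : ℝ) ^ (m + 1)) * b' := by
  refine le_trans ?_ (mul_le_mul_of_nonneg_right
    (sum_extends_le (hΩ.degree ω hω) T p hb0 (hg ω.2)) hb0')
  rw [Finset.sum_mul]
  refine (Finset.abs_sum_le_sum_abs _ _).trans (Finset.sum_le_sum fun u _ => ?_)
  rw [Finset.sum_mul]
  refine (Finset.abs_sum_le_sum_abs _ _).trans (Finset.sum_le_sum fun w _ => ?_)
  rw [abs_mul, abs_mul, abs_of_nonneg (ind_nonneg _), mul_assoc]
  exact mul_le_mul_of_nonneg_left (mul_le_mul_of_nonneg_left (hφ _ _) (abs_nonneg _))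
    (ind_nonneg _)

/-- The second moment bound for sums over the copies of a tree with a new leaf. -/
theorem IsSwitchClosed.tree_second_moment_le {Δ : ℝ} (hΩ : IsSwitchClosed label deg Ω)
    (hΔ : ∀ v, (deg v : ℝ) ≤ Δ) {t m : ℕ} (T : Tree m) (p : Fin (m + 1))
    {g : Finset V → (Fin (m + 1) → V) → ℝ} {φ : Finset V → V → ℝ} {c : Fin k} {y b : ℝ}
    (hb0 : 0 ≤ b) (hφ : ∀ S v, |φ S v| ≤ b) (hc : ∀ S u, g S u ≠ 0 → label (u p) = c)
    (hg : ∀ S u, |g S u| ≤ b * ind (∀ j, deg (u j) ≤ t)) (hΔ0 : 0 ≤ Δ) :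
    ∑ ω ∈ Ω, (degSum label deg c * extSum (fun G x => IsCopy T.pairs G x) p g φ ω -
        extSum (fun G x => IsCopy T.pairs G x) p g (fun _ _ => 1) ω * edgeSum label c φ ω) *
        (extSum (fun G x => IsCopy T.pairs G x) p g φ ω - y) ≤
      Ω.card * ((Fintype.card V * (b * (t : ℝ) ^ (m + 1))) * degSum label deg c * b *
          (8 * (m + 1) * (b * (t : ℝ) ^ (m + 1)) * b) +
        (Fintype.card V * (b * (t : ℝ) ^ (m + 1))) * (2 * (m + 1) * Δ + Δ + 2 * Δ ^ 2) * (2 * b) *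
          (Fintype.card V * (b * (t : ℝ) ^ (m + 1)) * b + |y|)) := by
  have hR := isLocal_isCopy (V := V) T.pairs
  refine hΩ.second_moment_le hR hφ hc (by positivity) hb0 (by positivity) (by positivity)
    (fun ω hω => sum_extends_le (hΩ.degree ω hω) T p hb0 (hg ω.2)) ?_ ?_ ?_
  · intro ω hω u w h
    have := hΩ.sum_not_goodPair_le hΔ hω h
    simpa using this
  · intro ω hω u w v' w' h
    have := hΩ.abs_extSum_sub_switch_le hR hφ hb0
      (fun ω hω i a => sum_extends_through_le (hΩ.degree ω hω) T p i a hb0 (hg ω.2)) hω h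
    simpa using this
  · intro ω hω
    have := abs_extSum_le hΩ T p hb0 hb0 hφ hg hω
    have h2 := abs_sub (extSum (fun G x => IsCopy T.pairs G x) p g φ ω) y
    linarith

end Copies

end CompatEst

namespace CompatEst

/-! ### Expectations and convergence in mean -/

variable {k : ℕ}

namespace Planted

variable (P : Planted k)

/-- The finite set of outcomes. -/
noncomputable def outcomeFinset (n : ℕ) : Finset (SimpleGraph (Fin n) × Finset (Fin n)) :=
  (P.outcomes n).toFinite.toFinset

theorem mem_outcomeFinset {n : ℕ} {ω} : ω ∈ P.outcomeFinset n ↔ ω ∈ P.outcomes n := by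
  simp [outcomeFinset]

/-- The expectation when all outcomes are equally likely. -/
noncomputable def expect (n : ℕ) (Y : SimpleGraph (Fin n) × Finset (Fin n) → ℝ) : ℝ :=
  (∑ ω ∈ P.outcomeFinset n, Y ω) / (P.outcomeFinset n).card

variable {P} {n : ℕ} {Y Z : SimpleGraph (Fin n) × Finset (Fin n) → ℝ}

theorem expect_mono (h : ∀ ω ∈ P.outcomeFinset n, Y ω ≤ Z ω) : P.expect n Y ≤ P.expect n Z :=
  div_le_div_of_nonneg_right (Finset.sum_le_sum h) (Nat.cast_nonneg _)

theorem expect_congr (h : ∀ ω ∈ P.outcomeFinset n, Y ω = Z ω) : P.expect n Y = P.expect n Z := by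
  rw [expect, expect, Finset.sum_congr rfl h]

theorem expect_add : P.expect n (fun ω => Y ω + Z ω) = P.expect n Y + P.expect n Z := by
  rw [expect, Finset.sum_add_distrib, add_div]; rfl

theorem expect_const_mul (c : ℝ) : P.expect n (fun ω => c * Y ω) = c * P.expect n Y := by
  rw [expect, ← Finset.mul_sum, mul_div_assoc]; rfl

theorem expect_sum {ι : Type*} (s : Finset ι)
    (F : ι → SimpleGraph (Fin n) × Finset (Fin n) → ℝ) :
    P.expect n (fun ω => ∑ i ∈ s, F i ω) = ∑ i ∈ s, P.expect n (F i) := by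
  simp only [expect]
  rw [Finset.sum_comm, Finset.sum_div]

theorem expect_nonneg (h : ∀ ω ∈ P.outcomeFinset n, 0 ≤ Y ω) : 0 ≤ P.expect n Y :=
  div_nonneg (Finset.sum_nonneg h) (Nat.cast_nonneg _)

/-- Only an inequality, because the expectation is `0` when there are no outcomes. -/
theorem expect_const_le {c : ℝ} (hc : 0 ≤ c) : P.expect n (fun _ => c) ≤ c := by
  rw [expect, Finset.sum_const, nsmul_eq_mul]
  rcases eq_or_ne ((P.outcomeFinset n).card : ℝ) 0 with h | h
  · rw [h]; simpa using hc
  · rw [mul_div_assoc, mul_comm, div_mul_cancel₀ _ h]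

theorem expect_le_of_sum_le {c : ℝ} (hc : 0 ≤ c)
    (h : ∑ ω ∈ P.outcomeFinset n, Y ω ≤ (P.outcomeFinset n).card * c) : P.expect n Y ≤ c := by
  refine le_trans ?_ (P.expect_const_le (n := n) hc)
  rw [expect, expect, Finset.sum_const, nsmul_eq_mul]
  exact div_le_div_of_nonneg_right h (Nat.cast_nonneg _)

theorem prob_eq_expect (A : Set (SimpleGraph (Fin n) × Finset (Fin n))) :
    P.prob n A = P.expect n fun ω => ind (ω ∈ A) := by
  classical
  have h1 : (P.outcomes n).ncard = (P.outcomeFinset n).card :=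
    Set.ncard_eq_toFinset_card _ _
  have h2 : (P.outcomes n ∩ A).ncard = ((P.outcomeFinset n).filter (· ∈ A)).card := by
    rw [← Set.ncard_coe_finset]
    congr 1
    ext ω; simp [mem_outcomeFinset]
  rw [prob, expect, h1, h2, Finset.card_filter]
  push_cast
  congr 1

variable (P) in
/-- The random variables `Y n` converge in mean to the constant `y`. -/
def MeanLim (Y : ∀ n, SimpleGraph (Fin n) × Finset (Fin n) → ℝ) (y : ℝ) : Prop :=
  Tendsto (fun n => P.expect n fun ω => |Y n ω - y|) atTop (𝓝 0)

section MeanLim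

variable {Y Z : ∀ n, SimpleGraph (Fin n) × Finset (Fin n) → ℝ} {y z : ℝ}

theorem meanLim_of_le {u : ℕ → ℝ} (hu : Tendsto u atTop (𝓝 0))
    (h : ∀ᶠ n in atTop, P.expect n (fun ω => |Y n ω - y|) ≤ u n) : P.MeanLim Y y :=
  squeeze_zero' (Eventually.of_forall fun _ => expect_nonneg fun _ _ => abs_nonneg _) h hu

theorem MeanLim.congr (h : P.MeanLim Y y)
    (he : ∀ᶠ n in atTop, ∀ ω ∈ P.outcomeFinset n, Y n ω = Z n ω) : P.MeanLim Z y := by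
  refine meanLim_of_le h ?_
  filter_upwards [he] with n hn
  exact (expect_congr fun ω hω => by rw [hn ω hω]).le

theorem MeanLim.congr_lim (h : P.MeanLim Y y) (he : y = z) : P.MeanLim Y z := he ▸ h

theorem meanLim_of_tendsto {a : ℕ → ℝ} (h : Tendsto a atTop (𝓝 y)) :
    P.MeanLim (fun n _ => a n) y := by
  refine meanLim_of_le (u := fun n => |a n - y|) ?_
    (Eventually.of_forall fun n => expect_const_le (abs_nonneg _))
  simpa using (h.sub_const y).abs

theorem MeanLim.add (hY : P.MeanLim Y y) (hZ : P.MeanLim Z z) :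
    P.MeanLim (fun n ω => Y n ω + Z n ω) (y + z) := by
  have := Tendsto.add hY hZ
  rw [add_zero] at this
  refine meanLim_of_le this (Eventually.of_forall fun n => ?_)
  rw [← expect_add]
  refine expect_mono fun ω _ => ?_
  rw [add_sub_add_comm]; exact abs_add_le _ _

theorem MeanLim.const_mul (hY : P.MeanLim Y y) (c : ℝ) :
    P.MeanLim (fun n ω => c * Y n ω) (c * y) := by
  have := Tendsto.const_mul |c| hY
  rw [mul_zero] at this
  refine meanLim_of_le this (Eventually.of_forall fun n => ?_)
  rw [← expect_const_mul]
  refine expect_mono fun ω _ => ?_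
  rw [← mul_sub, abs_mul]

theorem meanLim_sum {ι : Type*} (s : Finset ι)
    {Y : ι → ∀ n, SimpleGraph (Fin n) × Finset (Fin n) → ℝ} {y : ι → ℝ}
    (h : ∀ i ∈ s, P.MeanLim (Y i) (y i)) :
    P.MeanLim (fun n ω => ∑ i ∈ s, Y i n ω) (∑ i ∈ s, y i) := by
  classical
  induction s using Finset.induction_on with
  | empty => simpa using P.meanLim_of_tendsto (tendsto_const_nhds (x := (0 : ℝ)))
  | insert a s ha ih =>
    simp only [Finset.sum_insert ha]
    exact (h a (Finset.mem_insert_self _ _)).add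
      (ih fun i hi => h i (Finset.mem_insert_of_mem hi))

/-- Convergence in mean is not closed under products; a uniform bound on one factor suffices. -/
theorem MeanLim.mul (hY : P.MeanLim Y y) (hZ : P.MeanLim Z z) {C : ℝ}
    (hC : ∀ᶠ n in atTop, ∀ ω ∈ P.outcomeFinset n, |Y n ω| ≤ C) :
    P.MeanLim (fun n ω => Y n ω * Z n ω) (y * z) := by
  have := (Tendsto.const_mul C hZ).add (Tendsto.const_mul |z| hY)
  rw [mul_zero, mul_zero, add_zero] at this
  refine meanLim_of_le this ?_
  filter_upwards [hC] with n hn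
  rw [← expect_const_mul, ← expect_const_mul, ← expect_add]
  refine expect_mono fun ω hω => ?_
  have e : Y n ω * Z n ω - y * z = Y n ω * (Z n ω - z) + z * (Y n ω - y) := by ring
  rw [e]
  refine (abs_add_le _ _).trans ?_
  rw [abs_mul, abs_mul]
  exact add_le_add_left (mul_le_mul_of_nonneg_right (hn ω hω) (abs_nonneg _)) _

theorem meanLim_of_sq
    (h : Tendsto (fun n => P.expect n fun ω => (Y n ω - y) ^ 2) atTop (𝓝 0)) :
    P.MeanLim Y y := by
  rw [MeanLim, Metric.tendsto_atTop]
  intro ε hε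
  have h2 : 0 < ε * (ε / 4) := by positivity
  obtain ⟨N, hN⟩ := (Metric.tendsto_atTop.1 h) _ h2
  refine ⟨N, fun n hn => ?_⟩
  have h3 := hN n hn
  rw [Real.dist_eq, sub_zero] at h3 ⊢
  rw [abs_of_nonneg (expect_nonneg fun _ _ => abs_nonneg _)]
  have h4 : P.expect n (fun ω => |Y n ω - y|) ≤
      P.expect n (fun ω => ε / 4 + ε⁻¹ * (Y n ω - y) ^ 2) := by
    refine expect_mono fun ω _ => ?_
    -- Expanding this square gives `|x| ≤ ε / 4 + x ^ 2 / ε`, a form of the Cauchy–Schwarz bound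
    -- that needs no normalization of the expectation.
    have h5 : 0 ≤ ε⁻¹ * (|Y n ω - y| - ε / 2) ^ 2 := by positivity
    have h6 : ε⁻¹ * (|Y n ω - y| - ε / 2) ^ 2 =
        ε⁻¹ * (Y n ω - y) ^ 2 - |Y n ω - y| + ε / 4 := by
      rw [sub_sq, sq_abs]; field_simp; ring
    linarith
  rw [expect_add (Y := fun _ => ε / 4), expect_const_mul] at h4
  have h5 := P.expect_const_le (n := n) (c := ε / 4) (by positivity)
  have h6 : ε⁻¹ * P.expect n (fun ω => (Y n ω - y) ^ 2) < ε⁻¹ * (ε * (ε / 4)) :=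
    mul_lt_mul_of_pos_left ((le_abs_self _).trans_lt h3) (by positivity)
  rw [inv_mul_cancel_left₀ hε.ne'] at h6
  linarith

/-- Used to remove the truncation of degrees: both the approximating variables and their limits may
depend on `ε`. -/
theorem meanLim_of_approx
    (h : ∀ ε > 0, ∃ (Z : ∀ n, SimpleGraph (Fin n) × Finset (Fin n) → ℝ) (z : ℝ),
      P.MeanLim Z z ∧ |z - y| ≤ ε ∧
        ∀ᶠ n in atTop, P.expect n (fun ω => |Y n ω - Z n ω|) ≤ ε) :
    P.MeanLim Y y := by
  rw [MeanLim, Metric.tendsto_nhds]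
  intro ε hε
  obtain ⟨Z, z, hZ, hz, hYZ⟩ := h (ε / 4) (by positivity)
  have h1 := (Metric.tendsto_nhds.1 hZ) (ε / 4) (by positivity)
  filter_upwards [h1, hYZ] with n h1 h2
  rw [Real.dist_eq, sub_zero] at h1 ⊢
  rw [abs_of_nonneg (expect_nonneg fun _ _ => abs_nonneg _)] at h1 ⊢
  have h3 : P.expect n (fun ω => |Y n ω - y|) ≤
      P.expect n (fun ω => |Y n ω - Z n ω| + (|Z n ω - z| + |z - y|)) := by
    refine expect_mono fun ω _ => ?_
    have := abs_sub_le (Y n ω) (Z n ω) y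
    have := abs_sub_le (Z n ω) z y
    linarith
  rw [expect_add, expect_add (Z := fun _ => |z - y|)] at h3
  have h4 := P.expect_const_le (n := n) (abs_nonneg (z - y))
  linarith

theorem MeanLim.of_sub (hZ : P.MeanLim Z y)
    (h : Tendsto (fun n => P.expect n fun ω => |Y n ω - Z n ω|) atTop (𝓝 0)) :
    P.MeanLim Y y := by
  refine meanLim_of_approx fun ε hε => ⟨Z, y, hZ, by simpa using hε.le, ?_⟩
  filter_upwards [(Metric.tendsto_nhds.1 h) ε hε] with n hn
  rw [Real.dist_eq, sub_zero] at hn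
  exact (le_abs_self _).trans hn.le

end MeanLim

theorem prob_le_expect {A : Set (SimpleGraph (Fin n) × Finset (Fin n))}
    (h : ∀ ω ∈ P.outcomeFinset n, ω ∈ A → 1 ≤ Y ω) (h0 : ∀ ω, 0 ≤ Y ω) :
    P.prob n A ≤ P.expect n Y := by
  rw [prob_eq_expect]
  refine expect_mono fun ω hω => ?_
  by_cases hA : ω ∈ A
  · rw [ind_of hA]; exact h ω hω hA
  · rw [ind_of_not hA]; exact h0 ω

theorem prob_nonneg (A : Set (SimpleGraph (Fin n) × Finset (Fin n))) : 0 ≤ P.prob n A :=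
  div_nonneg (Nat.cast_nonneg _) (Nat.cast_nonneg _)

/-- Convergence of the entries in mean implies convergence in probability of the
row-normalized matrix. -/
theorem convergesInProb_rowNormalize
    {C : ∀ n, SimpleGraph (Fin n) → Finset (Fin n) → Matrix (Fin k) (Fin k) ℝ}
    {L : Matrix (Fin k) (Fin k) ℝ}
    (h : ∀ c e, P.MeanLim (fun n ω => C n ω.1 ω.2 c e / n) (L c e))
    (hL : ∀ c, 0 < ∑ e, L c e) :
    P.ConvergesInProb (fun n G S => rowNormalize (C n G S)) (rowNormalize L) := by
  intro c e ε hε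
  set s := ∑ e', L c e' with hs
  have hs0 : 0 < s := hL c
  set B := rowNormalize L c e with hB
  have hBs : L c e - B * s = 0 := by
    rw [hB, rowNormalize, Matrix.of_apply, div_mul_cancel₀ _ hs0.ne', sub_self]
  have h1 : P.MeanLim (fun n ω => ∑ e', C n ω.1 ω.2 c e' / n) s :=
    meanLim_sum _ fun e' _ => h c e'
  -- Working with the entry minus `B` times the row sum, which tends to `0` in mean, avoids taking a
  -- limit of quotients.
  have h2 : P.MeanLim (fun n ω => C n ω.1 ω.2 c e / n + (-B) * ∑ e', C n ω.1 ω.2 c e' / n) 0 := by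
    have := (h c e).add (h1.const_mul (-B))
    rwa [neg_mul, ← sub_eq_add_neg, hBs] at this
  have h3 := (Tendsto.const_mul (2 / s) h1).add (Tendsto.const_mul (2 / (ε * s)) h2)
  rw [mul_zero, mul_zero, add_zero] at h3
  refine squeeze_zero' (Eventually.of_forall fun n => prob_nonneg _) ?_ h3
  filter_upwards [eventually_gt_atTop 0] with n hn
  rw [← expect_const_mul, ← expect_const_mul, ← expect_add]
  have hn' : (0 : ℝ) < n := by exact_mod_cast hn
  refine prob_le_expect ?_ fun ω => by positivity
  intro ω _ hω
  simp only [Set.mem_ofPred_eq] at hω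
  set x := C n ω.1 ω.2 c e / n
  set t := ∑ e', C n ω.1 ω.2 c e' / n with ht
  -- Markov's inequality for two events: either the row sum is off by at least `s / 2`, or it
  -- exceeds `s / 2` and then the numerator must be at least `ε * s / 2`.
  by_cases hlt : |t - s| < s / 2
  · have ht0 : s / 2 < t := by linarith [(abs_lt.1 hlt).1]
    have ht1 : 0 < t := by linarith
    have e1 : rowNormalize (C n ω.1 ω.2) c e - B = (x + -B * t) / t := by
      have : rowNormalize (C n ω.1 ω.2) c e = x / t := by
        rw [rowNormalize, Matrix.of_apply, ht, ← Finset.sum_div]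
        exact (div_div_div_cancel_right₀ hn'.ne' _ _).symm
      rw [this]; field_simp; ring
    rw [e1, abs_div, abs_of_pos ht1, le_div_iff₀ ht1] at hω
    have e2 : 1 ≤ 2 / (ε * s) * |x + -B * t - 0| := by
      rw [sub_zero, div_mul_eq_mul_div, le_div_iff₀ (by positivity)]
      nlinarith
    have : 0 ≤ 2 / s * |t - s| := by positivity
    linarith
  · have e2 : 1 ≤ 2 / s * |t - s| := by
      rw [div_mul_eq_mul_div, le_div_iff₀ hs0]; linarith
    have : 0 ≤ 2 / (ε * s) * |x + -B * t - 0| := by positivity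
    linarith

/-- Limits in probability are unique. -/
theorem ConvergesInProb.unique (hne : ∀ᶠ n in atTop, (P.outcomes n).Nonempty)
    {T : ∀ n : ℕ, SimpleGraph (Fin n) → Finset (Fin n) → Matrix (Fin k) (Fin k) ℝ}
    {L L' : Matrix (Fin k) (Fin k) ℝ} (h : P.ConvergesInProb T L) (h' : P.ConvergesInProb T L') :
    L = L' := by
  by_contra hne'
  obtain ⟨c, e, hce⟩ : ∃ c e, L c e ≠ L' c e := by
    by_contra hc; push Not at hc; exact hne' (Matrix.ext hc)
  have hpos : 0 < |L c e - L' c e| / 2 := by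
    have := abs_pos.2 (sub_ne_zero.2 hce); positivity
  have h3 := (h c e _ hpos).add (h' c e _ hpos)
  rw [add_zero] at h3
  obtain ⟨n, hn, hlt⟩ := (hne.and (h3.eventually (gt_mem_nhds zero_lt_one))).exists
  -- At every outcome the statistic is at least half the gap away from one of the two candidates.
  -- Having outcomes at all makes the total probability `1`.
  have : (1 : ℝ) ≤ P.prob n {ω | |L c e - L' c e| / 2 ≤ |T n ω.1 ω.2 c e - L c e|} +
      P.prob n {ω | |L c e - L' c e| / 2 ≤ |T n ω.1 ω.2 c e - L' c e|} := by
    rw [prob_eq_expect, prob_eq_expect, ← expect_add]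
    have hcard : ((P.outcomeFinset n).card : ℝ) ≠ 0 := by
      obtain ⟨ω, hω⟩ := hn
      have : 0 < (P.outcomeFinset n).card := Finset.card_pos.2 ⟨ω, P.mem_outcomeFinset.2 hω⟩
      positivity
    have e1 : P.expect n (fun _ => (1 : ℝ)) = 1 := by
      rw [expect, Finset.sum_const, nsmul_eq_mul, mul_one, div_self hcard]
    rw [← e1]
    refine expect_mono fun ω _ => ?_
    by_contra hlt
    push Not at hlt
    simp only [Set.mem_ofPred_eq] at hlt
    have n1 := ind_nonneg (|L c e - L' c e| / 2 ≤ |T n ω.1 ω.2 c e - L c e|)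
    have n2 := ind_nonneg (|L c e - L' c e| / 2 ≤ |T n ω.1 ω.2 c e - L' c e|)
    have m1 : ¬ |L c e - L' c e| / 2 ≤ |T n ω.1 ω.2 c e - L c e| := fun hh => by
      rw [ind_of hh] at hlt
      linarith
    have m2 : ¬ |L c e - L' c e| / 2 ≤ |T n ω.1 ω.2 c e - L' c e| := fun hh => by
      rw [ind_of hh] at hlt
      linarith
    have := abs_sub_le (L c e) (T n ω.1 ω.2 c e) (L' c e)
    rw [abs_sub_comm (L c e) (T n ω.1 ω.2 c e)] at this
    linarith
  linarith

end Planted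

end CompatEst

/-! ### Averages over nodes, tails and the largest degree in a regular sequence -/

namespace CompatEst

variable {k : ℕ}

/-- The mean of `ψ` under the degree law `μ`. -/
noncomputable def degMean (μ : PMF ℕ) (ψ : ℕ → ℝ) : ℝ := ∑' j : ℕ, ψ j * (μ j).toReal

theorem degMoment_eq_degMean (μ : PMF ℕ) (p : ℕ) :
    degMoment μ p = degMean μ fun j => (j : ℝ) ^ p := rfl

theorem degMean_const_mul (μ : PMF ℕ) (c : ℝ) (ψ : ℕ → ℝ) :
    degMean μ (fun j => c * ψ j) = c * degMean μ ψ := by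
  simp only [degMean, mul_assoc, tsum_mul_left]

theorem degMean_trunc (μ : PMF ℕ) (ψ : ℕ → ℝ) (t : ℕ) :
    degMean μ (fun j => ψ j * ind (j ≤ t)) = ∑ j ∈ Finset.range (t + 1), ψ j * (μ j).toReal := by
  rw [degMean, tsum_eq_sum (s := Finset.range (t + 1))]
  · refine Finset.sum_congr rfl fun j hj => ?_
    rw [ind_of (Nat.lt_succ_iff.1 (Finset.mem_range.1 hj)), mul_one]
  · intro j hj
    rw [ind_of_not (fun h => hj (Finset.mem_range.2 (Nat.lt_succ_of_le h)))]; simp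

namespace Planted

variable {P : Planted k} {H : Matrix (Fin k) (Fin k) ℝ} {f : ℝ} {μ : PMF ℕ} {p : ℕ}

theorem classSize_eq_sum (n : ℕ) (c : Fin k) :
    (P.classSize n c : ℝ) = ∑ v, ind (P.label n v = c) :=
  (sum_ind_eq_ncard _).symm

namespace IsRegular

theorem summable_of_le (h : P.IsRegular H f μ p) {ψ : ℕ → ℝ} {C : ℝ}
    (hψ : ∀ j, 1 ≤ j → |ψ j| ≤ C * (j : ℝ) ^ p) :
    Summable fun j => ψ j * (μ j).toReal := by
  refine Summable.of_norm_bounded_eventually_nat (h.moment_finite.mul_left C) ?_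
  filter_upwards [eventually_ge_atTop 1] with j hj
  rw [Real.norm_eq_abs, abs_mul, abs_of_nonneg ENNReal.toReal_nonneg, ← mul_assoc]
  exact mul_le_mul_of_nonneg_right (hψ j hj) ENNReal.toReal_nonneg

theorem tendsto_degMean_trunc (h : P.IsRegular H f μ p) {ψ : ℕ → ℝ} {C : ℝ}
    (hψ : ∀ j, 1 ≤ j → |ψ j| ≤ C * (j : ℝ) ^ p) :
    Tendsto (fun t => degMean μ fun j => ψ j * ind (j ≤ t)) atTop (𝓝 (degMean μ ψ)) := by
  simp only [degMean_trunc]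
  exact ((h.summable_of_le hψ).hasSum.tendsto_sum_nat).comp (tendsto_add_atTop_nat 1)

theorem tendsto_div_of_div_classSize (h : P.IsRegular H f μ p) {c : Fin k} {a : ℕ → ℝ} {x : ℝ}
    (ha : Tendsto (fun n => a n / P.classSize n c) atTop (𝓝 x)) :
    Tendsto (fun n => a n / n) atTop (𝓝 (x / k)) := by
  have h1 := ha.mul (h.balanced c)
  have hk : (0 : ℝ) < 1 / k := by
    have : 0 < k := c.pos
    positivity
  rw [mul_one_div] at h1
  refine h1.congr' ?_
  filter_upwards [(h.balanced c).eventually (lt_mem_nhds hk)] with n hn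
  have : (P.classSize n c : ℝ) ≠ 0 := by
    rintro h0; rw [h0, zero_div] at hn; exact lt_irrefl _ hn
  rw [div_mul_div_cancel₀ this]

/-- A truncated function takes only finitely many relevant degree values, so pointwise convergence
of the empirical law suffices. -/
theorem tendsto_avg_trunc (h : P.IsRegular H f μ p) (c : Fin k) {ψ : ℕ → ℝ} {t : ℕ}
    (ht : ∀ j, t < j → ψ j = 0) :
    Tendsto (fun n => (∑ v, ind (P.label n v = c) * ψ (P.deg n v)) / n) atTop
      (𝓝 (degMean μ ψ / k)) := by
  have e1 : ∀ n, ∑ v, ind (P.label n v = c) * ψ (P.deg n v) = ∑ j ∈ Finset.range (t + 1),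
      ψ j * (({v : Fin n | P.label n v = c ∧ P.deg n v = j}.ncard : ℕ) : ℝ) := by
    intro n
    simp only [← sum_ind_eq_ncard, Finset.mul_sum]
    rw [Finset.sum_comm]
    refine Finset.sum_congr rfl fun v _ => ?_
    by_cases hv : P.deg n v ≤ t
    · rw [Finset.sum_eq_single (P.deg n v)]
      · simp [mul_comm]
      · intro j _ hj; rw [ind_of_not fun h => hj h.2.symm, mul_zero]
      · intro hj; exact absurd (Finset.mem_range.2 (Nat.lt_succ_of_le hv)) hj
    · rw [ht _ (not_le.1 hv), mul_zero, Finset.sum_eq_zero]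
      intro j hj
      have := Finset.mem_range.1 hj
      rw [ind_of_not fun h => by omega, mul_zero]
  have e2 : degMean μ ψ = ∑ j ∈ Finset.range (t + 1), ψ j * (μ j).toReal := by
    rw [← degMean_trunc]; congr 1; funext j
    by_cases hj : j ≤ t
    · rw [ind_of hj, mul_one]
    · rw [ht j (not_le.1 hj), zero_mul]
  simp only [e1, e2, Finset.sum_div, mul_div_assoc]
  refine tendsto_finsetSum _ fun j _ => ?_
  exact (h.tendsto_div_of_div_classSize (h.degrees c j)).const_mul _

theorem tendsto_moment (h : P.IsRegular H f μ p) (c : Fin k) :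
    Tendsto (fun n => (∑ v, ind (P.label n v = c) * (P.deg n v : ℝ) ^ p) / n) atTop
      (𝓝 (degMoment μ p / k)) := by
  refine (h.tendsto_div_of_div_classSize (h.moment c)).congr fun n => ?_
  congr 1
  exact Finset.sum_congr rfl fun v _ => by rw [ind_mul_eq_ite]

/-- Uniform integrability: the tail is the full moment minus a truncated one, and both converge, the
former by assumption. -/
theorem class_tail_le (h : P.IsRegular H f μ p) (c : Fin k) {ε : ℝ} (hε : 0 < ε) :
    ∀ᶠ t : ℕ in atTop, ∀ᶠ n : ℕ in atTop,
      (∑ v, ind (P.label n v = c) * ((P.deg n v : ℝ) ^ p * ind (t < P.deg n v))) / n ≤ ε := by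
  have hk : (0 : ℝ) < k := by exact_mod_cast c.pos
  have h1 := h.tendsto_degMean_trunc (ψ := fun j => (j : ℝ) ^ p) (C := 1) fun j _ => by
    rw [one_mul, abs_of_nonneg (by positivity)]
  have h2 : Tendsto (fun t => degMoment μ p / k -
      degMean μ (fun j => (j : ℝ) ^ p * ind (j ≤ t)) / k) atTop (𝓝 0) := by
    have := (h1.div_const (k : ℝ)).const_sub (degMoment μ p / k)
    rwa [degMoment_eq_degMean, sub_self] at this
  filter_upwards [h2.eventually (gt_mem_nhds hε)] with t ht
  have h3 := (h.tendsto_moment c).sub (h.tendsto_avg_trunc c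
    (ψ := fun j => (j : ℝ) ^ p * ind (j ≤ t)) (t := t)
    fun j hj => by rw [ind_of_not (not_le.2 hj), mul_zero])
  filter_upwards [h3.eventually (gt_mem_nhds ht)] with n hn
  refine le_trans (le_of_eq ?_) hn.le
  rw [← sub_div, ← Finset.sum_sub_distrib]
  congr 1
  refine Finset.sum_congr rfl fun v _ => ?_
  rw [← mul_sub, ← mul_one_sub, ← ind_not]
  simp only [not_le]

theorem sum_classes {n : ℕ} (F : Fin n → ℝ) :
    ∑ c, ∑ v, ind (P.label n v = c) * F v = ∑ v, F v := by
  rw [Finset.sum_comm]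
  exact Finset.sum_congr rfl fun v _ => by rw [sum_ind_eq_mul' _ fun _ => F v]

theorem tail_le (h : P.IsRegular H f μ p) {ε : ℝ} (hε : 0 < ε) :
    ∀ᶠ t : ℕ in atTop, ∀ᶠ n : ℕ in atTop,
      (∑ v, (P.deg n v : ℝ) ^ p * ind (t < P.deg n v)) / n ≤ ε := by
  have hk : (0 : ℝ) < k + 1 := by positivity
  have h1 : ∀ᶠ t : ℕ in atTop, ∀ c, ∀ᶠ n : ℕ in atTop,
      (∑ v, ind (P.label n v = c) * ((P.deg n v : ℝ) ^ p * ind (t < P.deg n v))) / n ≤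
        ε / (k + 1) :=
    eventually_all.2 fun c => h.class_tail_le c (by positivity)
  filter_upwards [h1] with t ht
  filter_upwards [eventually_all.2 ht] with n hn
  rw [← sum_classes (P := P), Finset.sum_div]
  calc _ ≤ ∑ _c : Fin k, ε / (k + 1) := Finset.sum_le_sum fun c _ => hn c
    _ = k * (ε / (k + 1)) := by rw [Finset.sum_const, Finset.card_fin, nsmul_eq_mul]
    _ ≤ (k + 1) * (ε / (k + 1)) := by gcongr; linarith
    _ = ε := mul_div_cancel₀ _ hk.ne'

/-- The growth bound is not needed at `0`, because the cutoff is taken at least one and the tail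
then involves only positive degrees. -/
theorem tendsto_avg (h : P.IsRegular H f μ p) (c : Fin k) {ψ : ℕ → ℝ} {C : ℝ}
    (hψ : ∀ j, 1 ≤ j → |ψ j| ≤ C * (j : ℝ) ^ p) :
    Tendsto (fun n => (∑ v, ind (P.label n v = c) * ψ (P.deg n v)) / n) atTop
      (𝓝 (degMean μ ψ / k)) := by
  have hk : (0 : ℝ) < k := by exact_mod_cast c.pos
  have hC : 0 ≤ C := by simpa using (abs_nonneg _).trans (hψ 1 le_rfl)
  rw [Metric.tendsto_nhds]
  intro ε hε
  have h1 := ((h.tendsto_degMean_trunc hψ).div_const (k : ℝ))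
  have h2 := (Metric.tendsto_nhds.1 h1) (ε / 3) (by positivity)
  obtain ⟨t, ht1, ht2, ht3⟩ := (h2.and ((h.class_tail_le c (ε := ε / (3 * (C + 1)))
    (by positivity)).and (eventually_ge_atTop 1))).exists
  have h3 := (Metric.tendsto_nhds.1 (h.tendsto_avg_trunc c
    (ψ := fun j => ψ j * ind (j ≤ t)) (t := t)
    fun j hj => by rw [ind_of_not (not_le.2 hj), mul_zero])) (ε / 3) (by positivity)
  filter_upwards [ht2, h3] with n hn1 hn2
  have e1 : |(∑ v, ind (P.label n v = c) * ψ (P.deg n v)) / (n : ℝ) -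
      (∑ v, ind (P.label n v = c) * (ψ (P.deg n v) * ind (P.deg n v ≤ t))) / n| ≤
      C * ((∑ v, ind (P.label n v = c) * ((P.deg n v : ℝ) ^ p * ind (t < P.deg n v))) / n) := by
    rw [← sub_div, ← Finset.sum_sub_distrib, abs_div, abs_of_nonneg (Nat.cast_nonneg n : (0 : ℝ) ≤ n),
      ← mul_div_assoc]
    refine div_le_div_of_nonneg_right ?_ (Nat.cast_nonneg n)
    rw [Finset.mul_sum]
    refine (Finset.abs_sum_le_sum_abs _ _).trans (Finset.sum_le_sum fun v _ => ?_)
    rw [← mul_sub, ← mul_one_sub, ← ind_not, abs_mul, abs_mul, abs_of_nonneg (ind_nonneg _),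
      abs_of_nonneg (ind_nonneg _), mul_left_comm C, ← mul_assoc C]
    simp only [not_le]
    refine mul_le_mul_of_nonneg_left ?_ (ind_nonneg _)
    by_cases hv : t < P.deg n v
    · exact mul_le_mul_of_nonneg_right (hψ _ (ht3.trans hv.le)) (ind_nonneg _)
    · simp [ind_of_not hv]
  have e2 : C * (ε / (3 * (C + 1))) ≤ ε / 3 := by
    rw [mul_div_assoc', div_le_div_iff₀ (by positivity) (by positivity)]
    nlinarith
  have e3 := mul_le_mul_of_nonneg_left hn1 hC
  rw [Real.dist_eq] at ht1 hn2 ⊢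
  have := abs_sub_le ((∑ v, ind (P.label n v = c) * ψ (P.deg n v)) / (n : ℝ))
    ((∑ v, ind (P.label n v = c) * (ψ (P.deg n v) * ind (P.deg n v ≤ t))) / n)
    (degMean μ ψ / k)
  have := abs_sub_le
    ((∑ v, ind (P.label n v = c) * (ψ (P.deg n v) * ind (P.deg n v ≤ t))) / (n : ℝ))
    (degMean μ (fun j => ψ j * ind (j ≤ t)) / k) (degMean μ ψ / k)
  linarith

theorem natCast_le_pow (hp : 1 ≤ p) (j : ℕ) : (j : ℝ) ≤ (j : ℝ) ^ p := by
  exact_mod_cast Nat.le_self_pow (by omega) j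

theorem tendsto_degSum (h : P.IsRegular H f μ p) (hp : 1 ≤ p) (c : Fin k) :
    Tendsto (fun n => degSum (P.label n) (P.deg n) c / n) atTop (𝓝 (degMoment μ 1 / k)) := by
  have := h.tendsto_avg c (ψ := fun j => (j : ℝ)) (C := 1) fun j _ => by
    rw [one_mul, abs_of_nonneg (Nat.cast_nonneg _)]; exact natCast_le_pow hp j
  simpa only [degSum, degMoment_eq_degMean, pow_one] using this

theorem degMoment_one_pos (h : P.IsRegular H f μ p) (hp : 1 ≤ p) : 0 < degMoment μ 1 := by
  obtain ⟨j, hj, hj'⟩ := h.degree_two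
  have hs := h.summable_of_le (ψ := fun j => (j : ℝ) ^ 1) (C := 1) fun j _ => by
    rw [one_mul, abs_of_nonneg (by positivity), pow_one]; exact natCast_le_pow hp j
  refine hs.tsum_pos (fun i => mul_nonneg (by positivity) ENNReal.toReal_nonneg) j ?_
  have : 0 < (μ j).toReal := ENNReal.toReal_pos hj' (μ.apply_ne_top j)
  have : (0 : ℝ) < j := by exact_mod_cast (show 0 < j by omega)
  positivity

end IsRegular

theorem isSwitchClosed (P : Planted k) (n : ℕ) :
    IsSwitchClosed (P.label n) (P.deg n) (P.outcomeFinset n) where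
  degree ω hω v := by
    rw [← ((P.mem_outcomeFinset).1 hω).1 v, ncard_neighborSet]
  switch_mem ω hω a b a' b' hl hs := by
    rw [mem_outcomeFinset] at hω ⊢
    refine ⟨fun v => ?_, ?_, hω.2.2⟩
    · rw [hs.ncard_neighborSet_switch]; exact hω.1 v
    · rw [hs.classCounts_switch _ hl]; exact hω.2.1

theorem sum_seeds (P : Planted k) {n : ℕ} (c : Fin k) :
    ∀ ω ∈ P.outcomeFinset n, ∑ v, ind (P.label n v = c ∧ v ∈ ω.2) = P.seeds n c := by
  intro ω hω
  rw [← ((P.mem_outcomeFinset).1 hω).2.2 c, sum_ind_eq_ncard]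
  simp only [and_comm]

theorem replaceElement_mem (P : Planted k) {n : ℕ} : ∀ ω ∈ P.outcomeFinset n, ∀ v ∈ ω.2,
    ∀ w ∉ ω.2, P.label n v = P.label n w →
      (ω.1, replaceElement ω.2 v w) ∈ P.outcomeFinset n := by
  intro ω hω v hv w hw hl
  rw [mem_outcomeFinset] at hω ⊢
  refine ⟨hω.1, hω.2.1, fun c => ?_⟩
  rw [← hω.2.2 c]
  have : ((({x | x ∈ replaceElement ω.2 v w ∧ P.label n x = c} : Set _).ncard : ℕ) : ℝ) =
      ({x | x ∈ ω.2 ∧ P.label n x = c} : Set _).ncard := by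
    rw [← sum_ind_eq_ncard, ← sum_ind_eq_ncard]
    have pt : ∀ x, ind (x ∈ replaceElement ω.2 v w ∧ P.label n x = c) =
        ind (x ∈ ω.2 ∧ P.label n x = c) - ind (x = v) * ind (P.label n x = c) +
          ind (x = w) * ind (P.label n x = c) := by
      intro x
      have hvw : v ≠ w := by rintro rfl; exact hw hv
      by_cases c1 : x = v
      · subst c1; simp [ind, mem_replaceElement, hv, hvw]
      by_cases c2 : x = w
      · subst c2; simp [ind, mem_replaceElement, hw, c1]
      simp [ind, mem_replaceElement, c1, c2]
    simp only [pt, Finset.sum_add_distrib, Finset.sum_sub_distrib, sum_ind_eq_mul, hl]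
    ring
  exact_mod_cast this

theorem sum_edgeCounts (P : Planted k) {n : ℕ} (c e : Fin k) :
    ∀ ω ∈ P.outcomeFinset n, ∑ v, ∑ w, ind (P.label n v = c) * ind (P.label n w = e) *
      ind (ω.1.Adj v w) = P.edgeCounts n c e := by
  intro ω hω
  rw [← ((P.mem_outcomeFinset).1 hω).2.1, classCounts_apply]
  simp [adjacency_apply]

namespace IsRegular

/-- Row `c` of the edge counts sums to the total degree of class `c`, which is asymptotically `n * d
/ k`. -/
theorem tendsto_edgeCounts (h : P.IsRegular H f μ p) (hp : 1 ≤ p) (c e : Fin k) :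
    Tendsto (fun n => P.edgeCounts n c e / n) atTop (𝓝 (H c e * (degMoment μ 1 / k))) := by
  have h1 := (h.planted c e).mul (h.tendsto_degSum hp c)
  have hk : (0 : ℝ) < k := by exact_mod_cast c.pos
  have hd := div_pos (h.degMoment_one_pos hp) hk
  refine h1.congr' ?_
  filter_upwards [h.nonempty, (h.tendsto_degSum hp c).eventually (lt_mem_nhds hd)] with n hn hd
  obtain ⟨ω, hω⟩ := hn
  have hω := P.mem_outcomeFinset.2 hω
  have e1 : ∑ e', P.edgeCounts n c e' = degSum (P.label n) (P.deg n) c := by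
    simp only [← P.sum_edgeCounts c _ ω hω]
    rw [Finset.sum_comm, degSum]
    refine Finset.sum_congr rfl fun v _ => ?_
    rw [Finset.sum_comm, ← (P.isSwitchClosed n).degree ω hω v, Finset.mul_sum]
    refine Finset.sum_congr rfl fun w _ => ?_
    rw [← Finset.sum_mul, ← Finset.mul_sum, sum_ind_eq', mul_one]
  have hne : degSum (P.label n) (P.deg n) c ≠ 0 := by
    rintro h0; rw [h0, zero_div] at hd; exact lt_irrefl _ hd
  rw [rowNormalize, Matrix.of_apply, e1, div_mul_div_cancel₀ hne]

end IsRegular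

/-- The largest degree. -/
def maxDeg (P : Planted k) (n : ℕ) : ℕ := Finset.univ.sup (P.deg n)

theorem deg_le_maxDeg (P : Planted k) {n : ℕ} (v : Fin n) : (P.deg n v : ℝ) ≤ P.maxDeg n := by
  exact_mod_cast Finset.le_sup (Finset.mem_univ v)

namespace IsRegular

/-- A single large degree is already controlled by the tail sum. With `p ≥ 2` this makes the square
of the largest degree `o(n)`, so obstructions to switching are negligible. -/
theorem tendsto_maxDeg_pow (h : P.IsRegular H f μ p) :
    Tendsto (fun n => (P.maxDeg n : ℝ) ^ p / n) atTop (𝓝 0) := by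
  rw [Metric.tendsto_nhds]
  intro ε hε
  obtain ⟨t, ht⟩ := (h.tail_le (ε := ε / 4) (by positivity)).exists
  have h2 : Tendsto (fun n : ℕ => (t : ℝ) ^ p / n) atTop (𝓝 0) :=
    tendsto_const_div_atTop_nhds_zero_nat _
  filter_upwards [ht, h2.eventually (gt_mem_nhds (show 0 < ε / 4 by positivity)),
    eventually_gt_atTop 0] with n hn hn2 hn0
  rw [Real.dist_eq, sub_zero, abs_of_nonneg (by positivity)]
  have : Nonempty (Fin n) := ⟨⟨0, hn0⟩⟩
  obtain ⟨v, -, hv⟩ := Finset.exists_mem_eq_sup Finset.univ Finset.univ_nonempty (P.deg n)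
  have hv : P.maxDeg n = P.deg n v := hv
  have e1 : (P.maxDeg n : ℝ) ^ p ≤
      (t : ℝ) ^ p + ∑ v, (P.deg n v : ℝ) ^ p * ind (t < P.deg n v) := by
    by_cases hlt : t < P.deg n v
    · have := Finset.single_le_sum (f := fun v => (P.deg n v : ℝ) ^ p * ind (t < P.deg n v))
        (fun v _ => mul_nonneg (by positivity) (ind_nonneg _)) (Finset.mem_univ v)
      simp only [ind_of hlt, mul_one] at this
      rw [hv]
      have : (0 : ℝ) ≤ (t : ℝ) ^ p := by positivity
      linarith
    · have h3 : (P.maxDeg n : ℝ) ^ p ≤ (t : ℝ) ^ p := by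
        rw [hv]; gcongr; exact_mod_cast not_lt.1 hlt
      have : 0 ≤ ∑ v, (P.deg n v : ℝ) ^ p * ind (t < P.deg n v) :=
        Finset.sum_nonneg fun v _ => mul_nonneg (by positivity) (ind_nonneg _)
      linarith
  calc (P.maxDeg n : ℝ) ^ p / n ≤
        ((t : ℝ) ^ p + ∑ v, (P.deg n v : ℝ) ^ p * ind (t < P.deg n v)) / n := by gcongr
    _ < ε := by rw [add_div]; linarith

theorem tendsto_maxDeg_sq (h : P.IsRegular H f μ p) (hp : 2 ≤ p) :
    Tendsto (fun n => (P.maxDeg n : ℝ) ^ 2 / n) atTop (𝓝 0) := by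
  refine squeeze_zero (fun n => by positivity) (fun n => ?_) h.tendsto_maxDeg_pow
  have : (P.maxDeg n : ℝ) ^ 2 ≤ (P.maxDeg n : ℝ) ^ p := by
    rcases Nat.eq_zero_or_pos (P.maxDeg n) with h0 | h0
    · rw [h0]; simp [show p ≠ 0 by omega]
    · exact pow_le_pow_right₀ (by exact_mod_cast h0) hp
  gcongr

theorem tendsto_maxDeg (h : P.IsRegular H f μ p) (hp : 2 ≤ p) :
    Tendsto (fun n => (P.maxDeg n : ℝ) / n) atTop (𝓝 0) := by
  refine squeeze_zero (fun n => by positivity) (fun n => ?_) (h.tendsto_maxDeg_sq hp)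
  have : (P.maxDeg n : ℝ) ≤ (P.maxDeg n : ℝ) ^ 2 := natCast_le_pow (by norm_num) _
  gcongr

/-- The total of the `p`-th powers of the degrees is at most linear. -/
theorem exists_sum_pow_le (h : P.IsRegular H f μ p) :
    ∃ C : ℝ, 1 ≤ C ∧ ∀ᶠ n : ℕ in atTop, ∑ v, (P.deg n v : ℝ) ^ p ≤ C * n := by
  obtain ⟨t, ht⟩ := (h.tail_le (ε := 1) one_pos).exists
  refine ⟨(t : ℝ) ^ p + 1, by linarith [show (0 : ℝ) ≤ (t : ℝ) ^ p by positivity], ?_⟩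
  filter_upwards [ht, eventually_gt_atTop 0] with n hn hn0
  have hn' : (0 : ℝ) < n := by exact_mod_cast hn0
  rw [div_le_iff₀ hn'] at hn
  calc ∑ v, (P.deg n v : ℝ) ^ p ≤
        ∑ v, ((t : ℝ) ^ p + (P.deg n v : ℝ) ^ p * ind (t < P.deg n v)) := by
        refine Finset.sum_le_sum fun v _ => ?_
        by_cases hv : t < P.deg n v
        · rw [ind_of hv, mul_one]; linarith [show (0 : ℝ) ≤ (t : ℝ) ^ p by positivity]
        · rw [ind_of_not hv, mul_zero, add_zero]; gcongr; exact_mod_cast not_lt.1 hv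
    _ ≤ _ := by
        rw [Finset.sum_add_distrib, Finset.sum_const, Finset.card_fin, nsmul_eq_mul]
        linarith

end IsRegular

end Planted

end CompatEst

namespace CompatEst

variable {k : ℕ}

namespace Planted

variable {P : Planted k} {H : Matrix (Fin k) (Fin k) ℝ} {f : ℝ} {μ : PMF ℕ} {p : ℕ}

theorem numClasses_pos (P : Planted k) : 0 < k := (P.label 1 0).pos

namespace IsRegular

/-! ### Asymptotics of sums over copies -/

/-- The switching bound with `Q` equal to half of `n * d / k`, valid for large `n` since the
correction terms are `o(n)`. The constant `q` does not depend on the weights `w`. -/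
theorem exists_expect_isCopy_le (h : P.IsRegular H f μ p) (hp : 2 ≤ p) {m : ℕ}
    (E : Finset (Sym2 (Fin (m + 1)))) (hE : ∀ z ∈ E, ¬ z.IsDiag) :
    ∃ q : ℝ, 0 < q ∧ ∀ᶠ n : ℕ in atTop, ∀ w : Fin (m + 1) → Fin n → ℝ, (∀ i v, 0 ≤ w i v) →
      P.expect n (fun ω => ∑ x : Fin (m + 1) → Fin n, ind (IsCopy E ω.1 x) * ∏ i, w i (x i)) ≤
        (∏ i, ∑ v, w i v * (P.deg n v : ℝ) ^ pairDegree E i) / (q * n) ^ E.card := by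
  have hk : (0 : ℝ) < k := by exact_mod_cast P.numClasses_pos
  have hd := h.degMoment_one_pos (by omega)
  set δ := degMoment μ 1 / k with hδ
  have hδ0 : 0 < δ := div_pos hd hk
  refine ⟨δ / 2, by positivity, ?_⟩
  have lim : ∀ c, Tendsto (fun n : ℕ => degSum (P.label n) (P.deg n) c / n - (2 * (P.maxDeg n / n) +
      2 * ((P.maxDeg n : ℝ) ^ 2 / n) + 2 * E.card / n)) atTop (𝓝 δ) := by
    intro c
    have := (h.tendsto_degSum (by omega) c).sub ((((h.tendsto_maxDeg hp).const_mul 2).add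
      ((h.tendsto_maxDeg_sq hp).const_mul 2)).add
      (tendsto_const_div_atTop_nhds_zero_nat (2 * (E.card : ℝ))))
    simpa using this
  have ev : ∀ᶠ n in atTop, ∀ c, δ / 2 < degSum (P.label n) (P.deg n) c / n -
      (2 * (P.maxDeg n / n) + 2 * ((P.maxDeg n : ℝ) ^ 2 / n) + 2 * E.card / n) :=
    eventually_all.2 fun c => (lim c).eventually (lt_mem_nhds (by linarith))
  filter_upwards [ev, eventually_gt_atTop 0] with n hn hn0 w hw
  have hn' : (0 : ℝ) < n := by exact_mod_cast hn0
  have hQ : ∀ c, δ / 2 * n ≤ degSum (P.label n) (P.deg n) c -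
      (2 * (P.maxDeg n : ℝ) + 2 * (P.maxDeg n : ℝ) ^ 2 + 2 * E.card) := by
    intro c
    rw [← le_div_iff₀ hn']
    refine (hn c).le.trans (le_of_eq ?_)
    field_simp
  have hpos : 0 < (δ / 2 * n) ^ E.card := by positivity
  have main := (P.isSwitchClosed n).sum_isCopy_le (fun v => P.deg_le_maxDeg v) E hE
    (by positivity) hQ w hw
  refine expect_le_of_sum_le (div_nonneg (Finset.prod_nonneg fun i _ => Finset.sum_nonneg
    fun v _ => mul_nonneg (hw _ _) (by positivity)) hpos.le) ?_
  rwa [mul_div_assoc', le_div_iff₀ hpos]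

/-- Copies of a pattern with a cycle through nodes of bounded degree are rare. -/
theorem tendsto_expect_isCopy_low (h : P.IsRegular H f μ p) (hp : 2 ≤ p) {m : ℕ}
    (E : Finset (Sym2 (Fin (m + 1)))) (hE : ∀ z ∈ E, ¬ z.IsDiag) (hm : m + 1 ≤ E.card) (t : ℕ) :
    Tendsto (fun n : ℕ => P.expect n (fun ω => ∑ x : Fin (m + 1) → Fin n,
      ind (IsCopy E ω.1 x) * ind (∀ j, P.deg n (x j) ≤ t)) / n) atTop (𝓝 0) := by
  obtain ⟨q, hq, ev⟩ := h.exists_expect_isCopy_le hp E hE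
  set C : ℝ := (∏ i, (t : ℝ) ^ pairDegree E i) / q ^ E.card with hC
  refine squeeze_zero' (Eventually.of_forall fun n => div_nonneg (expect_nonneg fun _ _ =>
    Finset.sum_nonneg fun _ _ => mul_nonneg (ind_nonneg _) (ind_nonneg _)) (Nat.cast_nonneg n))
    ?_ (tendsto_const_div_atTop_nhds_zero_nat C)
  filter_upwards [ev, eventually_gt_atTop 0] with n hn hn0
  have hn' : (0 : ℝ) < n := by exact_mod_cast hn0
  have hn1 : (1 : ℝ) ≤ n := by exact_mod_cast hn0
  refine div_le_div_of_nonneg_right ?_ hn'.le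
  have e : ∀ x : Fin (m + 1) → Fin n, ind (∀ j, P.deg n (x j) ≤ t) ≤
      ∏ i, ind (P.deg n (x i) ≤ t) := by
    intro x
    by_cases hx : ∀ j, P.deg n (x j) ≤ t
    · rw [ind_of hx, Finset.prod_congr rfl fun i _ => ind_of (hx i)]; simp
    · rw [ind_of_not hx]; exact Finset.prod_nonneg fun i _ => ind_nonneg _
  refine (expect_mono fun ω _ => Finset.sum_le_sum fun x _ =>
    mul_le_mul_of_nonneg_left (e x) (ind_nonneg _)).trans ((hn (fun _ v => ind (P.deg n v ≤ t))
    fun _ _ => ind_nonneg _).trans ?_)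
  have e2 : ∏ i, ∑ v, ind (P.deg n v ≤ t) * (P.deg n v : ℝ) ^ pairDegree E i ≤
      ∏ i : Fin (m + 1), n * (t : ℝ) ^ pairDegree E i := by
    refine Finset.prod_le_prod (fun i _ => Finset.sum_nonneg fun v _ =>
      mul_nonneg (ind_nonneg _) (by positivity)) fun i _ => ?_
    calc _ ≤ ∑ _v : Fin n, (t : ℝ) ^ pairDegree E i := by
          refine Finset.sum_le_sum fun v _ => ?_
          by_cases hv : P.deg n v ≤ t
          · rw [ind_of hv, one_mul]; gcongr
          · rw [ind_of_not hv, zero_mul]; positivity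
      _ = _ := by rw [Finset.sum_const, Finset.card_fin, nsmul_eq_mul]
  rw [Finset.prod_mul_distrib, Finset.prod_const, Finset.card_fin] at e2
  rw [hC, div_le_div_iff₀ (by positivity) (by positivity)]
  -- A pattern with at least as many edges as nodes has a bounded expected number of low-degree
  -- copies, which vanishes after division by `n`.
  have e3 : (n : ℝ) ^ (m + 1) ≤ (n : ℝ) ^ E.card := pow_le_pow_right₀ hn1 hm
  have e4 : 0 ≤ ∏ i, (t : ℝ) ^ pairDegree E i := Finset.prod_nonneg fun i _ => by positivity
  calc _ ≤ ((n : ℝ) ^ (m + 1) * ∏ i, (t : ℝ) ^ pairDegree E i) * q ^ E.card := by gcongr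
    _ ≤ ((n : ℝ) ^ E.card * ∏ i, (t : ℝ) ^ pairDegree E i) * q ^ E.card := by gcongr
    _ = _ := by rw [mul_pow]; ring

/-- The sums over copies of a tree with a new leaf factorize asymptotically. -/
theorem meanLim_extSum (h : P.IsRegular H f μ p) (hp : 2 ≤ p) {t m : ℕ} (T : Tree m)
    (i : Fin (m + 1)) {g : ∀ n, Finset (Fin n) → (Fin (m + 1) → Fin n) → ℝ}
    {φ : ∀ n, Finset (Fin n) → Fin n → ℝ} {c : Fin k} {b α β : ℝ} (hb0 : 0 ≤ b)
    (hφ : ∀ n S v, |φ n S v| ≤ b) (hc : ∀ n S u, g n S u ≠ 0 → P.label n (u i) = c)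
    (hg : ∀ n S u, |g n S u| ≤ b * ind (∀ j, P.deg n (u j) ≤ t))
    (hα : P.MeanLim (fun n ω =>
      extSum (fun G x => IsCopy T.pairs G x) i (g n) (fun _ _ => 1) ω / n) α)
    (hβ : P.MeanLim (fun n ω => edgeSum (P.label n) c (φ n) ω / n) β) :
    P.MeanLim (fun n ω => extSum (fun G x => IsCopy T.pairs G x) i (g n) (φ n) ω / n)
      (α * β / (degMoment μ 1 / k)) := by
  have hk : (0 : ℝ) < k := by exact_mod_cast P.numClasses_pos
  have hd := h.degMoment_one_pos (by omega)
  set δ := degMoment μ 1 / k with hδ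
  have hδ0 : 0 < δ := div_pos hd hk
  set L := α * β / δ with hL
  have hLδ : δ * L = α * β := mul_div_cancel₀ _ hδ0.ne'
  set W := b * (t : ℝ) ^ (m + 1) with hW
  have hW0 : 0 ≤ W := by positivity
  set A : ∀ n, SimpleGraph (Fin n) × Finset (Fin n) → ℝ := fun n ω =>
    extSum (fun G x => IsCopy T.pairs G x) i (g n) (fun _ _ => 1) ω with hA
  set Φ : ∀ n, SimpleGraph (Fin n) × Finset (Fin n) → ℝ := fun n ω =>
    edgeSum (P.label n) c (φ n) ω with hΦ
  set Z : ∀ n, SimpleGraph (Fin n) × Finset (Fin n) → ℝ := fun n ω =>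
    extSum (fun G x => IsCopy T.pairs G x) i (g n) (φ n) ω with hZ
  set M : ℕ → ℝ := fun n => degSum (P.label n) (P.deg n) c with hM
  have hMlim : Tendsto (fun n => M n / n) atTop (𝓝 δ) := h.tendsto_degSum (by omega) c
  have hAb : ∀ᶠ n : ℕ in atTop, ∀ ω ∈ P.outcomeFinset n, |A n ω / n| ≤ W := by
    filter_upwards [eventually_gt_atTop 0] with n hn ω hω
    have hn' : (0 : ℝ) < n := by exact_mod_cast hn
    have := abs_extSum_le (P.isSwitchClosed n) T i hb0 zero_le_one (φ := fun _ _ => 1)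
      (fun _ _ => by simp) (hg n) hω
    rw [Fintype.card_fin, mul_one] at this
    rw [abs_div, abs_of_pos hn', div_le_iff₀ hn', mul_comm]
    exact this
  have hZb : ∀ᶠ n : ℕ in atTop, ∀ ω ∈ P.outcomeFinset n, |Z n ω / n| ≤ W * b := by
    filter_upwards [eventually_gt_atTop 0] with n hn ω hω
    have hn' : (0 : ℝ) < n := by exact_mod_cast hn
    have := abs_extSum_le (P.isSwitchClosed n) T i hb0 hb0 (hφ n) (hg n) hω
    rw [Fintype.card_fin, mul_assoc] at this
    rw [abs_div, abs_of_pos hn', div_le_iff₀ hn', mul_comm]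
    exact this
  -- Here `L` is the value for which `A Φ / n²` and `(M / n) L` have the same limit.
  have hprod : P.MeanLim (fun n ω => A n ω / n * (Φ n ω / n) + -(M n / n * L)) 0 := by
    have h1 := MeanLim.mul hα hβ hAb
    have h2 : P.MeanLim (fun n _ => -(M n / n * L)) (-(δ * L)) :=
      meanLim_of_tendsto (hMlim.mul_const L).neg
    have h3 := h1.add h2
    rwa [hLδ, add_neg_cancel] at h3
  refine meanLim_of_sq ?_
  set C1 := W * b * (8 * (m + 1) * W * b) with hC1
  set C2 := W * (2 * b) * (W * b + |L|) with hC2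
  have hC20 : 0 ≤ C2 := by positivity
  have lim : Tendsto (fun n : ℕ => 2 / δ * (C1 * (M n / n) * (1 / n) +
      C2 * ((2 * (m + 1) + 1) * (P.maxDeg n / n) + 2 * ((P.maxDeg n : ℝ) ^ 2 / n)) +
      (W * b + |L|) * P.expect n (fun ω => |A n ω / n * (Φ n ω / n) + -(M n / n * L) - 0|)))
      atTop (𝓝 0) := by
    have := (((((hMlim.const_mul C1).mul (tendsto_const_div_atTop_nhds_zero_nat (1 : ℝ))).add
      ((((h.tendsto_maxDeg hp).const_mul (2 * ((m : ℝ) + 1) + 1)).add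
        ((h.tendsto_maxDeg_sq hp).const_mul 2)).const_mul C2)).add
      (Tendsto.const_mul (W * b + |L|) hprod)).const_mul (2 / δ))
    simpa only [mul_zero, add_zero] using this
  refine squeeze_zero' (Eventually.of_forall fun n => expect_nonneg fun _ _ => sq_nonneg _) ?_ lim
  filter_upwards [hZb, eventually_gt_atTop 0, hMlim.eventually (lt_mem_nhds
    (show δ / 2 < δ by linarith))] with n hZb hn hMn
  have hn' : (0 : ℝ) < n := by exact_mod_cast hn
  have main := (P.isSwitchClosed n).tree_second_moment_le (fun v => P.deg_le_maxDeg v) T i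
    (g := g n) (φ := φ n) (c := c) (y := n * L) (b := b) (t := t) hb0 (hφ n) (hc n) (hg n)
    (Nat.cast_nonneg _)
  have hM0 : 0 ≤ M n := Finset.sum_nonneg fun v _ => mul_nonneg (ind_nonneg _) (Nat.cast_nonneg _)
  have hM1 : 0 ≤ degSum (P.label n) (P.deg n) c := hM0
  have hexp := expect_le_of_sum_le (by positivity) main
  have key : M n / n * P.expect n (fun ω => (Z n ω / n - L) ^ 2) ≤
      C1 * (M n / n) * (1 / n) +
      C2 * ((2 * (m + 1) + 1) * (P.maxDeg n / n) + 2 * ((P.maxDeg n : ℝ) ^ 2 / n)) +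
      (W * b + |L|) * P.expect n (fun ω => |A n ω / n * (Φ n ω / n) + -(M n / n * L) - 0|) := by
    have e1 : C1 * (M n / n) * (1 / n) +
        C2 * ((2 * (m + 1) + 1) * (P.maxDeg n / n) + 2 * ((P.maxDeg n : ℝ) ^ 2 / n)) =
        ((n : ℝ) ^ 3)⁻¹ * ((n * W) * M n * b * (8 * (m + 1) * W * b) +
        (n * W) * (2 * (m + 1) * P.maxDeg n + P.maxDeg n + 2 * (P.maxDeg n : ℝ) ^ 2) * (2 * b) *
          (n * W * b + |n * L|)) := by
      rw [abs_mul, abs_of_pos hn', hC1, hC2]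
      field_simp
    rw [e1, ← expect_const_mul, ← expect_const_mul]
    have hexp' : ((n : ℝ) ^ 3)⁻¹ * P.expect n (fun ω =>
        (M n * Z n ω - A n ω * Φ n ω) * (Z n ω - n * L)) ≤ _ :=
      mul_le_mul_of_nonneg_left hexp (by positivity)
    rw [← expect_const_mul] at hexp'
    simp only [Fintype.card_fin] at hexp'
    have e2 : P.expect n (fun ω => M n / n * (Z n ω / n - L) ^ 2) ≤
        P.expect n (fun ω => ((n : ℝ) ^ 3)⁻¹ * ((M n * Z n ω - A n ω * Φ n ω) *
          (Z n ω - n * L)) + (W * b + |L|) *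
          |A n ω / n * (Φ n ω / n) + -(M n / n * L) - 0|) := by
      refine expect_mono fun ω hω => ?_
      -- The first summand is controlled by the second moment bound, the second by `hprod` and the
      -- uniform bound on `Z / n`.
      have e3 : M n / n * (Z n ω / n - L) ^ 2 = ((n : ℝ) ^ 3)⁻¹ *
          ((M n * Z n ω - A n ω * Φ n ω) * (Z n ω - n * L)) +
          (A n ω / n * (Φ n ω / n) + -(M n / n * L) - 0) * (Z n ω / n - L) := by
        field_simp
        ring
      rw [e3]
      refine add_le_add le_rfl ((le_abs_self _).trans ?_)
      rw [abs_mul, mul_comm]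
      refine mul_le_mul_of_nonneg_right ?_ (abs_nonneg _)
      exact (abs_sub _ _).trans (add_le_add (hZb ω hω) le_rfl)
    rw [expect_add] at e2
    refine e2.trans (add_le_add (hexp'.trans (le_of_eq ?_)) le_rfl)
    rw [hW]
  have h0 : 0 ≤ P.expect n (fun ω => (Z n ω / n - L) ^ 2) := expect_nonneg fun _ _ => sq_nonneg _
  rw [div_mul_eq_mul_div, le_div_iff₀ hδ0]
  nlinarith

end IsRegular

end Planted

end CompatEst

/-! ### Asymptotic counts of trees with weighted nodes -/

namespace CompatEst

variable {k : ℕ}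

theorem sum_fin_one {α : Type*} [Fintype α] (F : (Fin 1 → α) → ℝ) :
    ∑ x, F x = ∑ a, F fun _ => a :=
  (Fintype.sum_equiv (Equiv.funUnique (Fin 1) α).symm _ _ fun _ => rfl).symm

theorem sum_ind_mem_pairs {ι : Type*} [Fintype ι] (E : Finset (Sym2 ι)) (i : ι) :
    ∑ j, ind (s(i, j) ∈ E) = pairDegree E i := by
  classical
  rw [pairDegree_eq]
  have : ((E.filter fun z => i ∈ z).card : ℝ) =
      ((Finset.univ.filter fun j => s(i, j) ∈ E).card : ℝ) := by
    norm_cast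
    symm
    refine Finset.card_nbij (fun j => s(i, j)) ?_ ?_ ?_
    · intro j hj
      simp only [Finset.coe_filter, Finset.mem_univ, true_and] at hj
      simpa using hj
    · intro j _ j' _ hjj
      simp only [Sym2.eq_iff] at hjj; grind
    · intro z hz
      have hz := Finset.mem_filter.1 (Finset.mem_coe.1 hz)
      obtain ⟨j, rfl⟩ := hz.2
      exact ⟨j, by simpa using hz.1, rfl⟩
  rw [this, Finset.card_filter]
  push_cast
  exact Finset.sum_congr rfl fun j _ => by simpa using ind_mul_eq_ite (s(i, j) ∈ E) 1

/-- The number of extensions of a copy of a tree differs from its expected value only if there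
are additional edges. -/
theorem abs_sum_extends_sub_le {V : Type*} [Fintype V] {deg : V → ℕ} {G : SimpleGraph V}
    (hG : ∀ v, ∑ w, ind (G.Adj v w) = deg v) {m : ℕ} (T : Tree m) (p : Fin (m + 1))
    (u : Fin (m + 1) → V) :
    |∑ w, ind (Extends (fun G x => IsCopy T.pairs G x) p G u w) -
      ind (IsCopy T.pairs G u) * ((deg (u p) : ℝ) - T.degree p)| ≤
      ∑ i, ind (p ≠ i ∧ s(p, i) ∉ T.pairs) * ind (IsCopy (insert s(p, i) T.pairs) G u) := by
  by_cases hu : IsCopy T.pairs G u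
  · have e1 : ∀ w, ind (Extends (fun G x => IsCopy T.pairs G x) p G u w) =
        ind (G.Adj (u p) w) - ∑ i, ind (u i = w) * ind (G.Adj (u p) w) := by
      intro w
      rw [← Finset.sum_mul, ← one_sub_mul]
      have : (1 : ℝ) - ∑ i, ind (u i = w) = ind (∀ i, u i ≠ w) := by
        by_cases hw : ∀ i, u i ≠ w
        · rw [ind_of hw, Finset.sum_eq_zero fun i _ => ind_of_not (hw i), sub_zero]
        · rw [ind_of_not hw]
          push Not at hw
          obtain ⟨i, rfl⟩ := hw
          rw [Finset.sum_congr rfl fun j _ => ind_congr (hu.1.eq_iff), sum_ind_eq, sub_self]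
      rw [this, ← ind_and]
      exact ind_congr ⟨fun h => ⟨h.2.2, h.2.1⟩, fun h => ⟨hu, h.2, h.1⟩⟩
    -- A neighbor of `u p` inside the copy is either a tree neighbor or witnesses a copy of the tree
    -- with one extra edge, hence with a cycle.
    have e2 : ∀ i, ind (G.Adj (u p) (u i)) = ind (s(p, i) ∈ T.pairs) +
        ind (p ≠ i ∧ s(p, i) ∉ T.pairs) * ind (IsCopy (insert s(p, i) T.pairs) G u) := by
      intro i
      by_cases hi : s(p, i) ∈ T.pairs
      · have : G.Adj (u p) (u i) := hu.2 _ hi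
        rw [ind_of this, ind_of hi, ind_of_not fun h => h.2 hi]; ring
      · rw [ind_of_not hi]
        by_cases hpi : p = i
        · subst hpi
          rw [ind_of_not (G.loopless.irrefl _), ind_of_not fun h => h.1 rfl]; ring
        · rw [ind_of (p := p ≠ i ∧ s(p, i) ∉ T.pairs) ⟨hpi, hi⟩, zero_add, one_mul]
          refine ind_congr ⟨fun h => ⟨hu.1, ?_⟩, fun h => h.2 _ (Finset.mem_insert_self _ _)⟩
          rw [Finset.forall_mem_insert]
          exact ⟨h, hu.2⟩
    have e3 : ∑ w, ind (Extends (fun G x => IsCopy T.pairs G x) p G u w) =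
        ((deg (u p) : ℝ) - T.degree p) -
        ∑ i, ind (p ≠ i ∧ s(p, i) ∉ T.pairs) * ind (IsCopy (insert s(p, i) T.pairs) G u) := by
      rw [Finset.sum_congr rfl fun w _ => e1 w, Finset.sum_sub_distrib, hG, Finset.sum_comm]
      simp only [sum_ind_eq_mul']
      rw [Finset.sum_congr rfl fun i _ => e2 i, Finset.sum_add_distrib,
        sum_ind_mem_pairs T.pairs, T.pairDegree_pairs]
      ring
    rw [e3, ind_of hu, one_mul, sub_sub_cancel_left, abs_neg, abs_of_nonneg]
    exact Finset.sum_nonneg fun i _ => mul_nonneg (ind_nonneg _) (ind_nonneg _)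
  · rw [ind_of_not hu, Finset.sum_eq_zero fun w _ => ind_of_not fun h => hu h.1]
    simp only [zero_mul, sub_self, abs_zero]
    exact Finset.sum_nonneg fun i _ => mul_nonneg (ind_nonneg _) (ind_nonneg _)

/-- The product of the entries of `H` along the edges of a tree with classes `γ`. -/
def Tree.classWeight (H : Matrix (Fin k) (Fin k) ℝ) : {m : ℕ} → Tree m → (Fin (m + 1) → Fin k) → ℝ
  | _, .single => fun _ => 1
  | _, .attach T p => fun γ => T.classWeight H (fun i => γ i.castSucc) *
      H (γ p.castSucc) (γ (Fin.last _))

/-- The asymptotic fraction of nodes satisfying a requirement to be labelled. -/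
def markFactor (f : ℝ) (b : Bool) : ℝ := if b then f else 1

theorem exists_bound_of_trunc {ψ : ℕ → ℝ} {t : ℕ} (ht : ∀ j, t < j → ψ j = 0) :
    ∃ C : ℝ, 1 ≤ C ∧ ∀ j, |ψ j| ≤ C * ind (j ≤ t) := by
  refine ⟨1 + ∑ j ∈ Finset.range (t + 1), |ψ j|, le_add_of_nonneg_right
    (Finset.sum_nonneg fun _ _ => abs_nonneg _), fun j => ?_⟩
  by_cases hj : j ≤ t
  · rw [ind_of hj, mul_one]
    have := Finset.single_le_sum (f := fun j => |ψ j|) (fun _ _ => abs_nonneg _)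
      (Finset.mem_range.2 (Nat.lt_succ_of_le hj))
    linarith
  · rw [ht j (not_le.1 hj), ind_of_not hj]; simp

namespace Planted

/-- A weight of nodes depending on class, degree and membership in the labelled set. -/
noncomputable def nodeWeight (P : Planted k) (n : ℕ) (c : Fin k) (ψ : ℕ → ℝ) (b : Bool)
    (S : Finset (Fin n)) (v : Fin n) : ℝ :=
  ind (P.label n v = c) * ψ (P.deg n v) * (if b then ind (v ∈ S) else 1)

/-- The sum over all copies of a tree of the product of weights of the nodes. -/
noncomputable def treeSum (P : Planted k) {m : ℕ} (T : Tree m) (γ : Fin (m + 1) → Fin k)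
    (ψ : Fin (m + 1) → ℕ → ℝ) (b : Fin (m + 1) → Bool) (n : ℕ)
    (ω : SimpleGraph (Fin n) × Finset (Fin n)) : ℝ :=
  ∑ x : Fin (m + 1) → Fin n, ind (IsCopy T.pairs ω.1 x) *
    ∏ i, P.nodeWeight n (γ i) (ψ i) (b i) ω.2 (x i)

variable {P : Planted k} {H : Matrix (Fin k) (Fin k) ℝ} {f : ℝ} {μ : PMF ℕ} {p : ℕ}

theorem abs_nodeWeight_le {n : ℕ} {c : Fin k} {ψ : ℕ → ℝ} {b : Bool} {S : Finset (Fin n)}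
    {v : Fin n} {C : ℝ} {t : ℕ} (hψ : ∀ j, |ψ j| ≤ C * ind (j ≤ t)) :
    |P.nodeWeight n c ψ b S v| ≤ C * ind (P.deg n v ≤ t) := by
  have h1 : (0 : ℝ) ≤ if b then ind (v ∈ S) else 1 := by split_ifs; exacts [ind_nonneg _, one_pos.le]
  have h2 : (if b then ind (v ∈ S) else 1) ≤ (1 : ℝ) := by split_ifs; exacts [ind_le_one _, le_rfl]
  rw [nodeWeight, abs_mul, abs_mul, abs_of_nonneg (ind_nonneg _), abs_of_nonneg h1]
  calc _ ≤ 1 * |ψ (P.deg n v)| * 1 := by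
        gcongr
        · exact ind_le_one _
    _ ≤ _ := by rw [one_mul, mul_one]; exact hψ _

theorem abs_prod_nodeWeight_le {n m : ℕ} {γ : Fin (m + 1) → Fin k} {ψ : Fin (m + 1) → ℕ → ℝ}
    {b : Fin (m + 1) → Bool} {S : Finset (Fin n)} {C : ℝ} {t : ℕ} (hC : 0 ≤ C)
    (hψ : ∀ i j, |ψ i j| ≤ C * ind (j ≤ t)) (u : Fin (m + 1) → Fin n) :
    |∏ i, P.nodeWeight n (γ i) (ψ i) (b i) S (u i)| ≤
      C ^ (m + 1) * ind (∀ j, P.deg n (u j) ≤ t) := by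
  rw [Finset.abs_prod]
  refine (Finset.prod_le_prod (fun _ _ => abs_nonneg _)
    fun i _ => abs_nodeWeight_le (hψ i)).trans ?_
  rw [Finset.prod_mul_distrib, Finset.prod_const, Finset.card_fin]
  refine mul_le_mul_of_nonneg_left ?_ (by positivity)
  by_cases hu : ∀ j, P.deg n (u j) ≤ t
  · rw [ind_of hu]; exact Finset.prod_le_one (fun _ _ => ind_nonneg _) fun _ _ => ind_le_one _
  · rw [ind_of_not hu]
    push Not at hu
    obtain ⟨j, hj⟩ := hu
    exact (Finset.prod_eq_zero (Finset.mem_univ j) (ind_of_not (not_le.2 hj))).le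

namespace IsRegular

/-- Without a mark this is an average over degrees. With a mark, the labelled part of the sum
concentrates around its proportional share, by `sum_seeds_le`. -/
theorem meanLim_sum_nodeWeight (h : P.IsRegular H f μ p) (c : Fin k) {ψ : ℕ → ℝ} {t : ℕ}
    (ht : ∀ j, t < j → ψ j = 0) (b : Bool) :
    P.MeanLim (fun n ω => (∑ v, P.nodeWeight n c ψ b ω.2 v) / n)
      (degMean μ ψ * markFactor f b / k) := by
  have havg := h.tendsto_avg_trunc c ht
  cases b with
  | false => simpa [nodeWeight, markFactor] using meanLim_of_tendsto (P := P) havg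
  | true =>
    obtain ⟨C, hC1, hC⟩ := exists_bound_of_trunc ht
    have hψ : ∀ j, |ψ j| ≤ C := fun j => (hC j).trans
      (mul_le_of_le_one_right (by linarith) (ind_le_one _))
    have hk : (0 : ℝ) < 1 / k := by
      have := P.numClasses_pos
      positivity
    set y : ℕ → ℝ := fun n => P.seeds n c / P.classSize n c *
      ((∑ v, ind (P.label n v = c) * ψ (P.deg n v)) / n) with hy
    have hylim : Tendsto y atTop (𝓝 (degMean μ ψ * f / k)) := by
      have := (h.labelled c).mul havg
      rwa [mul_div_assoc', mul_comm f] at this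
    simp only [markFactor, if_true]
    set Z : ∀ n, SimpleGraph (Fin n) × Finset (Fin n) → ℝ := fun n ω =>
      ∑ v, P.nodeWeight n c ψ true ω.2 v with hZ
    have hdiff : P.MeanLim (fun n ω => Z n ω / n - y n) 0 := by
      refine meanLim_of_sq ?_
      refine squeeze_zero' (Eventually.of_forall fun n => expect_nonneg fun _ _ => sq_nonneg _) ?_
        (tendsto_const_div_atTop_nhds_zero_nat (2 * C ^ 2))
      filter_upwards [(h.balanced c).eventually (lt_mem_nhds hk), eventually_gt_atTop 0]
        with n hn hn0
      have hn' : (0 : ℝ) < n := by exact_mod_cast hn0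
      set N : ℝ := (P.classSize n c : ℝ) with hN
      have hN0 : 0 < N := by
        by_contra h0
        have : N = 0 := le_antisymm (not_lt.1 h0) (Nat.cast_nonneg _)
        rw [this, zero_div] at hn; exact lt_irrefl _ hn
      have hNn : N ≤ n := by
        rw [hN, classSize_eq_sum]
        refine (Finset.sum_le_sum fun v _ => ind_le_one _).trans ?_
        simp
      have main := sum_seeds_le (c := c) P.replaceElement_mem (P.sum_seeds c)
        (ψ := fun v => ψ (P.deg n v)) (fun v => hψ _) (n * y n)
      rw [← classSize_eq_sum] at main
      refine expect_le_of_sum_le (by positivity) ?_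
      have hZ' : ∀ ω : SimpleGraph (Fin n) × Finset (Fin n),
          ∑ v, ind (P.label n v = c ∧ v ∈ ω.2) * ψ (P.deg n v) = Z n ω := by
        intro ω
        refine Finset.sum_congr rfl fun v _ => ?_
        simp only [nodeWeight, ind_and, if_true]; ring
      simp only [hZ'] at main
      have e : ∀ ω, (N * Z n ω - P.seeds n c * ∑ v, ind (P.label n v = c) * ψ (P.deg n v)) *
          (Z n ω - n * y n) = N * n ^ 2 * (Z n ω / n - y n - 0) ^ 2 := by
        intro ω
        simp only [hy, ← hN]
        field_simp
        ring
      simp only [← hN, e, ← Finset.mul_sum] at main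
      have hpos : 0 < N * (n : ℝ) ^ 2 := by positivity
      rw [← mul_le_mul_iff_of_pos_left hpos]
      refine main.trans ?_
      have : N * (n : ℝ) ^ 2 * (((P.outcomeFinset n).card : ℝ) * (2 * C ^ 2 / n)) =
          ((P.outcomeFinset n).card : ℝ) * (2 * C ^ 2 * (N * n)) := by field_simp
      rw [this]
      gcongr
      nlinarith
    have := hdiff.add (meanLim_of_tendsto (P := P) hylim)
    simpa using this

/-- Read each edge from its weighted end in class `e`. Summing over the neighbors yields a factor
`j`, and `meanLim_extSum` for the one-node tree makes the class of the neighbor asymptotically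
independent of that end's degree and mark, with frequency `H e c`. Symmetry of `H` gives the stated
form. -/
theorem meanLim_edgeSum (h : P.IsRegular H f μ p) (hp : 2 ≤ p) (hH : H.IsSymm) (c e : Fin k)
    {ψ : ℕ → ℝ} {t : ℕ} (ht : ∀ j, t < j → ψ j = 0) (b : Bool) :
    P.MeanLim (fun n ω => edgeSum (P.label n) c (P.nodeWeight n e ψ b) ω / n)
      (H c e * (degMean μ (fun j => ψ j * j) * markFactor f b) / k) := by
  obtain ⟨C, hC1, hC⟩ := exists_bound_of_trunc ht
  have hk : (0 : ℝ) < k := by exact_mod_cast P.numClasses_pos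
  have hd := h.degMoment_one_pos (by omega)
  have hext : ∀ n (G : SimpleGraph (Fin n)) v w,
      Extends (fun G x => IsCopy Tree.single.pairs G x) 0 G (fun _ : Fin 1 => v) w ↔
        G.Adj v w := by
    intro n G v w
    refine ⟨fun h => h.2.1, fun h => ⟨⟨fun a b _ => Subsingleton.elim (α := Fin 1) a b, ?_⟩, h,
      fun _ => h.ne⟩⟩
    simp [Tree.pairs]
  have hα : P.MeanLim (fun n ω => extSum (fun G x => IsCopy Tree.single.pairs G x) 0
      (fun S u => P.nodeWeight n e ψ b S (u 0)) (fun _ _ => 1) ω / n)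
      (degMean μ (fun j => ψ j * j) * markFactor f b / k) := by
    refine (h.meanLim_sum_nodeWeight e (ψ := fun j => ψ j * j) (t := t)
      (fun j hj => by rw [ht j hj, zero_mul]) b).congr ?_
    refine Eventually.of_forall fun n ω hω => ?_
    rw [extSum, sum_fin_one]
    congr 1
    refine Finset.sum_congr rfl fun v _ => ?_
    simp only [hext, mul_one, ← Finset.sum_mul, (P.isSwitchClosed n).degree ω hω, nodeWeight]
    ring
  have hβ : P.MeanLim (fun n ω => edgeSum (P.label n) e
      (fun _ w => ind (P.label n w = c)) ω / n) (H e c * (degMoment μ 1 / k)) := by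
    refine (meanLim_of_tendsto (P := P) (h.tendsto_edgeCounts (by omega) e c)).congr ?_
    refine Eventually.of_forall fun n ω hω => ?_
    rw [← P.sum_edgeCounts e c ω hω, edgeSum]
    congr 1
    refine Finset.sum_congr rfl fun v _ => Finset.sum_congr rfl fun w _ => ?_
    rw [ind_and]; ring
  have main := h.meanLim_extSum hp (t := t) (b := C) Tree.single 0 (by linarith)
    (φ := fun n _ w => ind (P.label n w = c)) (c := e)
    (g := fun n S u => P.nodeWeight n e ψ b S (u 0))
    (fun n S v => by rw [abs_of_nonneg (ind_nonneg _)]; exact (ind_le_one _).trans hC1)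
    (fun n S u hu => by
      by_contra hne
      exact hu (by simp [nodeWeight, ind_of_not hne]))
    (fun n S u => by
      refine (abs_nodeWeight_le hC).trans (le_of_eq ?_)
      congr 1
      exact ind_congr (by simp)) hα hβ
  have e1 : degMean μ (fun j => ψ j * j) * markFactor f b / k * (H e c * (degMoment μ 1 / k)) /
      (degMoment μ 1 / k) = H c e * (degMean μ (fun j => ψ j * j) * markFactor f b) / k := by
    rw [hH.apply c e]; field_simp
  rw [e1] at main
  refine main.congr (Eventually.of_forall fun n ω hω => ?_)
  congr 1
  rw [extSum, sum_fin_one, edgeSum, Finset.sum_comm]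
  refine Finset.sum_congr rfl fun v _ => Finset.sum_congr rfl fun w _ => ?_
  rw [ind_congr (hext n ω.1 w v), ind_and, ω.1.adj_comm]; ring

/-- Induction on the tree. Attaching a leaf at `q` contributes the mean of `ψ j * j` for the leaf,
an entry of `H` and a division by `d`, while the number of free neighbors of `q` raises its
factorial moment by one order. -/
theorem meanLim_treeSum (h : P.IsRegular H f μ p) (hp : 2 ≤ p) (hH : H.IsSymm) :
    {m : ℕ} → (T : Tree m) → (γ : Fin (m + 1) → Fin k) → (ψ : Fin (m + 1) → ℕ → ℝ) →
    (b : Fin (m + 1) → Bool) → (t : ℕ) → (∀ i j, t < j → ψ i j = 0) →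
    P.MeanLim (fun n ω => P.treeSum T γ ψ b n ω / n)
      (T.classWeight H γ * (∏ i, degMean μ (fun j => ψ i j * j.descFactorial (T.degree i)) *
        markFactor f (b i)) / degMoment μ 1 ^ m / k)
  | _, .single => by
    intro γ ψ b t ht
    have := h.meanLim_sum_nodeWeight (γ 0) (ht 0) (b 0)
    refine (this.congr (Z := fun n ω => P.treeSum .single γ ψ b n ω / n)
      (Eventually.of_forall fun n ω _ => ?_)).congr_lim ?_
    · rw [treeSum, sum_fin_one]
      congr 1
      refine Finset.sum_congr rfl fun v _ => ?_
      rw [ind_of ⟨fun a b _ => Subsingleton.elim (α := Fin 1) a b, by simp [Tree.pairs]⟩]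
      simp
    · simp [Tree.classWeight, Tree.degree]
  | _, .attach (m := m) T q => by
    intro γ ψ b t ht
    have hk : (0 : ℝ) < k := by exact_mod_cast P.numClasses_pos
    have hd := h.degMoment_one_pos (by omega)
    choose C₀ hC₀1 hC₀ using fun i => exists_bound_of_trunc (ht i)
    set C := ∑ i, C₀ i with hCdef
    have hC : ∀ i j, |ψ i j| ≤ C * ind (j ≤ t) := fun i j => (hC₀ i j).trans
      (mul_le_mul_of_nonneg_right (Finset.single_le_sum (f := C₀)
        (fun i _ => by linarith [hC₀1 i]) (Finset.mem_univ i)) (ind_nonneg _))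
    have hC1 : 1 ≤ C := (hC₀1 0).trans (Finset.single_le_sum (f := C₀)
        (fun i _ => by linarith [hC₀1 i]) (Finset.mem_univ 0))
    have hC0 : 0 ≤ C := by linarith
    set g : ∀ n, Finset (Fin n) → (Fin (m + 1) → Fin n) → ℝ := fun n S u =>
      ∏ i, P.nodeWeight n (γ i.castSucc) (ψ i.castSucc) (b i.castSucc) S (u i) with hg
    have hgb : ∀ n S u, |g n S u| ≤ C ^ (m + 1) * ind (∀ j, P.deg n (u j) ≤ t) :=
      fun n S u => abs_prod_nodeWeight_le hC0 (fun i j => hC i.castSucc j) u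
    -- The factor `j - T.degree q` is the number of neighbors left for the new leaf; absorbing it
    -- into the weight lets the induction hypothesis apply.
    set ψ' : Fin (m + 1) → ℕ → ℝ := fun i j =>
      ψ i.castSucc j * (if i = q then (j : ℝ) - T.degree q else 1) with hψ'
    have ih := meanLim_treeSum h hp hH T (fun i => γ i.castSucc) ψ' (fun i => b i.castSucc) t
      (fun i j hj => by rw [hψ']; simp only [ht _ j hj, zero_mul])
    -- The true number of extensions differs from `deg - T.degree q` only through extra edges inside
    -- the copy, and copies with an extra edge are rare.
    have hclose : Tendsto (fun n => P.expect n fun ω =>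
        |extSum (fun G x => IsCopy T.pairs G x) q (g n) (fun _ _ => 1) ω / n -
          P.treeSum T (fun i => γ i.castSucc) ψ' (fun i => b i.castSucc) n ω / n|)
        atTop (𝓝 0) := by
      have lim : Tendsto (fun n : ℕ => C ^ (m + 1) * ∑ i, ind (q ≠ i ∧ s(q, i) ∉ T.pairs) *
          (P.expect n (fun ω => ∑ x : Fin (m + 1) → Fin n,
            ind (IsCopy (insert s(q, i) T.pairs) ω.1 x) * ind (∀ j, P.deg n (x j) ≤ t)) / n))
          atTop (𝓝 0) := by
        have : Tendsto (fun n : ℕ => C ^ (m + 1) * ∑ i, ind (q ≠ i ∧ s(q, i) ∉ T.pairs) *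
          (P.expect n (fun ω => ∑ x : Fin (m + 1) → Fin n,
            ind (IsCopy (insert s(q, i) T.pairs) ω.1 x) * ind (∀ j, P.deg n (x j) ≤ t)) / n))
          atTop (𝓝 (C ^ (m + 1) * ∑ _i : Fin (m + 1), 0)) := by
          refine Tendsto.const_mul _ (tendsto_finsetSum _ fun i _ => ?_)
          by_cases hi : q ≠ i ∧ s(q, i) ∉ T.pairs
          · rw [ind_of hi]
            simp only [one_mul]
            refine h.tendsto_expect_isCopy_low hp _ ?_ ?_ t
            · rw [Finset.forall_mem_insert]
              exact ⟨by simpa using hi.1, T.not_isDiag⟩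
            · rw [Finset.card_insert_of_notMem hi.2, T.card_pairs]
          · rw [ind_of_not hi]
            simp
        simpa using this
      refine squeeze_zero' (Eventually.of_forall fun n => expect_nonneg fun _ _ => abs_nonneg _)
        ?_ lim
      filter_upwards [eventually_gt_atTop 0] with n hn
      have hn' : (0 : ℝ) < n := by exact_mod_cast hn
      have e0 : C ^ (m + 1) * ∑ i, ind (q ≠ i ∧ s(q, i) ∉ T.pairs) *
          (P.expect n (fun ω => ∑ x : Fin (m + 1) → Fin n,
            ind (IsCopy (insert s(q, i) T.pairs) ω.1 x) * ind (∀ j, P.deg n (x j) ≤ t)) / n) =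
          P.expect n fun ω => C ^ (m + 1) / n * ∑ i, ∑ x : Fin (m + 1) → Fin n,
            ind (q ≠ i ∧ s(q, i) ∉ T.pairs) *
            (ind (IsCopy (insert s(q, i) T.pairs) ω.1 x) * ind (∀ j, P.deg n (x j) ≤ t)) := by
        rw [expect_const_mul, expect_sum, Finset.mul_sum, Finset.mul_sum]
        refine Finset.sum_congr rfl fun i _ => ?_
        simp only [← Finset.mul_sum]
        rw [expect_const_mul]
        ring
      rw [e0]
      refine expect_mono fun ω hω => ?_
      have hG := (P.isSwitchClosed n).degree ω hω
      rw [← sub_div, abs_div, abs_of_pos hn', div_mul_eq_mul_div]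
      refine div_le_div_of_nonneg_right ?_ hn'.le
      have e1 : ∀ u : Fin (m + 1) → Fin n,
          ∏ i, P.nodeWeight n (γ i.castSucc) (ψ' i) (b i.castSucc) ω.2 (u i) =
          g n ω.2 u * ((P.deg n (u q) : ℝ) - T.degree q) := by
        intro u
        have : ∀ i, P.nodeWeight n (γ i.castSucc) (ψ' i) (b i.castSucc) ω.2 (u i) =
            P.nodeWeight n (γ i.castSucc) (ψ i.castSucc) (b i.castSucc) ω.2 (u i) *
              (if i = q then (P.deg n (u i) : ℝ) - T.degree q else 1) := by
          intro i; simp only [nodeWeight, hψ']; ring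
        simp only [this, Finset.prod_mul_distrib, Finset.prod_ite_eq', Finset.mem_univ, if_true, hg]
      rw [extSum, treeSum, ← Finset.sum_sub_distrib, Finset.mul_sum]
      refine (Finset.abs_sum_le_sum_abs _ _).trans ?_
      simp only [Finset.mul_sum]
      rw [Finset.sum_comm]
      refine Finset.sum_le_sum fun u _ => ?_
      rw [e1]
      simp only [mul_one]
      rw [← Finset.sum_mul, mul_left_comm, mul_comm _ (g n ω.2 u), ← mul_sub, abs_mul]
      calc _ ≤ C ^ (m + 1) * ind (∀ j, P.deg n (u j) ≤ t) * _ :=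
            mul_le_mul (hgb n ω.2 u) (abs_sum_extends_sub_le hG T q u) (abs_nonneg _)
              (mul_nonneg (by positivity) (ind_nonneg _))
        _ = _ := by
            rw [Finset.mul_sum]
            exact Finset.sum_congr rfl fun i _ => by ring
    have hα := ih.of_sub hclose
    have hβ := h.meanLim_edgeSum hp hH (γ q.castSucc) (γ (Fin.last _)) (ht (Fin.last _))
      (b (Fin.last _))
    have main := h.meanLim_extSum hp (t := t) (b := C ^ (m + 1)) T q (by positivity)
      (φ := fun n => P.nodeWeight n (γ (Fin.last _)) (ψ (Fin.last _)) (b (Fin.last _)))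
      (c := γ q.castSucc) (g := g)
      (fun n S v => by
        refine (abs_nodeWeight_le (hC _)).trans ?_
        refine (mul_le_of_le_one_right hC0 (ind_le_one _)).trans ?_
        exact le_self_pow₀ hC1 (by omega))
      (fun n S u hu => by
        by_contra hne
        refine hu (Finset.prod_eq_zero (Finset.mem_univ q) ?_)
        simp [nodeWeight, ind_of_not hne])
      hgb hα hβ
    refine (main.congr (Z := fun n ω => P.treeSum (.attach T q) γ ψ b n ω / n)
      (Eventually.of_forall fun n ω _ => ?_)).congr_lim ?_
    · congr 1
      rw [treeSum, sum_snoc, extSum]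
      refine Finset.sum_congr rfl fun u _ => Finset.sum_congr rfl fun w _ => ?_
      rw [ind_congr (isCopy_attach_iff T q ω.1 u w), Fin.prod_univ_castSucc]
      simp [hg]
    · rw [Fin.prod_univ_castSucc (n := m + 1), Tree.classWeight]
      have e2 : ∀ i : Fin (m + 1), degMean μ (fun j => ψ i.castSucc j *
          j.descFactorial ((T.attach q).degree i.castSucc)) =
          degMean μ (fun j => ψ' i j * j.descFactorial (T.degree i)) := by
        intro i
        congr 1
        funext j
        simp only [hψ', Tree.degree_attach_castSucc]
        by_cases hi : i = q
        · subst hi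
          rw [if_pos rfl, if_pos rfl, Nat.descFactorial_succ]
          by_cases hj : T.degree i ≤ j
          · push_cast [Nat.cast_sub hj]; ring
          · rw [Nat.descFactorial_of_lt (not_le.1 hj)]; simp
        · rw [if_neg hi, if_neg hi, mul_one, add_zero]
      simp only [e2, Tree.degree_attach_last, Nat.descFactorial_one]
      field_simp
      ring

end IsRegular

end Planted

end CompatEst

namespace CompatEst

variable {k : ℕ}

/-! ### Distances in trees -/

namespace Tree

variable {m : ℕ}

theorem dist_self : {m : ℕ} → (T : Tree m) → ∀ i, T.dist i i = 0
  | _, single => fun _ => rfl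
  | _, attach T p => fun i => by
    induction i using Fin.lastCases with
    | last => simp
    | cast i => simpa using dist_self T i

theorem dist_le : {m : ℕ} → (T : Tree m) → ∀ i j, T.dist i j ≤ m
  | _, single => fun _ _ => le_rfl
  | _, attach T p => fun i j => by
    induction i using Fin.lastCases with
    | last =>
      induction j using Fin.lastCases with
      | last => simp
      | cast j => simpa using dist_le T p j
    | cast i =>
      induction j using Fin.lastCases with
      | last => simpa using dist_le T i p
      | cast j => simpa using (dist_le T i j).trans (Nat.le_succ _)

theorem mem_pairs_attach {T : Tree m} {p : Fin (m + 1)} {z : Sym2 (Fin (m + 2))} :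
    z ∈ (T.attach p).pairs ↔ z = s(p.castSucc, Fin.last _) ∨
      ∃ i j, s(i, j) ∈ T.pairs ∧ z = s(i.castSucc, j.castSucc) := by
  rw [pairs, Finset.mem_insert, Finset.mem_image]
  refine or_congr_right ⟨?_, ?_⟩
  · rintro ⟨y, hy, rfl⟩
    induction y with
    | h i j => exact ⟨i, j, hy, rfl⟩
  · rintro ⟨i, j, h, rfl⟩
    exact ⟨_, h, rfl⟩

theorem castSucc_mem_pairs_attach {T : Tree m} {p i j : Fin (m + 1)} :
    s(i.castSucc, j.castSucc) ∈ (T.attach p).pairs ↔ s(i, j) ∈ T.pairs := by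
  rw [pairs, Finset.mem_insert, ← Sym2.map_mk,
    (Sym2.map.injective (Fin.castSucc_injective _)).mem_finset_image, or_iff_right]
  intro h
  exact last_notMem_map_castSucc s(i, j) (h ▸ Sym2.mem_mk_right _ _)

/-- Distances to the two ends of a tree edge differ by exactly one; the parity of walks in trees
follows. -/
theorem dist_adj : {m : ℕ} → (T : Tree m) → ∀ z i j, s(i, j) ∈ T.pairs →
    T.dist z i = T.dist z j + 1 ∨ T.dist z j = T.dist z i + 1
  | _, single => by simp [pairs]
  | _, attach T p => by
    intro z i j h
    have new : (T.attach p).dist z p.castSucc = (T.attach p).dist z (Fin.last _) + 1 ∨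
        (T.attach p).dist z (Fin.last _) = (T.attach p).dist z p.castSucc + 1 := by
      induction z using Fin.lastCases with
      | last => simp [dist_self]
      | cast z => simp
    rcases mem_pairs_attach.1 h with h | ⟨i', j', h', h⟩
    · rcases Sym2.eq_iff.1 h with ⟨rfl, rfl⟩ | ⟨rfl, rfl⟩
      · exact new
      · exact new.symm
    · have old : (T.attach p).dist z i'.castSucc = (T.attach p).dist z j'.castSucc + 1 ∨
          (T.attach p).dist z j'.castSucc = (T.attach p).dist z i'.castSucc + 1 := by
        induction z using Fin.lastCases with
        | last => simpa using dist_adj T p i' j' h'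
        | cast z => simpa using dist_adj T z i' j' h'
      rcases Sym2.eq_iff.1 h with ⟨rfl, rfl⟩ | ⟨rfl, rfl⟩
      · exact old
      · exact old.symm

/-- Leaves off the path from `i` to `j` sum out because rows of `H` sum to one, and the remaining
sum along the path is a matrix product. For a leaf that is itself both ends, the column sums are
used. -/
theorem sum_classWeight (H : Matrix (Fin k) (Fin k) ℝ) (hsymm : H.IsSymm)
    (hrow : ∀ c, ∑ e, H c e = 1) : {m : ℕ} → (T : Tree m) → ∀ i j c e,
    ∑ γ : Fin (m + 1) → Fin k, ind (γ i = c) * ind (γ j = e) * T.classWeight H γ =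
      (H ^ T.dist i j) c e
  | _, single => by
    intro i j c e
    rw [sum_fin_one]
    simp only [classWeight, mul_one, dist, pow_zero]
    rw [sum_ind_eq_mul, Matrix.one_apply]
    exact ind_mul_eq_ite (c = e) 1 ▸ by rw [mul_one]
  | _, attach T p => by
    intro i j c e
    have ih := sum_classWeight H hsymm hrow T
    have hcol : ∀ e, ∑ c, H c e = 1 := fun e => by
      rw [← hrow e]; exact Finset.sum_congr rfl fun c _ => hsymm.apply e c
    have expand : ∀ (F : (Fin _ → Fin k) → Fin k → ℝ), ∑ u, F u (u p) =
        ∑ g, ∑ u, ind (u p = g) * F u g := by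
      intro F
      rw [Finset.sum_comm]
      exact Finset.sum_congr rfl fun u _ => (sum_ind_eq_mul' (u p) fun g => F u g).symm
    rw [sum_snoc]
    induction i using Fin.lastCases with
    | last =>
      induction j using Fin.lastCases with
      | last =>
        simp only [classWeight, Fin.snoc_last, Fin.snoc_castSucc, dist_attach_last_last, pow_zero]
        have e1 : ∀ u : Fin _ → Fin k, ∑ w, ind (w = c) * ind (w = e) *
            (T.classWeight H u * H (u p) w) = ind (c = e) * (T.classWeight H u * H (u p) c) := by
          intro u; simp only [mul_assoc]; rw [sum_ind_eq_mul]
        rw [Finset.sum_congr rfl fun u _ => e1 u, ← Finset.mul_sum,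
          expand fun u g => T.classWeight H u * H g c]
        have e2 : ∀ g, ∑ u : Fin _ → Fin k, ind (u p = g) * (T.classWeight H u * H g c) = H g c := by
          intro g
          have := ih p p g g
          rw [dist_self, pow_zero, Matrix.one_apply_eq] at this
          calc _ = (∑ u : Fin _ → Fin k, ind (u p = g) * ind (u p = g) * T.classWeight H u) *
                H g c := by
                rw [Finset.sum_mul]
                exact Finset.sum_congr rfl fun u _ => by rw [ind_mul_self]; ring
            _ = _ := by rw [this, one_mul]
        rw [Finset.sum_congr rfl fun g _ => e2 g, hcol, Matrix.one_apply, ind_mul_eq_ite]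
      | cast j =>
        simp only [classWeight, Fin.snoc_last, Fin.snoc_castSucc, dist_attach_last_castSucc]
        have e1 : ∀ u : Fin _ → Fin k, ∑ w, ind (w = c) * ind (u j = e) *
            (T.classWeight H u * H (u p) w) = ind (u j = e) * (T.classWeight H u * H (u p) c) := by
          intro u; simp only [mul_assoc]; rw [sum_ind_eq_mul]
        rw [Finset.sum_congr rfl fun u _ => e1 u,
          expand fun u g => ind (u j = e) * (T.classWeight H u * H g c), pow_succ',
          Matrix.mul_apply]
        refine Finset.sum_congr rfl fun g _ => ?_
        rw [← ih p j g e, ← hsymm.apply c g, Finset.mul_sum]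
        exact Finset.sum_congr rfl fun u _ => by rw [hsymm.apply]; ring
    | cast i =>
      induction j using Fin.lastCases with
      | last =>
        simp only [classWeight, Fin.snoc_last, Fin.snoc_castSucc, dist_attach_castSucc_last]
        have e1 : ∀ u : Fin _ → Fin k, ∑ w, ind (u i = c) * ind (w = e) *
            (T.classWeight H u * H (u p) w) = ind (u i = c) * (T.classWeight H u * H (u p) e) := by
          intro u; simp only [mul_assoc]; rw [← Finset.mul_sum, sum_ind_eq_mul]
        rw [Finset.sum_congr rfl fun u _ => e1 u,
          expand fun u g => ind (u i = c) * (T.classWeight H u * H g e), pow_succ,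
          Matrix.mul_apply]
        refine Finset.sum_congr rfl fun g _ => ?_
        rw [← ih i p c g, Finset.sum_mul]
        exact Finset.sum_congr rfl fun u _ => by ring
      | cast j =>
        simp only [classWeight, Fin.snoc_last, Fin.snoc_castSucc, dist_attach_castSucc_castSucc]
        rw [← ih i j c e]
        refine Finset.sum_congr rfl fun u _ => ?_
        rw [← Finset.mul_sum, ← Finset.mul_sum, hrow, mul_one]

end Tree

/-! ### Patterns of walks -/

/-- The ways in which a walk with `ℓ` steps visits `m + 1` different nodes: in every step it
goes to one of the nodes visited before, or to a new one. -/
inductive Pattern : ℕ → ℕ → Type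
  | start : Pattern 0 0
  | old {ℓ m : ℕ} (Q : Pattern ℓ m) (q : Fin (m + 1)) : Pattern (ℓ + 1) m
  | new {ℓ m : ℕ} (Q : Pattern ℓ m) : Pattern (ℓ + 1) (m + 1)

namespace Pattern

/-- The sequence of nodes visited; the nodes are numbered in the order of the first visits. -/
def path : {ℓ m : ℕ} → Pattern ℓ m → Fin (ℓ + 1) → Fin (m + 1)
  | _, _, start => fun _ => 0
  | _, _, old Q q => Fin.snoc (α := fun _ => Fin _) Q.path q
  | _, _, new Q => Fin.snoc (α := fun _ => Fin _) (fun t => (Q.path t).castSucc) (Fin.last _)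

/-- The tree formed by the steps to new nodes. -/
def tree : {ℓ m : ℕ} → Pattern ℓ m → Tree m
  | _, _, start => .single
  | _, _, old Q _ => Q.tree
  | _, _, new Q => Q.tree.attach (Q.path (Fin.last _))

/-- The walk without repeated nodes. -/
def straight : (ℓ : ℕ) → Pattern ℓ ℓ
  | 0 => start
  | ℓ + 1 => new (straight ℓ)

/-- The set of pairs of consecutive nodes. -/
def steps {ℓ m : ℕ} (Q : Pattern ℓ m) : Finset (Sym2 (Fin (m + 1))) :=
  Finset.univ.image fun t : Fin ℓ => s(Q.path t.castSucc, Q.path t.succ)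

variable {ℓ m : ℕ} (Q : Pattern ℓ m) (q : Fin (m + 1))

@[simp] theorem path_old_castSucc (t : Fin (ℓ + 1)) : (Q.old q).path t.castSucc = Q.path t := by
  simp [path]
@[simp] theorem path_old_last : (Q.old q).path (Fin.last _) = q := by simp [path]
@[simp] theorem path_new_castSucc (t : Fin (ℓ + 1)) :
    Q.new.path t.castSucc = (Q.path t).castSucc := by simp [path]
@[simp] theorem path_new_last : Q.new.path (Fin.last _) = Fin.last _ := by simp [path]
@[simp] theorem path_old_zero : (Q.old q).path 0 = Q.path 0 := Q.path_old_castSucc q 0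
@[simp] theorem path_new_zero : Q.new.path 0 = (Q.path 0).castSucc := Q.path_new_castSucc 0

theorem mem_steps {z : Sym2 (Fin (m + 1))} :
    z ∈ Q.steps ↔ ∃ t : Fin ℓ, s(Q.path t.castSucc, Q.path t.succ) = z := by
  simp [steps]

theorem le : {ℓ m : ℕ} → Pattern ℓ m → m ≤ ℓ
  | _, _, start => le_rfl
  | _, _, old Q _ => (le Q).trans (Nat.le_succ _)
  | _, _, new Q => Nat.succ_le_succ (le Q)

theorem eq_straight : {ℓ m : ℕ} → (Q : Pattern ℓ m) → m = ℓ →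
    (⟨m, Q⟩ : Sigma (Pattern ℓ)) = ⟨ℓ, straight ℓ⟩
  | _, _, start => fun _ => rfl
  | _, _, old Q _ => fun h => by have := Q.le; omega
  | _, _, new Q => fun h => by
    obtain rfl := Nat.succ_injective h
    have := eq_straight Q rfl
    rw [straight, ← eq_of_heq (Sigma.mk.inj this).2]

theorem path_surjective : {ℓ m : ℕ} → (Q : Pattern ℓ m) → Function.Surjective Q.path
  | _, _, start => fun i => ⟨0, (Subsingleton.elim (α := Fin 1) _ _)⟩
  | _, _, old Q q => fun i => by
    obtain ⟨t, rfl⟩ := path_surjective Q i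
    exact ⟨t.castSucc, by simp⟩
  | _, _, new Q => fun i => by
    induction i using Fin.lastCases with
    | last => exact ⟨Fin.last _, by simp⟩
    | cast i =>
      obtain ⟨t, rfl⟩ := path_surjective Q i
      exact ⟨t.castSucc, by simp⟩

theorem pairs_subset_steps : {ℓ m : ℕ} → (Q : Pattern ℓ m) → Q.tree.pairs ⊆ Q.steps
  | _, _, start => by simp [tree, Tree.pairs]
  | _, _, old Q q => by
    intro z hz
    obtain ⟨t, rfl⟩ := Q.mem_steps.1 (pairs_subset_steps Q hz)
    exact (mem_steps _).2 ⟨t.castSucc, by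
      rw [Fin.succ_castSucc, path_old_castSucc, path_old_castSucc]⟩
  | _, _, new Q => by
    intro z hz
    rcases Tree.mem_pairs_attach.1 hz with rfl | ⟨i, j, h, rfl⟩
    · exact (mem_steps _).2 ⟨Fin.last _, by rw [Fin.succ_last]; simp⟩
    · obtain ⟨t, ht⟩ := Q.mem_steps.1 (pairs_subset_steps Q h)
      refine (mem_steps _).2 ⟨t.castSucc, ?_⟩
      rw [Fin.succ_castSucc, path_new_castSucc, path_new_castSucc, ← Sym2.map_mk, ht, Sym2.map_mk]

/-- A step from `j` to a new node uses one step and leaves `j`, and another such step requires a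
return. So each tree edge at `j` costs two steps, up to corrections when `j` is not the start or not
the current end. -/
theorem two_mul_degree_le : {ℓ m : ℕ} → (Q : Pattern ℓ m) → ∀ j,
    2 * Q.tree.degree j ≤ ℓ + (if Q.path 0 = j then 0 else 1) +
      (if Q.path (Fin.last _) = j then 0 else 1)
  | _, _, start => fun j => by simp [tree, Tree.degree]
  | _, _, old Q q => fun j => by
    have := two_mul_degree_le Q j
    simp only [tree, path_old_zero, path_old_last]
    split_ifs at this ⊢ <;> omega
  | _, _, new Q => fun j => by
    simp only [tree, path_new_zero, path_new_last]
    induction j using Fin.lastCases with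
    | last =>
      rw [Tree.degree_attach_last, if_neg (Fin.castSucc_lt_last _).ne]; omega
    | cast j =>
      have := two_mul_degree_le Q j
      rw [Tree.degree_attach_castSucc, if_neg (Fin.castSucc_lt_last _).ne']
      simp only [Fin.castSucc_inj]
      by_cases hj : j = Q.path (Fin.last _)
      · subst hj
        simp only [if_true] at this ⊢
        omega
      · rw [if_neg hj]
        rw [if_neg (Ne.symm hj)] at this
        omega

/-- All steps of the walk go along the edges of the tree. -/
def IsTreeWalk : Prop := ∀ t : Fin ℓ, s(Q.path t.castSucc, Q.path t.succ) ∈ Q.tree.pairs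

variable {Q q}

theorem IsTreeWalk.steps_eq (h : Q.IsTreeWalk) : Q.steps = Q.tree.pairs := by
  refine Finset.Subset.antisymm (fun z hz => ?_) Q.pairs_subset_steps
  obtain ⟨t, rfl⟩ := Q.mem_steps.1 hz
  exact h t

theorem isTreeWalk_old : (Q.old q).IsTreeWalk ↔
    Q.IsTreeWalk ∧ s(Q.path (Fin.last _), q) ∈ Q.tree.pairs := by
  unfold IsTreeWalk
  rw [Fin.forall_fin_succ']
  simp only [Fin.succ_castSucc, Fin.succ_last, path_old_castSucc, path_old_last, tree]

theorem isTreeWalk_new : Q.new.IsTreeWalk ↔ Q.IsTreeWalk := by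
  unfold IsTreeWalk
  rw [Fin.forall_fin_succ']
  simp only [Fin.succ_castSucc, Fin.succ_last, path_new_castSucc, path_new_last, tree,
    Tree.castSucc_mem_pairs_attach]
  exact and_iff_left (Tree.mem_pairs_attach.2 (Or.inl rfl))

theorem isTreeWalk_straight : (ℓ : ℕ) → (straight ℓ).IsTreeWalk
  | 0 => fun t => t.elim0
  | ℓ + 1 => isTreeWalk_new.2 (isTreeWalk_straight ℓ)

theorem path_straight : (ℓ : ℕ) → ∀ t, (straight ℓ).path t = t
  | 0 => fun t => Subsingleton.elim (α := Fin 1) _ _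
  | ℓ + 1 => fun t => by
    rw [straight]
    induction t using Fin.lastCases with
    | last => simp
    | cast t => simp [path_straight ℓ t]

theorem degree_straight : (ℓ : ℕ) → ∀ t, (straight ℓ).tree.degree t =
    (if t = 0 then 0 else 1) + if t = Fin.last _ then 0 else 1
  | 0 => fun t => by
    simp [Subsingleton.elim (α := Fin 1) t 0, straight, tree, Tree.degree]
  | ℓ + 1 => fun t => by
    rw [straight, tree, path_straight]
    induction t using Fin.lastCases with
    | last => simp
    | cast t =>
      rw [Tree.degree_attach_castSucc, degree_straight ℓ t, if_neg (Fin.castSucc_lt_last _).ne]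
      simp only [Fin.castSucc_eq_zero_iff]
      split_ifs <;> rfl

theorem dist_straight : (ℓ : ℕ) →
    (straight ℓ).tree.dist ((straight ℓ).path 0) ((straight ℓ).path (Fin.last _)) = ℓ
  | 0 => rfl
  | ℓ + 1 => by
    rw [straight, tree, path_new_zero, path_new_last, Tree.dist_attach_castSucc_last,
      dist_straight ℓ]

/-- The parity of distances along a walk in a tree. -/
theorem IsTreeWalk.exists_dist : {ℓ m : ℕ} → {Q : Pattern ℓ m} → Q.IsTreeWalk →
    ∃ a, Q.tree.dist (Q.path 0) (Q.path (Fin.last _)) + 2 * a = ℓ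
  | _, _, start => fun _ => ⟨0, rfl⟩
  | _, _, old Q q => fun h => by
    obtain ⟨h1, h2⟩ := isTreeWalk_old.1 h
    obtain ⟨a, ha⟩ := exists_dist h1
    simp only [tree, path_old_zero, path_old_last]
    rcases Q.tree.dist_adj (Q.path 0) _ _ h2 with h3 | h3
    · exact ⟨a + 1, by omega⟩
    · exact ⟨a, by omega⟩
  | _, _, new Q => fun h => by
    obtain ⟨a, ha⟩ := exists_dist (isTreeWalk_new.1 h)
    refine ⟨a, ?_⟩
    rw [tree, path_new_zero, path_new_last, Tree.dist_attach_castSucc_last]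
    omega

/-- A walk that is not straight visits fewer than `ℓ + 1` nodes, so its endpoint distance is below
`ℓ`; parity then makes the drop at least two. -/
theorem IsTreeWalk.exists_dist_of_ne (h : Q.IsTreeWalk)
    (hne : (⟨m, Q⟩ : Sigma (Pattern ℓ)) ≠ ⟨ℓ, straight ℓ⟩) :
    ∃ a, Q.tree.dist (Q.path 0) (Q.path (Fin.last _)) + 2 * (a + 1) = ℓ := by
  obtain ⟨a, ha⟩ := h.exists_dist
  have h1 : m ≠ ℓ := fun e => hne (Q.eq_straight e)
  have h2 := Q.le
  have h3 := Q.tree.dist_le (Q.path 0) (Q.path (Fin.last _))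
  exact ⟨a - 1, by omega⟩

/-- By induction the walk so far is straight. The only tree edge at its end leads to the previous
node, and taking it would be backtracking. -/
theorem IsTreeWalk.eq_straight_of_nonbacktracking : {ℓ m : ℕ} → {Q : Pattern ℓ m} →
    Q.IsTreeWalk → (∀ s t : Fin (ℓ + 1), (t : ℕ) = s + 2 → Q.path s ≠ Q.path t) →
    (⟨m, Q⟩ : Sigma (Pattern ℓ)) = ⟨ℓ, straight ℓ⟩
  | _, _, start => fun _ _ => rfl
  | _, _, old (ℓ := ℓ) Q q => fun h hnb => by
    obtain ⟨h1, h2⟩ := isTreeWalk_old.1 h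
    have := eq_straight_of_nonbacktracking h1 fun s t hst => by
      simpa using hnb s.castSucc t.castSucc (by simpa using hst)
    obtain ⟨rfl, hQ⟩ := Sigma.mk.inj this
    obtain rfl := eq_of_heq hQ
    obtain ⟨t, ht⟩ := (mem_steps _).1 (pairs_subset_steps _ h2)
    simp only [path_straight] at ht
    exfalso
    rcases Sym2.eq_iff.1 ht with ⟨e1, e2⟩ | ⟨e1, e2⟩
    · exact (Fin.castSucc_lt_last t).ne e1
    · refine hnb t.castSucc.castSucc (Fin.last _) ?_ ?_
      · have := congrArg Fin.val e2
        simp only [Fin.val_succ, Fin.val_last, Fin.val_castSucc] at this ⊢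
        omega
      · simp [path_straight, e1]
  | _, _, new Q => fun h hnb => by
    have := eq_straight_of_nonbacktracking (isTreeWalk_new.1 h) fun s t hst => by
      simpa using hnb s.castSucc t.castSucc (by simpa using hst)
    obtain ⟨rfl, hQ⟩ := Sigma.mk.inj this
    rw [straight, ← eq_of_heq hQ]

/-! ### Sums over walks -/

/-- The patterns with `ℓ + 1` steps extend those with `ℓ` steps. -/
def extendEquiv (ℓ : ℕ) :
    Sigma (Pattern (ℓ + 1)) ≃ (Σ Q : Sigma (Pattern ℓ), Option (Fin (Q.1 + 1))) where
  toFun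
    | ⟨_, old Q q⟩ => ⟨⟨_, Q⟩, some q⟩
    | ⟨_, new Q⟩ => ⟨⟨_, Q⟩, none⟩
  invFun
    | ⟨⟨_, Q⟩, some q⟩ => ⟨_, old Q q⟩
    | ⟨⟨_, Q⟩, none⟩ => ⟨_, new Q⟩
  left_inv := by rintro ⟨_, Q | Q⟩ <;> rfl
  right_inv := by rintro ⟨⟨_, Q⟩, _ | q⟩ <;> rfl

instance instFinite : (ℓ : ℕ) → Finite (Sigma (Pattern ℓ))
  | 0 => Finite.of_injective (fun _ => ()) <| by
      rintro ⟨_, _ | _⟩ ⟨_, _ | _⟩ _; rfl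
  | ℓ + 1 => by
      have := instFinite ℓ
      exact Finite.of_equiv _ (extendEquiv ℓ).symm

noncomputable instance (ℓ : ℕ) : Fintype (Sigma (Pattern ℓ)) := Fintype.ofFinite _

/-- Every sequence of nodes has exactly one pattern, with an injective assignment of actual nodes.
Induction on the length carries this out. -/
theorem sum_walks {V : Type*} [Fintype V] : {ℓ : ℕ} → (F : (Fin (ℓ + 1) → V) → ℝ) →
    ∑ u, F u = ∑ Q : Sigma (Pattern ℓ), ∑ x : Fin (Q.1 + 1) → V,
      ind (Function.Injective x) * F fun t => x (Q.2.path t)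
  | 0 => fun F => by
    rw [Fintype.sum_eq_single (⟨0, start⟩ : Sigma (Pattern 0))
      (by rintro ⟨_, _ | _⟩ h; exact absurd rfl h)]
    refine Finset.sum_congr rfl fun x _ => ?_
    rw [ind_of (Function.injective_of_subsingleton (α := Fin 1) x), one_mul]
    congr 1
    funext t
    exact congrArg x (Subsingleton.elim (α := Fin 1) _ _)
  | ℓ + 1 => fun F => by
    rw [sum_snoc, sum_walks fun u => ∑ w, F (Fin.snoc (α := fun _ => V) u w),
      ← (extendEquiv ℓ).symm.sum_comp, Fintype.sum_sigma]
    refine Finset.sum_congr rfl fun Q _ => ?_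
    obtain ⟨m, Q⟩ := Q
    rw [Fintype.sum_option]
    refine Eq.trans ?_ (add_comm _ _)
    -- The next node is either one of the nodes already visited or outside their range.
    have e1 : ∀ x : Fin (m + 1) → V, ind (Function.Injective x) *
        ∑ w, F (Fin.snoc (α := fun _ => V) (fun t => x (Q.path t)) w) =
        (∑ q, ind (Function.Injective x) * F fun t => x ((Q.old q).path t)) +
        ∑ w, ind (Function.Injective (Fin.snoc (α := fun _ => V) x w : Fin (m + 2) → V)) *
          F fun t => (Fin.snoc (α := fun _ => V) x w : Fin (m + 2) → V) (Q.new.path t) := by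
      intro x
      have p1 : ∀ q, (fun t => x ((Q.old q).path t)) =
          Fin.snoc (α := fun _ => V) (fun t => x (Q.path t)) (x q) := by
        intro q; funext t
        induction t using Fin.lastCases with
        | last => simp
        | cast t => simp
      have p2 : ∀ w, (fun t => (Fin.snoc (α := fun _ => V) x w : Fin (m + 2) → V)
          (Q.new.path t)) = Fin.snoc (α := fun _ => V) (fun t => x (Q.path t)) w := by
        intro w; funext t
        induction t using Fin.lastCases with
        | last => simp
        | cast t => simp
      simp only [p1, p2, Fin.snoc_injective_iff, ind_and, Set.mem_range, ind_not]
      set G : V → ℝ := fun w => F (Fin.snoc (α := fun _ => V) (fun t => x (Q.path t)) w)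
      by_cases hx : Function.Injective x
      · rw [ind_of hx]
        simp only [one_mul, sub_mul, Finset.sum_sub_distrib]
        have : ∑ w, ind (∃ y, x y = w) * G w = ∑ q, G (x q) := by
          have e3 : ∀ w, ind (∃ y, x y = w) = ∑ y, ind (x y = w) := by
            intro w
            by_cases hw : ∃ y, x y = w
            · rw [ind_of hw]
              obtain ⟨y, rfl⟩ := hw
              rw [Finset.sum_congr rfl fun z _ => ind_congr hx.eq_iff, sum_ind_eq]
            · rw [ind_of_not hw, Finset.sum_eq_zero fun y _ => ind_of_not fun h => hw ⟨y, h⟩]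
          simp only [e3, Finset.sum_mul]
          rw [Finset.sum_comm]
          exact Finset.sum_congr rfl fun q _ => sum_ind_eq_mul' (x q) G
        rw [this]; ring
      · simp [ind_of_not hx]
    rw [Finset.sum_congr rfl fun x _ => e1 x, Finset.sum_add_distrib, Finset.sum_comm]
    congr 1
    exact (sum_snoc fun x : Fin (m + 2) → V => ind (Function.Injective x) *
      F fun t => x (Q.new.path t)).symm

end Pattern

end CompatEst

namespace CompatEst

variable {k : ℕ}

namespace Planted.IsRegular

variable {P : Planted k} {H : Matrix (Fin k) (Fin k) ℝ} {f : ℝ} {μ : PMF ℕ} {p : ℕ}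

/-! ### Removing the truncation of the degrees -/

/-- Exponents above `p` are paid for by the maximum `D`. The subtraction is truncated, so exponents
up to `p` cost nothing; the summand `1` covers degree `0`. -/
theorem pow_le_one_add_pow_mul (d δ p : ℕ) {D : ℝ} (hD : 1 ≤ D) (hd : (d : ℝ) ≤ D) :
    (d : ℝ) ^ δ ≤ (1 + (d : ℝ) ^ p) * D ^ (δ - p) := by
  have hd0 : (0 : ℝ) ≤ d := Nat.cast_nonneg d
  rcases le_total δ p with h | h
  · rw [Nat.sub_eq_zero_of_le h, pow_zero, mul_one]
    rcases Nat.eq_zero_or_pos d with rfl | h0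
    · have : ((0 : ℕ) : ℝ) ^ δ ≤ 1 := pow_le_one₀ (by simp) (by simp)
      have : (0 : ℝ) ≤ ((0 : ℕ) : ℝ) ^ p := by positivity
      linarith
    · have : (d : ℝ) ^ δ ≤ (d : ℝ) ^ p := pow_le_pow_right₀ (by exact_mod_cast h0) h
      linarith
  · obtain ⟨a, rfl⟩ := Nat.exists_eq_add_of_le h
    rw [Nat.add_sub_cancel_left, pow_add]
    have : (d : ℝ) ^ a ≤ D ^ a := by gcongr
    calc _ ≤ (d : ℝ) ^ p * D ^ a := by gcongr
      _ ≤ _ := by gcongr; linarith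

theorem exists_sum_pow_le_maxDeg (h : P.IsRegular H f μ p) :
    ∃ C : ℝ, 1 ≤ C ∧ ∀ᶠ n : ℕ in atTop, ∀ δ, ∑ v, (P.deg n v : ℝ) ^ δ ≤
      C * n * (max (P.maxDeg n : ℝ) 1) ^ (δ - p) := by
  obtain ⟨C, hC, ev⟩ := h.exists_sum_pow_le
  refine ⟨1 + C, by linarith, ?_⟩
  filter_upwards [ev] with n hn δ
  calc _ ≤ ∑ v, (1 + (P.deg n v : ℝ) ^ p) * (max (P.maxDeg n : ℝ) 1) ^ (δ - p) :=
        Finset.sum_le_sum fun v _ => pow_le_one_add_pow_mul _ _ _ (le_max_right _ _)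
          ((P.deg_le_maxDeg v).trans (le_max_left _ _))
    _ ≤ _ := by
        rw [← Finset.sum_mul, Finset.sum_add_distrib]
        refine mul_le_mul_of_nonneg_right ?_ (by positivity)
        simp only [Finset.sum_const, Finset.card_univ, Fintype.card_fin, nsmul_eq_mul, mul_one]
        linarith

/-- Copies of patterns with cycles are rare if only few of the degrees are large. -/
theorem tendsto_expect_isCopy (h : P.IsRegular H f μ p) (hp : 2 ≤ p) {m : ℕ}
    (E : Finset (Sym2 (Fin (m + 1)))) (hE : ∀ z ∈ E, ¬ z.IsDiag) (hm : m + 1 ≤ E.card)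
    (hdeg : ∑ i, (pairDegree E i - p) ≤ p * (E.card - m)) :
    Tendsto (fun n : ℕ => P.expect n (fun ω => ∑ x : Fin (m + 1) → Fin n,
      ind (IsCopy E ω.1 x)) / n) atTop (𝓝 0) := by
  obtain ⟨q, hq, ev⟩ := h.exists_expect_isCopy_le hp E hE
  obtain ⟨C, hC, ev2⟩ := h.exists_sum_pow_le_maxDeg
  set D : ℕ → ℝ := fun n => max (P.maxDeg n : ℝ) 1 with hD
  have hD1 : ∀ n, 1 ≤ D n := fun n => le_max_right _ _
  obtain ⟨a, ha⟩ : ∃ a, E.card = m + (a + 1) := ⟨E.card - m - 1, by omega⟩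
  have hlim : Tendsto (fun n => D n ^ p / n) atTop (𝓝 0) := by
    have := h.tendsto_maxDeg_pow.add (tendsto_const_div_atTop_nhds_zero_nat (1 : ℝ))
    rw [add_zero] at this
    refine squeeze_zero (fun n => by have := hD1 n; positivity) (fun n => ?_) this
    rw [← add_div]
    refine div_le_div_of_nonneg_right ?_ (Nat.cast_nonneg n)
    rcases le_total (P.maxDeg n : ℝ) 1 with h1 | h1
    · rw [hD]; simp only [max_eq_right h1, one_pow]
      have : (0 : ℝ) ≤ (P.maxDeg n : ℝ) ^ p := by positivity
      linarith
    · rw [hD]; simp only [max_eq_left h1]; linarith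
  have lim : Tendsto (fun n => C ^ (m + 1) / q ^ E.card * (D n ^ p / n) ^ (a + 1)) atTop (𝓝 0) := by
    have := (hlim.pow (a + 1)).const_mul (C ^ (m + 1) / q ^ E.card)
    rwa [zero_pow (Nat.succ_ne_zero a), mul_zero] at this
  refine squeeze_zero' (Eventually.of_forall fun n => div_nonneg (expect_nonneg fun _ _ =>
    Finset.sum_nonneg fun _ _ => ind_nonneg _) (Nat.cast_nonneg n)) ?_ lim
  filter_upwards [ev, ev2, eventually_gt_atTop 0] with n hn hn2 hn0
  have hn' : (0 : ℝ) < n := by exact_mod_cast hn0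
  have h1 := hn (fun _ _ => 1) fun _ _ => zero_le_one
  simp only [Finset.prod_const_one, mul_one, one_mul] at h1
  -- With `E.card = m + a + 1`, division by `(q n) ^ E.card` and by `n` leaves a constant times `(D
  -- ^ p / n) ^ (a + 1)`. The assumption `hdeg` provides exactly the exponent `p * (a + 1)`.
  have h2 : ∏ i, ∑ v, (P.deg n v : ℝ) ^ pairDegree E i ≤
      (C * n) ^ (m + 1) * D n ^ (p * (a + 1)) := by
    calc _ ≤ ∏ i, (C * n * D n ^ (pairDegree E i - p)) :=
          Finset.prod_le_prod (fun i _ => Finset.sum_nonneg fun v _ => by positivity)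
            fun i _ => hn2 _
      _ = (C * n) ^ (m + 1) * D n ^ ∑ i, (pairDegree E i - p) := by
          rw [Finset.prod_mul_distrib, Finset.prod_const, Finset.card_fin,
            Finset.prod_pow_eq_pow_sum]
      _ ≤ _ := by
          refine mul_le_mul_of_nonneg_left (pow_le_pow_right₀ (hD1 n) ?_) (by positivity)
          refine hdeg.trans (le_of_eq ?_)
          rw [ha, Nat.add_sub_cancel_left]
  refine (div_le_div_of_nonneg_right (h1.trans (div_le_div_of_nonneg_right h2 (by positivity)))
    hn'.le).trans (le_of_eq ?_)
  rw [ha]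
  simp only [mul_pow, div_pow, pow_add, pow_mul]
  field_simp

/-- The number of copies of a tree in which some node has a large degree is small. -/
theorem exists_trunc (h : P.IsRegular H f μ p) (hp : 2 ≤ p) {m : ℕ} (T : Tree m)
    (hT : ∀ i, T.degree i ≤ p) {ε : ℝ} (hε : 0 < ε) :
    ∀ᶠ t : ℕ in atTop, ∀ᶠ n : ℕ in atTop, P.expect n (fun ω => ∑ x : Fin (m + 1) → Fin n,
      ind (IsCopy T.pairs ω.1 x) * ∑ i, ind (t < P.deg n (x i))) ≤ ε * n := by
  obtain ⟨q, hq, ev⟩ := h.exists_expect_isCopy_le hp T.pairs T.not_isDiag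
  obtain ⟨C, hC, ev2⟩ := h.exists_sum_pow_le_maxDeg
  -- Chosen so that the bounds for the `m + 1` positions of the node of large degree add up to `ε *
  -- n`.
  set η : ℝ := ε * q ^ m / ((m + 1) * C ^ m) with hη
  have hη0 : 0 < η := by positivity
  filter_upwards [h.tail_le hη0] with t ht
  filter_upwards [ht, ev, ev2, eventually_gt_atTop 0] with n hn hn1 hn2 hn0
  have hn' : (0 : ℝ) < n := by exact_mod_cast hn0
  rw [div_le_iff₀ hn'] at hn
  have key : ∀ i, P.expect n (fun ω => ∑ x : Fin (m + 1) → Fin n,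
      ind (IsCopy T.pairs ω.1 x) * ind (t < P.deg n (x i))) ≤ η * n * (C * n) ^ m / (q * n) ^ m := by
    intro i
    -- One node is given the tail weight and the others weight one; since all tree degrees are at
    -- most `p`, each other factor is at most `C * n`.
    have h1 := hn1 (fun j v => if j = i then ind (t < P.deg n v) else 1) fun j v => by
      split_ifs
      exacts [ind_nonneg _, zero_le_one]
    simp only [Finset.prod_ite_eq', Finset.mem_univ, if_true, T.card_pairs,
      T.pairDegree_pairs] at h1
    refine h1.trans (div_le_div_of_nonneg_right ?_ (by positivity))
    rw [← Finset.mul_prod_erase _ _ (Finset.mem_univ i)]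
    refine mul_le_mul ?_ ?_ (Finset.prod_nonneg fun j _ => Finset.sum_nonneg fun v _ => by
      split_ifs
      · exact mul_nonneg (ind_nonneg _) (by positivity)
      · positivity) (by positivity)
    · refine (Finset.sum_le_sum fun v _ => ?_).trans hn
      rw [if_pos rfl, mul_comm]
      by_cases hv : t < P.deg n v
      · refine mul_le_mul_of_nonneg_right ?_ (ind_nonneg _)
        exact pow_le_pow_right₀ (by exact_mod_cast (by omega : 1 ≤ P.deg n v)) (hT i)
      · rw [ind_of_not hv, mul_zero, mul_zero]
    · calc _ ≤ ∏ j ∈ Finset.univ.erase i, C * n := by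
            refine Finset.prod_le_prod (fun j _ => Finset.sum_nonneg fun v _ => by
              split_ifs
              · exact mul_nonneg (ind_nonneg _) (by positivity)
              · positivity) fun j hj => ?_
            have := hn2 (T.degree j)
            rw [Nat.sub_eq_zero_of_le (hT j), pow_zero, mul_one] at this
            simpa only [if_neg (Finset.ne_of_mem_erase hj), one_mul] using this
        _ = _ := by
            rw [Finset.prod_const, Finset.card_erase_of_mem (Finset.mem_univ i), Finset.card_fin,
              Nat.add_sub_cancel]
  simp only [Finset.mul_sum]
  have : P.expect n (fun ω => ∑ x : Fin (m + 1) → Fin n, ∑ i,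
      ind (IsCopy T.pairs ω.1 x) * ind (t < P.deg n (x i))) =
      ∑ i, P.expect n (fun ω => ∑ x : Fin (m + 1) → Fin n,
      ind (IsCopy T.pairs ω.1 x) * ind (t < P.deg n (x i))) := by
    rw [← expect_sum]
    exact expect_congr fun ω _ => Finset.sum_comm
  rw [this]
  refine (Finset.sum_le_sum fun i _ => key i).trans (le_of_eq ?_)
  rw [Finset.sum_const, Finset.card_fin, nsmul_eq_mul, hη, mul_pow, mul_pow]
  push_cast
  field_simp

theorem meanLim_treeSum_one (h : P.IsRegular H f μ p) (hp : 2 ≤ p) (hH : H.IsSymm) {m : ℕ}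
    (T : Tree m) (hT : ∀ i, T.degree i ≤ p) (γ : Fin (m + 1) → Fin k) (b : Fin (m + 1) → Bool) :
    P.MeanLim (fun n ω => P.treeSum T γ (fun _ _ => 1) b n ω / n)
      (T.classWeight H γ * (∏ i, degMean μ (fun j => j.descFactorial (T.degree i)) *
        markFactor f (b i)) / degMoment μ 1 ^ m / k) := by
  refine meanLim_of_approx fun ε hε => ?_
  have lim : Tendsto (fun t : ℕ => T.classWeight H γ * (∏ i, degMean μ (fun j =>
      ind (j ≤ t) * j.descFactorial (T.degree i)) * markFactor f (b i)) / degMoment μ 1 ^ m / k)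
      atTop (𝓝 (T.classWeight H γ * (∏ i, degMean μ (fun j => j.descFactorial (T.degree i)) *
        markFactor f (b i)) / degMoment μ 1 ^ m / k)) := by
    refine (((tendsto_finsetProd _ fun i _ => ?_).const_mul _).div_const _).div_const _
    refine Tendsto.mul_const _ ?_
    have := h.tendsto_degMean_trunc (ψ := fun j => j.descFactorial (T.degree i)) (C := 1)
      fun j hj => by
        rw [one_mul, abs_of_nonneg (Nat.cast_nonneg _)]
        calc ((j.descFactorial (T.degree i) : ℕ) : ℝ) ≤ (j : ℝ) ^ T.degree i := by
              exact_mod_cast Nat.descFactorial_le_pow _ _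
          _ ≤ _ := pow_le_pow_right₀ (by exact_mod_cast hj) (hT i)
    simpa only [mul_comm] using this
  obtain ⟨t, ht1, ht2⟩ := ((Metric.tendsto_nhds.1 lim ε hε).and (h.exists_trunc hp T hT hε)).exists
  refine ⟨fun n ω => P.treeSum T γ (fun _ j => ind (j ≤ t)) b n ω / n, _,
    h.meanLim_treeSum hp hH T γ (fun _ j => ind (j ≤ t)) b t
      fun i j hj => ind_of_not (not_le.2 hj), ht1.le, ?_⟩
  filter_upwards [ht2, eventually_gt_atTop 0] with n hn hn0
  have hn' : (0 : ℝ) < n := by exact_mod_cast hn0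
  have : P.expect n (fun ω => |P.treeSum T γ (fun _ _ => 1) b n ω / n -
      P.treeSum T γ (fun _ j => ind (j ≤ t)) b n ω / n|) ≤
      P.expect n (fun ω => (1 / n : ℝ) * ∑ x : Fin (m + 1) → Fin n,
      ind (IsCopy T.pairs ω.1 x) * ∑ i, ind (t < P.deg n (x i))) := by
    refine expect_mono fun ω _ => ?_
    rw [← sub_div, abs_div, abs_of_pos hn', div_eq_inv_mul, one_div]
    refine mul_le_mul_of_nonneg_left ?_ (by positivity)
    rw [treeSum, treeSum, ← Finset.sum_sub_distrib]
    refine (Finset.abs_sum_le_sum_abs _ _).trans (Finset.sum_le_sum fun x _ => ?_)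
    rw [← mul_sub, abs_mul, abs_of_nonneg (ind_nonneg _)]
    refine mul_le_mul_of_nonneg_left ?_ (ind_nonneg _)
    have e : ∀ i, P.nodeWeight n (γ i) (fun j => ind (j ≤ t)) (b i) ω.2 (x i) =
        P.nodeWeight n (γ i) (fun _ => 1) (b i) ω.2 (x i) * ind (P.deg n (x i) ≤ t) := by
      intro i; simp only [nodeWeight]; ring
    rw [Finset.prod_congr rfl fun i _ => e i, Finset.prod_mul_distrib, ← mul_one_sub, abs_mul]
    have h1 : |∏ i, P.nodeWeight n (γ i) (fun _ => 1) (b i) ω.2 (x i)| ≤ 1 := by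
      rw [Finset.abs_prod]
      refine Finset.prod_le_one (fun _ _ => abs_nonneg _) fun i _ => ?_
      rw [nodeWeight, mul_one, abs_mul, abs_of_nonneg (ind_nonneg _)]
      split_ifs
      · rw [abs_of_nonneg (ind_nonneg _)]
        exact mul_le_one₀ (ind_le_one _) (ind_nonneg _) (ind_le_one _)
      · simpa using ind_le_one _
    refine (mul_le_of_le_one_left (abs_nonneg _) h1).trans ?_
    by_cases hx : ∀ i, P.deg n (x i) ≤ t
    · rw [Finset.prod_congr rfl fun i _ => ind_of (hx i), Finset.prod_const_one, sub_self, abs_zero]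
      exact Finset.sum_nonneg fun i _ => ind_nonneg _
    · push Not at hx
      obtain ⟨i, hi⟩ := hx
      rw [Finset.prod_eq_zero (Finset.mem_univ i) (ind_of_not (not_le.2 hi)), sub_zero, abs_one,
        ← ind_of hi]
      exact Finset.single_le_sum (f := fun i => ind (t < P.deg n (x i)))
        (fun i _ => ind_nonneg _) (Finset.mem_univ i)
  rw [expect_const_mul] at this
  refine this.trans ?_
  rw [one_div, inv_mul_le_iff₀ hn']
  linarith

end Planted.IsRegular

end CompatEst

namespace CompatEst

variable {k : ℕ}

/-! ### Degrees in graphs with few edges -/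

theorem pairDegree_le_card {ι : Type*} (E : Finset (Sym2 ι)) (i : ι) :
    pairDegree E i ≤ E.card := by
  classical
  rw [pairDegree_eq]
  exact Finset.card_filter_le _ _

/-- Two different nodes have at most one pair in common. -/
theorem pairDegree_add_le {ι : Type*} (E : Finset (Sym2 ι)) {i j : ι} (hij : i ≠ j) :
    pairDegree E i + pairDegree E j ≤ E.card + 1 := by
  classical
  rw [pairDegree_eq, pairDegree_eq, ← Finset.card_union_add_card_inter]
  refine Nat.add_le_add (Finset.card_le_card (Finset.union_subset (Finset.filter_subset _ _)
    (Finset.filter_subset _ _))) (Finset.card_le_one_iff.2 fun {x y} hx hy => ?_)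
  simp only [Finset.mem_inter, Finset.mem_filter] at hx hy
  exact ((Sym2.mem_and_mem_iff hij).1 ⟨hx.1.2, hx.2.2⟩).trans
    ((Sym2.mem_and_mem_iff hij).1 ⟨hy.1.2, hy.2.2⟩).symm

theorem sum_pairDegree {ι : Type*} [Fintype ι] (E : Finset (Sym2 ι))
    (hE : ∀ z ∈ E, ¬ z.IsDiag) : ∑ i, pairDegree E i = 2 * E.card := by
  classical
  simp only [pairDegree_eq, Finset.card_filter]
  rw [Finset.sum_comm, mul_comm, ← smul_eq_mul, ← Finset.sum_const]
  refine Finset.sum_congr rfl fun z hz => ?_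
  rw [← Finset.card_filter, ← Sym2.card_toFinset_of_not_isDiag z (hE z hz)]
  congr 1
  ext i
  simp

namespace Pattern

variable {ℓ m : ℕ} {Q : Pattern ℓ m}

/-- In a walk of length at most `2 p - 1` that is not a walk in a tree, at most one node has more
than `p` neighbors. -/
theorem sum_pairDegree_sub_le {p : ℕ} (hℓ : ℓ + 1 ≤ 2 * p) (hm : m + 1 ≤ Q.steps.card) :
    ∑ i, (pairDegree Q.steps i - p) ≤ p * (Q.steps.card - m) := by
  have hE : Q.steps.card ≤ ℓ := Finset.card_image_le.trans_eq (by simp)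
  by_cases h : ∀ i, pairDegree Q.steps i ≤ p
  · rw [Finset.sum_eq_zero fun i _ => Nat.sub_eq_zero_of_le (h i)]
    exact Nat.zero_le _
  · push Not at h
    obtain ⟨i, hi⟩ := h
    -- Two nodes of degree above `p` would give degree sum at least `2 p + 2`, whereas it is at most
    -- `ℓ + 1 ≤ 2 p`. The single excess is below `p` because there are at most `2 p - 1` steps.
    rw [Fintype.sum_eq_single i fun j hj => by
      have := pairDegree_add_le Q.steps hj
      omega]
    have := pairDegree_le_card Q.steps i
    calc _ ≤ p * 1 := by omega
      _ ≤ _ := Nat.mul_le_mul_left _ (by omega)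

/-- The walk never traverses the same edge twice in a row. -/
def IsReduced (Q : Pattern ℓ m) : Prop :=
  ∀ s t : Fin (ℓ + 1), (t : ℕ) = s + 2 → Q.path s ≠ Q.path t

/-- Every node visited between the endpoints has two different neighbors, so only endpoints can have
degree one. Summing the degrees then gives a total excess over `2` of at most `2 |E| - 2 (m + 1) +
2`. -/
theorem IsReduced.sum_pairDegree_sub_le (h : Q.IsReduced) (hE : ∀ z ∈ Q.steps, ¬ z.IsDiag)
    (hm : m + 1 ≤ Q.steps.card) :
    ∑ i, (pairDegree Q.steps i - 2) ≤ 2 * (Q.steps.card - m) := by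
  classical
  have hmem : ∀ t : Fin ℓ, s(Q.path t.castSucc, Q.path t.succ) ∈ Q.steps :=
    fun t => Q.mem_steps.2 ⟨t, rfl⟩
  have hℓ : 0 < ℓ := by
    rcases Nat.eq_zero_or_pos ℓ with rfl | h
    · simp [steps] at hm
    · exact h
  have hdeg : ∀ i, (pairDegree Q.steps i - 2) + 2 ≤ pairDegree Q.steps i +
      (if i = Q.path 0 then 1 else 0) + if i = Q.path (Fin.last _) then 1 else 0 := by
    intro i
    obtain ⟨t, rfl⟩ := Q.path_surjective i
    have h1 : 1 ≤ pairDegree Q.steps (Q.path t) := by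
      rw [pairDegree_eq, Nat.succ_le_iff, Finset.card_pos]
      induction t using Fin.lastCases with
      | last => exact ⟨_, Finset.mem_filter.2 ⟨hmem ⟨ℓ - 1, by omega⟩, by
          have : (⟨ℓ - 1, by omega⟩ : Fin ℓ).succ = Fin.last ℓ := by
            ext; simp; omega
          rw [this]; exact Sym2.mem_mk_right _ _⟩⟩
      | cast t => exact ⟨_, Finset.mem_filter.2 ⟨hmem t, Sym2.mem_mk_left _ _⟩⟩
    by_cases h0 : t = 0
    · subst h0; rw [if_pos rfl]; omega
    by_cases h0' : t = Fin.last _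
    · subst h0'; rw [if_pos rfl]; omega
    · have h2 : 2 ≤ pairDegree Q.steps (Q.path t) := by
        have ht0 : 0 < (t : ℕ) := Nat.pos_of_ne_zero fun e => h0 (Fin.ext e)
        have ht1 : (t : ℕ) < ℓ := by
          have := t.is_lt
          have : (t : ℕ) ≠ ℓ := fun e => h0' (Fin.ext e)
          omega
        set a : Fin ℓ := ⟨t - 1, by omega⟩ with ha
        set b : Fin ℓ := ⟨t, ht1⟩ with hb
        have ea : a.succ = t := by ext; simp [ha]; omega
        have eb : b.castSucc = t := rfl
        rw [pairDegree_eq]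
        refine Finset.one_lt_card.2 ⟨_, Finset.mem_filter.2 ⟨hmem a, ea ▸ Sym2.mem_mk_right _ _⟩,
          _, Finset.mem_filter.2 ⟨hmem b, eb ▸ Sym2.mem_mk_left _ _⟩, fun e => ?_⟩
        rw [ea, eb, Sym2.eq_swap, Sym2.congr_right] at e
        exact h a.castSucc b.succ (by simp [ha, hb]; omega) e
      omega
  have := Finset.sum_le_sum fun i (_ : i ∈ Finset.univ) => hdeg i
  simp only [Finset.sum_add_distrib, sum_pairDegree _ hE, Finset.sum_const, Finset.card_univ,
    Fintype.card_fin, smul_eq_mul, Finset.sum_ite_eq', Finset.mem_univ, if_true] at this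
  omega

/-- The pattern contributes at most linearly many walks if the `p`-th moments of the degrees are
bounded. -/
structure IsAdmissible (Q : Pattern ℓ m) (p : ℕ) : Prop where
  degree_le : Q.IsTreeWalk → ∀ i, Q.tree.degree i ≤ p
  sum_le : (∀ z ∈ Q.steps, ¬ z.IsDiag) → m + 1 ≤ Q.steps.card →
    ∑ i, (pairDegree Q.steps i - p) ≤ p * (Q.steps.card - m)

theorem isAdmissible (Q : Pattern ℓ m) : Q.IsAdmissible (ℓ / 2 + 1) where
  degree_le _ i := by
    have := Q.two_mul_degree_le i
    split_ifs at this <;> omega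
  sum_le _ hm := sum_pairDegree_sub_le (by omega) hm

/-- A reduced walk in a tree is straight, so its degrees are at most two; this is why second moments
suffice for the non-backtracking statistic. -/
theorem IsReduced.isAdmissible (h : Q.IsReduced) : Q.IsAdmissible 2 where
  degree_le ht i := by
    obtain ⟨rfl, hQ⟩ := Sigma.mk.inj (ht.eq_straight_of_nonbacktracking h)
    obtain rfl := eq_of_heq hQ
    rw [degree_straight]
    split_ifs <;> omega
  sum_le := h.sum_pairDegree_sub_le

/-- Whether a node of the pattern is an endpoint of the walk. -/
def isEnd (Q : Pattern ℓ m) (i : Fin (m + 1)) : Bool :=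
  decide (i = Q.path 0 ∨ i = Q.path (Fin.last _))

open Classical in
/-- The asymptotic number of walks with a given pattern, per node. -/
noncomputable def weight (Q : Pattern ℓ m) (f : ℝ) (μ : PMF ℕ) : ℝ :=
  if Q.IsTreeWalk then
    (∏ i, degMean μ (fun j => j.descFactorial (Q.tree.degree i)) * markFactor f (Q.isEnd i)) /
      degMoment μ 1 ^ m
  else 0

/-- The distance in the tree between the endpoints of the walk. -/
def endDist (Q : Pattern ℓ m) : ℕ := Q.tree.dist (Q.path 0) (Q.path (Fin.last _))

end Pattern

/-! ### Class counts of walks as sums over patterns, and their limits -/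

namespace Planted

variable {P : Planted k} {H : Matrix (Fin k) (Fin k) ℝ} {f : ℝ} {μ : PMF ℕ} {p : ℕ}

/-- The number of walks of a given pattern between labelled nodes of given classes. -/
noncomputable def patternCount (P : Planted k) {ℓ m : ℕ} (Q : Pattern ℓ m) (c e : Fin k) (n : ℕ)
    (ω : SimpleGraph (Fin n) × Finset (Fin n)) : ℝ :=
  ∑ x : Fin (m + 1) → Fin n, ind (IsCopy Q.steps ω.1 x) *
    (ind (x (Q.path 0) ∈ ω.2 ∧ P.label n (x (Q.path 0)) = c) *
      ind (x (Q.path (Fin.last _)) ∈ ω.2 ∧ P.label n (x (Q.path (Fin.last _))) = e))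

theorem prod_ind {ι : Type*} [Fintype ι] (q : ι → Prop) : ∏ i, ind (q i) = ind (∀ i, q i) := by
  by_cases h : ∀ i, q i
  · rw [ind_of h, Finset.prod_congr rfl fun i _ => ind_of (h i), Finset.prod_const_one]
  · rw [ind_of_not h]
    push Not at h
    obtain ⟨i, hi⟩ := h
    exact Finset.prod_eq_zero (Finset.mem_univ i) (ind_of_not hi)

/-- Only the endpoint classes are prescribed, so the classes of all nodes are summed over. Marks sit
at the endpoints alone and count once if the walk is closed. -/
theorem patternCount_eq_sum_treeSum {ℓ m : ℕ} {Q : Pattern ℓ m} (hQ : Q.IsTreeWalk) (c e : Fin k)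
    {n : ℕ} (ω : SimpleGraph (Fin n) × Finset (Fin n)) :
    P.patternCount Q c e n ω = ∑ γ : Fin (m + 1) → Fin k,
      ind (γ (Q.path 0) = c) * ind (γ (Q.path (Fin.last _)) = e) *
        P.treeSum Q.tree γ (fun _ _ => 1) Q.isEnd n ω := by
  simp only [patternCount, treeSum, Finset.mul_sum]
  rw [Finset.sum_comm]
  refine Finset.sum_congr rfl fun x _ => ?_
  rw [hQ.steps_eq]
  have e1 : ∀ γ : Fin (m + 1) → Fin k,
      ∏ i, P.nodeWeight n (γ i) (fun _ => 1) (Q.isEnd i) ω.2 (x i) =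
      ind ((fun i => P.label n (x i)) = γ) *
        (ind (x (Q.path 0) ∈ ω.2) * ind (x (Q.path (Fin.last _)) ∈ ω.2)) := by
    intro γ
    simp only [nodeWeight, mul_one, Finset.prod_mul_distrib]
    congr 1
    · rw [prod_ind]; exact ind_congr funext_iff.symm
    · have : ∀ i, (if Q.isEnd i then ind (x i ∈ ω.2) else 1) =
          ind (Q.isEnd i = true → x i ∈ ω.2) := by
        intro i
        split_ifs with h
        · exact ind_congr ⟨fun h' _ => h', fun h' => h' h⟩
        · rw [ind_of fun h' => absurd h' h]
      rw [Finset.prod_congr rfl fun i _ => this i, prod_ind, ← ind_and]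
      refine ind_congr ⟨fun h => ⟨h _ (by simp [Pattern.isEnd]), h _ (by simp [Pattern.isEnd])⟩, ?_⟩
      rintro ⟨h1, h2⟩ i hi
      rcases of_decide_eq_true hi with rfl | rfl
      exacts [h1, h2]
  have e2 : ∀ γ : Fin (m + 1) → Fin k, ind (γ (Q.path 0) = c) * ind (γ (Q.path (Fin.last _)) = e) *
      (ind (IsCopy Q.tree.pairs ω.1 x) *
        ∏ i, P.nodeWeight n (γ i) (fun _ => 1) (Q.isEnd i) ω.2 (x i)) =
      ind ((fun i => P.label n (x i)) = γ) * (ind (γ (Q.path 0) = c) *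
        ind (γ (Q.path (Fin.last _)) = e) * (ind (IsCopy Q.tree.pairs ω.1 x) *
        (ind (x (Q.path 0) ∈ ω.2) * ind (x (Q.path (Fin.last _)) ∈ ω.2)))) := by
    intro γ; rw [e1]; ring
  rw [Finset.sum_congr rfl fun γ _ => e2 γ, sum_ind_eq_mul']
  simp only [ind_and]
  ring

theorem patternCount_nonneg {ℓ m : ℕ} (Q : Pattern ℓ m) (c e : Fin k) {n : ℕ}
    (ω : SimpleGraph (Fin n) × Finset (Fin n)) : 0 ≤ P.patternCount Q c e n ω :=
  Finset.sum_nonneg fun _ _ => mul_nonneg (ind_nonneg _) (mul_nonneg (ind_nonneg _) (ind_nonneg _))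

/-- The common form of both statistics: `χ` expresses the part of the condition on walks that
depends on the pattern alone. -/
theorem classCounts_eq_sum_patternCount {ℓ n : ℕ} {χ : Sigma (Pattern ℓ) → Prop}
    {ω : SimpleGraph (Fin n) × Finset (Fin n)} {A : Matrix (Fin n) (Fin n) ℝ}
    {W : (Fin (ℓ + 1) → Fin n) → Prop}
    (hA : ∀ i j, A i j = ∑ u : Fin (ℓ + 1) → Fin n, ind (W u ∧ u 0 = i ∧ u (Fin.last _) = j))
    (hW : ∀ (Q : Sigma (Pattern ℓ)) (x : Fin (Q.1 + 1) → Fin n), Function.Injective x →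
      (W (fun t => x (Q.2.path t)) ↔ χ Q ∧
        ∀ t : Fin ℓ, ω.1.Adj (x (Q.2.path t.castSucc)) (x (Q.2.path t.succ))))
    (c e : Fin k) :
    classCounts (P.label n) ω.2 A c e = ∑ Q : Sigma (Pattern ℓ),
      ind (χ Q) * P.patternCount Q.2 c e n ω := by
  rw [classCounts_apply]
  have e1 : ∑ x, ∑ y, ind (x ∈ ω.2 ∧ P.label n x = c) * ind (y ∈ ω.2 ∧ P.label n y = e) * A x y =
      ∑ u : Fin (ℓ + 1) → Fin n, ind (W u) * (ind (u 0 ∈ ω.2 ∧ P.label n (u 0) = c) *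
        ind (u (Fin.last _) ∈ ω.2 ∧ P.label n (u (Fin.last _)) = e)) := by
    simp only [hA, Finset.mul_sum]
    rw [Finset.sum_congr rfl fun x _ => Finset.sum_comm, Finset.sum_comm]
    refine Finset.sum_congr rfl fun u _ => ?_
    have : ∀ x y, ind (x ∈ ω.2 ∧ P.label n x = c) * ind (y ∈ ω.2 ∧ P.label n y = e) *
        ind (W u ∧ u 0 = x ∧ u (Fin.last _) = y) = ind (u 0 = x) * (ind (u (Fin.last _) = y) *
        (ind (W u) * (ind (x ∈ ω.2 ∧ P.label n x = c) * ind (y ∈ ω.2 ∧ P.label n y = e)))) := by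
      intro x y; rw [ind_and (W u), ind_and (u 0 = x)]; ring
    simp only [this, ← Finset.mul_sum]
    rw [sum_ind_eq_mul', sum_ind_eq_mul']
  rw [e1, Pattern.sum_walks]
  refine Finset.sum_congr rfl fun Q _ => ?_
  rw [patternCount, Finset.mul_sum]
  refine Finset.sum_congr rfl fun x _ => ?_
  have key : ind (Function.Injective x) * ind (W fun t => x (Q.2.path t)) =
      ind (χ Q) * ind (IsCopy Q.2.steps ω.1 x) := by
    rw [← ind_and, ← ind_and]
    refine ind_congr ⟨fun h => ?_, fun h => ⟨h.2.1, (hW Q x h.2.1).2 ⟨h.1, fun t => ?_⟩⟩⟩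
    · obtain ⟨h1, h2⟩ := (hW Q x h.1).1 h.2
      refine ⟨h1, h.1, fun z hz => ?_⟩
      obtain ⟨t, rfl⟩ := Q.2.mem_steps.1 hz
      exact h2 t
    · exact h.2.2 _ (Q.2.mem_steps.2 ⟨t, rfl⟩)
  rw [← mul_assoc, key, mul_assoc]

theorem adjacency_pow_apply {V : Type*} [Fintype V] [DecidableEq V] (G : SimpleGraph V) :
    (ℓ : ℕ) → ∀ i j, (adjacency G ^ ℓ) i j = ∑ u : Fin (ℓ + 1) → V,
      ind ((∀ t : Fin ℓ, G.Adj (u t.castSucc) (u t.succ)) ∧ u 0 = i ∧ u (Fin.last _) = j)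
  | 0 => fun i j => by
    rw [sum_fin_one, pow_zero, Matrix.one_apply, ← mul_one (ite _ _ _)]
    have : ∀ a : V, ind ((∀ t : Fin 0, G.Adj ((fun _ : Fin 1 => a) t.castSucc)
        ((fun _ : Fin 1 => a) t.succ)) ∧ a = i ∧ a = j) = ind (a = i) * ind (a = j) := by
      intro a
      rw [← ind_and]
      exact ind_congr ⟨fun h => h.2, fun h => ⟨fun t => t.elim0, h⟩⟩
    rw [Finset.sum_congr rfl fun a _ => this a, sum_ind_eq_mul, ← mul_one (ind _), ind_mul_eq_ite]
    simp
  | ℓ + 1 => fun i j => by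
    rw [pow_succ, Matrix.mul_apply, sum_snoc]
    have e : ∀ (u : Fin (ℓ + 1) → V) w, ind ((∀ t : Fin (ℓ + 1),
        G.Adj ((Fin.snoc (α := fun _ => V) u w : Fin (ℓ + 2) → V) t.castSucc)
        ((Fin.snoc (α := fun _ => V) u w : Fin (ℓ + 2) → V) t.succ)) ∧
        (Fin.snoc (α := fun _ => V) u w : Fin (ℓ + 2) → V) 0 = i ∧
        (Fin.snoc (α := fun _ => V) u w : Fin (ℓ + 2) → V) (Fin.last _) = j) =
        ind (w = j) * (ind (G.Adj (u (Fin.last _)) w) *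
          ind ((∀ t : Fin ℓ, G.Adj (u t.castSucc) (u t.succ)) ∧ u 0 = i)) := by
      intro u w
      rw [← ind_and, ← ind_and]
      refine ind_congr ?_
      rw [Fin.forall_fin_succ', ← Fin.castSucc_zero]
      simp only [Fin.succ_castSucc, Fin.succ_last, Fin.snoc_castSucc, Fin.snoc_last]
      tauto
    simp only [e, sum_ind_eq_mul]
    simp only [adjacency_pow_apply G ℓ, adjacency_apply, Finset.sum_mul]
    rw [Finset.sum_comm]
    refine Finset.sum_congr rfl fun u _ => ?_
    have : ∀ y, ind ((∀ t : Fin ℓ, G.Adj (u t.castSucc) (u t.succ)) ∧ u 0 = i ∧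
        u (Fin.last _) = y) * ind (G.Adj y j) = ind (u (Fin.last _) = y) * (ind (G.Adj y j) *
        ind ((∀ t : Fin ℓ, G.Adj (u t.castSucc) (u t.succ)) ∧ u 0 = i)) := by
      intro y; rw [← and_assoc, ind_and]; ring
    rw [Finset.sum_congr rfl fun y _ => this y, sum_ind_eq_mul']

namespace IsRegular

/-- Three cases. A tree walk is a sum of tree counts; a pattern without loops but with a step off
the tree has at least `m + 1` edges and is rare; a pattern with a loop has no copies. -/
theorem meanLim_patternCount (h : P.IsRegular H f μ p) (hp : 2 ≤ p) (hH : H.IsSymm)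
    (hrow : ∀ c, ∑ e, H c e = 1) {ℓ m : ℕ} {Q : Pattern ℓ m} (hQ : Q.IsAdmissible p)
    (c e : Fin k) :
    P.MeanLim (fun n ω => P.patternCount Q c e n ω / n)
      (Q.weight f μ * (H ^ Q.endDist) c e / k) := by
  by_cases ht : Q.IsTreeWalk
  · have := meanLim_sum (P := P) Finset.univ fun γ _ =>
      (h.meanLim_treeSum_one hp hH Q.tree (hQ.degree_le ht) γ Q.isEnd).const_mul
        (ind (γ (Q.path 0) = c) * ind (γ (Q.path (Fin.last _)) = e))
    refine (this.congr (Eventually.of_forall fun n ω _ => ?_)).congr_lim ?_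
    · rw [patternCount_eq_sum_treeSum ht, Finset.sum_div]
      exact Finset.sum_congr rfl fun γ _ => by rw [mul_div_assoc]
    · rw [Pattern.weight, if_pos ht, Pattern.endDist, ← Tree.sum_classWeight H hH hrow,
        Finset.mul_sum, Finset.sum_div]
      exact Finset.sum_congr rfl fun γ _ => by ring
  · rw [Pattern.weight, if_neg ht, zero_mul, zero_div]
    by_cases hE : ∀ z ∈ Q.steps, ¬ z.IsDiag
    · have hm : m + 1 ≤ Q.steps.card := by
        have h1 := Q.tree.card_pairs
        have : Q.tree.pairs ⊂ Q.steps := by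
          refine (Finset.ssubset_iff_subset_ne).2 ⟨Q.pairs_subset_steps, fun e => ht fun t => ?_⟩
          rw [e]; exact Q.mem_steps.2 ⟨t, rfl⟩
        have := Finset.card_lt_card this
        omega
      refine meanLim_of_le (h.tendsto_expect_isCopy hp _ hE hm (hQ.sum_le hE hm))
        (Eventually.of_forall fun n => ?_)
      rw [div_eq_inv_mul, ← expect_const_mul]
      refine expect_mono fun ω _ => ?_
      rw [sub_zero, abs_of_nonneg (div_nonneg (patternCount_nonneg _ _ _ _) (Nat.cast_nonneg n)),
        div_eq_inv_mul]
      refine mul_le_mul_of_nonneg_left (Finset.sum_le_sum fun x _ => ?_) (by positivity)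
      exact mul_le_of_le_one_right (ind_nonneg _) (mul_le_one₀ (ind_le_one _) (ind_nonneg _)
        (ind_le_one _))
    · push Not at hE
      obtain ⟨z, hz, hd⟩ := hE
      refine (meanLim_of_tendsto (P := P) (a := fun _ => 0) tendsto_const_nhds).congr
        (Eventually.of_forall fun n ω _ => ?_)
      rw [patternCount, Finset.sum_eq_zero, zero_div]
      intro x _
      rw [ind_of_not, zero_mul]
      intro hx
      exact ω.1.not_isDiag_of_mem_edgeSet (hx.2 z hz) (hd.map)

/-- The limit of a statistic of walks of admissible patterns. -/
theorem convergesInProb_of_patterns (h : P.IsRegular H f μ p) (hp : 2 ≤ p) (hH : H.IsSymm)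
    (hrow : ∀ c, ∑ e, H c e = 1) {ℓ : ℕ} {χ : Sigma (Pattern ℓ) → Prop}
    (hχ : ∀ Q, χ Q → Q.2.IsAdmissible p)
    {A : ∀ n, SimpleGraph (Fin n) → Matrix (Fin n) (Fin n) ℝ}
    (hA : ∀ n (G : SimpleGraph (Fin n)) S c e, classCounts (P.label n) S (A n G) c e =
      ∑ Q : Sigma (Pattern ℓ), ind (χ Q) * P.patternCount Q.2 c e n (G, S))
    (hpos : 0 < ∑ Q : Sigma (Pattern ℓ), ind (χ Q) * Q.2.weight f μ) :
    P.ConvergesInProb (fun n G S => rowNormalize (classCounts (P.label n) S (A n G)))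
      (Matrix.of fun c e => (∑ Q : Sigma (Pattern ℓ),
        ind (χ Q) * Q.2.weight f μ * (H ^ Q.2.endDist) c e) /
        ∑ Q : Sigma (Pattern ℓ), ind (χ Q) * Q.2.weight f μ) := by
  have hk : (0 : ℝ) < k := by exact_mod_cast P.numClasses_pos
  have hpow : ∀ a c, ∑ e, (H ^ a) c e = 1 := by
    intro a
    induction a with
    | zero => intro c; simp [Matrix.one_apply]
    | succ a ih =>
      intro c
      simp only [pow_succ, Matrix.mul_apply]
      rw [Finset.sum_comm]
      simp only [← Finset.mul_sum, hrow, mul_one, ih]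
  set L : Matrix (Fin k) (Fin k) ℝ := Matrix.of fun c e => ∑ Q : Sigma (Pattern ℓ),
    ind (χ Q) * (Q.2.weight f μ * (H ^ Q.2.endDist) c e / k) with hL
  have hsum : ∀ c, ∑ e, L c e = (∑ Q : Sigma (Pattern ℓ), ind (χ Q) * Q.2.weight f μ) / k := by
    intro c
    simp only [hL, Matrix.of_apply]
    rw [Finset.sum_comm, Finset.sum_div]
    refine Finset.sum_congr rfl fun Q _ => ?_
    rw [← Finset.mul_sum, ← Finset.sum_div, ← Finset.mul_sum, hpow]
    ring
  have main := convergesInProb_rowNormalize (P := P) (C := fun n G S =>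
    classCounts (P.label n) S (A n G)) (L := L) (fun c e => ?_) (fun c => ?_)
  · convert main using 1
    ext c e
    rw [rowNormalize, Matrix.of_apply, Matrix.of_apply, hsum, hL, Matrix.of_apply]
    rw [← mul_div_mul_right _ _ (one_div_pos.2 hk).ne', mul_one_div (∑ Q : Sigma (Pattern ℓ),
      ind (χ Q) * Q.2.weight f μ), Finset.sum_mul]
    congr 1
    exact Finset.sum_congr rfl fun Q _ => by ring
  · have : ∀ Q : Sigma (Pattern ℓ), P.MeanLim
        (fun n ω => ind (χ Q) * (P.patternCount Q.2 c e n ω / n))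
        (ind (χ Q) * (Q.2.weight f μ * (H ^ Q.2.endDist) c e / k)) := by
      intro Q
      by_cases hQ : χ Q
      · exact (h.meanLim_patternCount hp hH hrow (hχ Q hQ) c e).const_mul _
      · simp only [ind_of_not hQ, zero_mul]
        exact meanLim_of_tendsto tendsto_const_nhds
    refine (meanLim_sum (P := P) Finset.univ fun Q _ => this Q).congr
      (Eventually.of_forall fun n ω _ => ?_)
    rw [hA, Finset.sum_div]
    exact Finset.sum_congr rfl fun Q _ => by rw [mul_div_assoc]
  · rw [hsum]; exact div_pos hpos hk

end IsRegular

end Planted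

end CompatEst

namespace CompatEst

variable {k : ℕ}

/-! ### Powers of a symmetric doubly stochastic matrix -/

section Stochastic

variable {H : Matrix (Fin k) (Fin k) ℝ}

theorem sum_row_pow (hH : H ∈ doublyStochastic ℝ (Fin k)) (a : ℕ) (c : Fin k) :
    ∑ e, (H ^ a) c e = 1 := sum_row_of_mem_doublyStochastic (pow_mem hH a) c

theorem pow_apply_nonneg (hH : H ∈ doublyStochastic ℝ (Fin k)) (a : ℕ) (c e : Fin k) :
    0 ≤ (H ^ a) c e := nonneg_of_mem_doublyStochastic (pow_mem hH a)

theorem pow_apply_le_one (hH : H ∈ doublyStochastic ℝ (Fin k)) (a : ℕ) (c e : Fin k) :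
    (H ^ a) c e ≤ 1 := by
  rw [← sum_row_pow hH a c]
  exact Finset.single_le_sum (f := fun e => (H ^ a) c e)
    (fun e _ => pow_apply_nonneg hH a c e) (Finset.mem_univ e)

theorem pow_add_diag (hsymm : H.IsSymm) (a b : ℕ) (c : Fin k) :
    (H ^ (a + b)) c c = ∑ e, (H ^ a) c e * (H ^ b) c e := by
  rw [pow_add, Matrix.mul_apply]
  refine Finset.sum_congr rfl fun e _ => ?_
  rw [(hsymm.pow b).apply c e]

/-- A doubly stochastic matrix is a contraction in the Euclidean norm: Cauchy–Schwarz with column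
weights, then the row sums. -/
theorem sum_sq_mul_le (hH : H ∈ doublyStochastic ℝ (Fin k)) (y : Fin k → ℝ) :
    ∑ e, (∑ g, y g * H g e) ^ 2 ≤ ∑ g, y g ^ 2 := by
  have h1 : ∀ e, (∑ g, y g * H g e) ^ 2 ≤ ∑ g, y g ^ 2 * H g e := by
    intro e
    have := Finset.sum_sq_le_sum_mul_sum_of_sq_le_mul Finset.univ (r := fun g => y g * H g e)
      (f := fun g => H g e) (g := fun g => y g ^ 2 * H g e)
      (fun g _ => nonneg_of_mem_doublyStochastic hH)
      (fun g _ => mul_nonneg (sq_nonneg _) (nonneg_of_mem_doublyStochastic hH))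
      fun g _ => le_of_eq (by ring)
    rwa [sum_col_of_mem_doublyStochastic hH, one_mul] at this
  refine (Finset.sum_le_sum fun e _ => h1 e).trans (le_of_eq ?_)
  rw [Finset.sum_comm]
  refine Finset.sum_congr rfl fun g _ => ?_
  rw [← Finset.mul_sum, sum_row_of_mem_doublyStochastic hH, mul_one]

/-- By symmetry `(H ^ (2 * s)) c c` is the squared norm of row `c` of `H ^ s`, and each further
factor `H` contracts. -/
theorem pow_diag_antitone (hH : H ∈ doublyStochastic ℝ (Fin k)) (hsymm : H.IsSymm) (c : Fin k) :
    Antitone fun s => (H ^ (2 * s)) c c := by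
  refine antitone_nat_of_succ_le fun s => ?_
  rw [two_mul, two_mul, pow_add_diag hsymm, pow_add_diag hsymm]
  have := sum_sq_mul_le hH fun e => (H ^ s) c e
  simpa only [pow_succ H s, Matrix.mul_apply, sq] using this

/-- The squared norm of the difference of the two rows is a second difference of the diagonal
sequence. Equality at one step makes it nonpositive, by monotonicity at the next. -/
theorem pow_add_two_apply_of_diag_eq (hH : H ∈ doublyStochastic ℝ (Fin k)) (hsymm : H.IsSymm)
    {s : ℕ} {c : Fin k} (h : (H ^ (2 * (s + 1))) c c = (H ^ (2 * s)) c c) (e : Fin k) :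
    (H ^ (s + 2)) c e = (H ^ s) c e := by
  have h1 : ∑ e, ((H ^ (s + 2)) c e - (H ^ s) c e) ^ 2 ≤ 0 := by
    have e1 : ∑ e, ((H ^ (s + 2)) c e - (H ^ s) c e) ^ 2 =
        (H ^ (2 * (s + 2))) c c - 2 * (H ^ (2 * (s + 1))) c c + (H ^ (2 * s)) c c := by
      rw [show 2 * (s + 2) = (s + 2) + (s + 2) by ring, show 2 * (s + 1) = (s + 2) + s by ring,
        show 2 * s = s + s by ring, pow_add_diag hsymm, pow_add_diag hsymm, pow_add_diag hsymm,
        Finset.mul_sum, ← Finset.sum_sub_distrib, ← Finset.sum_add_distrib]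
      exact Finset.sum_congr rfl fun e _ => by ring
    have h2 := pow_diag_antitone hH hsymm c (Nat.le_succ (s + 1))
    simp only [Nat.succ_eq_add_one] at h2
    rw [e1]
    linarith
  have h2 := (Finset.sum_eq_zero_iff_of_nonneg fun e _ => sq_nonneg _).1
    (le_antisymm h1 (Finset.sum_nonneg fun e _ => sq_nonneg _)) e (Finset.mem_univ e)
  exact sub_eq_zero.1 (pow_eq_zero_iff two_ne_zero |>.1 h2)

theorem exists_diag_lt (hH : H ∈ doublyStochastic ℝ (Fin k)) (hsymm : H.IsSymm) {s : ℕ}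
    (h : H ^ (s + 2) ≠ H ^ s) : ∃ c, (H ^ (2 * (s + 1))) c c < (H ^ (2 * s)) c c := by
  by_contra! hc
  refine h ?_
  ext c e
  exact pow_add_two_apply_of_diag_eq hH hsymm
    (le_antisymm (pow_diag_antitone hH hsymm c (Nat.le_succ s)) (hc c)) e

/-- Pairing with `H` turns odd powers into traces of even powers, where monotonicity is available.
-/
theorem trace_mul_pow (hsymm : H.IsSymm) (a : ℕ) :
    ∑ c, ∑ e, H c e * (H ^ a) c e = (H ^ (a + 1)).trace := by
  rw [Matrix.trace]
  refine Finset.sum_congr rfl fun c _ => ?_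
  rw [Matrix.diag_apply, add_comm, pow_add_diag hsymm, pow_one]

theorem trace_antitone (hH : H ∈ doublyStochastic ℝ (Fin k)) (hsymm : H.IsSymm) :
    Antitone fun s => (H ^ (2 * s)).trace := fun _ _ hst =>
  Finset.sum_le_sum fun c _ => pow_diag_antitone hH hsymm c hst

theorem trace_lt (hH : H ∈ doublyStochastic ℝ (Fin k)) (hsymm : H.IsSymm) {s : ℕ}
    (h : H ^ (s + 2) ≠ H ^ s) : (H ^ (2 * (s + 1))).trace < (H ^ (2 * s)).trace := by
  obtain ⟨c, hc⟩ := exists_diag_lt hH hsymm h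
  exact Finset.sum_lt_sum (fun c _ => pow_diag_antitone hH hsymm c (Nat.le_succ s))
    ⟨c, Finset.mem_univ c, hc⟩

theorem pow_add_two_ne {a b : ℕ} (hab : a ≤ b) (h : H ^ (b + 2) ≠ H ^ b) :
    H ^ (a + 2) ≠ H ^ a := by
  intro e
  obtain ⟨j, rfl⟩ := Nat.exists_eq_add_of_le hab
  refine h ?_
  rw [add_right_comm, pow_add, e, ← pow_add]

end Stochastic

/-! ### Weighted means -/

section Mixture

variable {ι : Type*} [Fintype ι] {w x : ι → ℝ} {y g : ℝ} {i₀ : ι}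

theorem mixture_sub (hS : 0 < ∑ i, w i) :
    (∑ i, w i * x i) / (∑ i, w i) - y = (∑ i, w i * (x i - y)) / ∑ i, w i := by
  rw [eq_div_iff hS.ne', sub_mul, div_mul_cancel₀ _ hS.ne', Finset.mul_sum,
    ← Finset.sum_sub_distrib]
  exact Finset.sum_congr rfl fun i _ => by ring

/-- The reference term contributes no bias, and all other mass contributes at least `g` per unit. -/
theorem le_mixture_sub (hw : ∀ i, 0 ≤ w i) (hS : 0 < ∑ i, w i) (hx₀ : x i₀ = y)
    (hx : ∀ i, i ≠ i₀ → w i ≠ 0 → g ≤ x i - y) :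
    (1 - w i₀ / ∑ i, w i) * g ≤ (∑ i, w i * x i) / (∑ i, w i) - y := by
  classical
  rw [mixture_sub hS, one_sub_div hS.ne', div_mul_eq_mul_div]
  refine div_le_div_of_nonneg_right ?_ hS.le
  rw [← Finset.add_sum_erase _ w (Finset.mem_univ i₀),
    ← Finset.add_sum_erase _ (fun i => w i * (x i - y)) (Finset.mem_univ i₀), hx₀,
    sub_self, mul_zero, zero_add, add_sub_cancel_left, Finset.sum_mul]
  refine Finset.sum_le_sum fun i hi => ?_
  by_cases h0 : w i = 0
  · rw [h0, zero_mul, zero_mul]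
  · exact mul_le_mul_of_nonneg_left (hx i (Finset.ne_of_mem_erase hi) h0) (hw i)

theorem single_le_mixture_sub (hw : ∀ i, 0 ≤ w i) (hS : 0 < ∑ i, w i)
    (hx : ∀ i, w i ≠ 0 → y ≤ x i) (i : ι) :
    w i / (∑ i, w i) * (x i - y) ≤ (∑ i, w i * x i) / (∑ i, w i) - y := by
  rw [mixture_sub hS, div_mul_eq_mul_div]
  refine div_le_div_of_nonneg_right ?_ hS.le
  refine Finset.single_le_sum (f := fun i => w i * (x i - y)) (fun i _ => ?_) (Finset.mem_univ i)
  by_cases h0 : w i = 0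
  · rw [h0, zero_mul]
  · exact mul_nonneg (hw i) (sub_nonneg.2 (hx i h0))

theorem abs_mixture_sub_le (hw : ∀ i, 0 ≤ w i) (hS : 0 < ∑ i, w i) (hx₀ : x i₀ = y)
    (hx : ∀ i, |x i - y| ≤ 1) :
    |(∑ i, w i * x i) / (∑ i, w i) - y| ≤ 1 - w i₀ / ∑ i, w i := by
  classical
  rw [mixture_sub hS, one_sub_div hS.ne', abs_div, abs_of_pos hS]
  refine div_le_div_of_nonneg_right ?_ hS.le
  rw [← Finset.add_sum_erase _ w (Finset.mem_univ i₀),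
    ← Finset.add_sum_erase _ (fun i => w i * (x i - y)) (Finset.mem_univ i₀), hx₀,
    sub_self, mul_zero, zero_add, add_sub_cancel_left]
  refine (Finset.abs_sum_le_sum_abs _ _).trans (Finset.sum_le_sum fun i _ => ?_)
  rw [abs_mul, abs_of_nonneg (hw i)]
  exact mul_le_of_le_one_right (hw i) (hx i)

end Mixture

/-! ### Weights of patterns -/

/-- The factorial moments of the degree law. -/
noncomputable def factMean (μ : PMF ℕ) (δ : ℕ) : ℝ := degMean μ fun j => j.descFactorial δ

theorem factMean_nonneg (μ : PMF ℕ) (δ : ℕ) : 0 ≤ factMean μ δ :=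
  tsum_nonneg fun _ => mul_nonneg (Nat.cast_nonneg _) ENNReal.toReal_nonneg

theorem hasSum_toReal (μ : PMF ℕ) : HasSum (fun j => (μ j).toReal) 1 := by
  have := ENNReal.hasSum_toReal (f := μ) (by rw [μ.tsum_coe]; exact ENNReal.one_ne_top)
  rwa [← ENNReal.tsum_toReal_eq fun j => μ.apply_ne_top j, μ.tsum_coe, ENNReal.toReal_one] at this

theorem degMean_const (μ : PMF ℕ) (c : ℝ) : degMean μ (fun _ => c) = c := by
  rw [degMean, tsum_mul_left, (hasSum_toReal μ).tsum_eq, mul_one]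

theorem factMean_zero (μ : PMF ℕ) : factMean μ 0 = 1 := by
  simpa [factMean] using degMean_const μ 1

theorem factMean_one (μ : PMF ℕ) : factMean μ 1 = degMoment μ 1 := by
  simp [factMean, degMoment_eq_degMean]

theorem markFactor_nonneg {f : ℝ} (hf : 0 < f) (b : Bool) : 0 ≤ markFactor f b := by
  unfold markFactor; split_ifs <;> linarith

theorem markFactor_le_one {f : ℝ} (hf : f ≤ 1) (b : Bool) : markFactor f b ≤ 1 := by
  unfold markFactor; split_ifs <;> linarith

namespace Pattern

variable {ℓ m : ℕ} (Q : Pattern ℓ m) {f : ℝ} {μ : PMF ℕ}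

theorem weight_eq : Q.weight f μ = ind Q.IsTreeWalk * ((∏ i, factMean μ (Q.tree.degree i)) /
    degMoment μ 1 ^ m * ∏ i, markFactor f (Q.isEnd i)) := by
  unfold weight
  split_ifs with h
  · rw [ind_of h, Finset.prod_mul_distrib]; simp only [factMean]; ring
  · rw [ind_of_not h, zero_mul]

theorem isTreeWalk_of_weight_ne_zero {Q : Pattern ℓ m} (h : Q.weight f μ ≠ 0) : Q.IsTreeWalk := by
  by_contra hQ
  exact h (by rw [weight_eq, ind_of_not hQ, zero_mul])

theorem prod_markFactor_eq (Q : Pattern ℓ m) (f : ℝ) : ∏ i, markFactor f (Q.isEnd i) =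
    f ^ ({Q.path 0, Q.path (Fin.last _)} : Finset (Fin (m + 1))).card := by
  classical
  simp only [markFactor]
  rw [← Finset.prod_filter, Finset.prod_const]
  congr 2
  ext i
  simp [isEnd]

theorem sq_le_prod_markFactor (Q : Pattern ℓ m) (hf : 0 < f) (hf1 : f ≤ 1) :
    f ^ 2 ≤ ∏ i, markFactor f (Q.isEnd i) := by
  rw [prod_markFactor_eq]
  exact pow_le_pow_of_le_one hf.le hf1 Finset.card_le_two

theorem prod_markFactor_straight (f : ℝ) :
    ∏ i, markFactor f ((straight (ℓ + 1)).isEnd i) = f ^ 2 := by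
  rw [prod_markFactor_eq, path_straight, path_straight, Finset.card_pair (Fin.last_pos.ne)]

theorem prod_markFactor_le_one (Q : Pattern ℓ m) (hf : 0 < f) (hf1 : f ≤ 1) :
    ∏ i, markFactor f (Q.isEnd i) ≤ 1 :=
  Finset.prod_le_one (fun _ _ => markFactor_nonneg hf _) fun _ _ => markFactor_le_one hf1 _

theorem prod_factMean_straight (ℓ : ℕ) (μ : PMF ℕ) :
    ∏ i, factMean μ ((straight (ℓ + 1)).tree.degree i) =
      degMoment μ 1 ^ 2 * factMean μ 2 ^ ℓ := by
  simp only [degree_straight]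
  rw [Fin.prod_univ_succ, Fin.prod_univ_castSucc]
  have h1 : ∀ i : Fin ℓ, i.castSucc.succ ≠ Fin.last (ℓ + 1) := fun i => by
    rw [Fin.succ_castSucc]; exact (Fin.castSucc_lt_last _).ne
  simp only [Fin.succ_ne_zero, h1, Fin.succ_last, Fin.last_pos.ne, if_true, if_false,
    Finset.prod_const, Finset.card_univ, Fintype.card_fin, factMean_one, zero_add, add_zero]
  norm_num
  rw [factMean_one]
  ring

theorem weight_nonneg (hf : 0 < f) (hd : 0 < degMoment μ 1) : 0 ≤ Q.weight f μ := by
  rw [weight_eq]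
  refine mul_nonneg (ind_nonneg _) (mul_nonneg (div_nonneg (Finset.prod_nonneg fun i _ =>
    factMean_nonneg _ _) (by positivity)) (Finset.prod_nonneg fun i _ => markFactor_nonneg hf _))

theorem weight_straight (ℓ : ℕ) : (straight (ℓ + 1)).weight f μ =
    f ^ 2 * (degMoment μ 1 ^ 2 * factMean μ 2 ^ ℓ / degMoment μ 1 ^ (ℓ + 1)) := by
  rw [weight_eq, ind_of (isTreeWalk_straight _), prod_factMean_straight, prod_markFactor_straight]
  ring

/-- The walk that turns back in the last step only. -/
def turnBack (ℓ : ℕ) : Pattern (ℓ + 2) (ℓ + 1) :=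
  (straight (ℓ + 1)).old (Fin.last ℓ).castSucc

theorem isTreeWalk_turnBack (ℓ : ℕ) : (turnBack ℓ).IsTreeWalk := by
  refine isTreeWalk_old.2 ⟨isTreeWalk_straight _, ?_⟩
  have := isTreeWalk_straight (ℓ + 1) (Fin.last ℓ)
  simp only [path_straight] at this ⊢
  rwa [Sym2.eq_swap]

/-- Its tree is the straight path with one node fewer, so the ratio of the straight weight to this
one is controlled by `factMean μ 2 / d`. It is an inequality since the endpoints coincide when `ℓ =
0`, giving one factor `f` instead of two. -/
theorem le_weight_turnBack (ℓ : ℕ) (hf : 0 < f) (hf1 : f ≤ 1) (hd : 0 < degMoment μ 1) :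
    f ^ 2 * (degMoment μ 1 ^ 2 * factMean μ 2 ^ ℓ / degMoment μ 1 ^ (ℓ + 1)) ≤
      (turnBack ℓ).weight f μ := by
  rw [weight_eq, ind_of (isTreeWalk_turnBack ℓ), one_mul]
  have := prod_factMean_straight ℓ μ
  rw [turnBack, tree, this, mul_comm]
  have h2 := factMean_nonneg μ 2
  refine mul_le_mul_of_nonneg_left ?_ (by positivity)
  exact sq_le_prod_markFactor (turnBack ℓ) hf hf1

/-- The walk that goes back and forth between two nodes. -/
def alternating : (ℓ : ℕ) → Pattern (ℓ + 1) 1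
  | 0 => new start
  | ℓ + 1 => (alternating ℓ).old (if (alternating ℓ).path (Fin.last _) = 0 then 1 else 0)

theorem tree_alternating : (ℓ : ℕ) → (alternating ℓ).tree = Tree.single.attach 0
  | 0 => rfl
  | ℓ + 1 => tree_alternating ℓ

theorem isTreeWalk_alternating : (ℓ : ℕ) → (alternating ℓ).IsTreeWalk
  | 0 => isTreeWalk_new.2 fun t => t.elim0
  | ℓ + 1 => by
    refine isTreeWalk_old.2 ⟨isTreeWalk_alternating ℓ, ?_⟩
    rw [tree_alternating]
    have : s(0, 1) ∈ (Tree.single.attach 0).pairs := Tree.mem_pairs_attach.2 (Or.inl rfl)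
    split_ifs with h
    · rwa [h]
    · have h1 : (alternating ℓ).path (Fin.last _) = 1 := Fin.eq_one_of_ne_zero _ h
      rwa [h1, Sym2.eq_swap]

theorem exists_endDist_alternating (ℓ : ℕ) :
    ∃ a, (alternating ℓ).endDist + 2 * a = ℓ + 1 ∧ (alternating ℓ).endDist ≤ 1 := by
  obtain ⟨a, ha⟩ := (isTreeWalk_alternating ℓ).exists_dist
  exact ⟨a, ha, Tree.dist_le _ _ _⟩

theorem sum_degree (Q : Pattern ℓ m) : ∑ i, Q.tree.degree i = 2 * m := by
  simp only [← Tree.pairDegree_pairs]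
  rw [sum_pairDegree _ Q.tree.not_isDiag, Q.tree.card_pairs]

/-- The tree is a single edge, so only the mean degree enters. -/
theorem weight_alternating_pos (ℓ : ℕ) (hf : 0 < f) (hf1 : f ≤ 1) (hd : 0 < degMoment μ 1) :
    0 < (alternating ℓ).weight f μ := by
  rw [weight_eq, ind_of (isTreeWalk_alternating ℓ), one_mul]
  refine mul_pos (div_pos (Finset.prod_pos fun i _ => ?_) (by positivity))
    ((by positivity : 0 < f ^ 2).trans_le (sq_le_prod_markFactor _ hf hf1))
  have h1 : (alternating ℓ).tree.degree i ≤ 1 := by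
    rw [← Tree.pairDegree_pairs]
    exact (pairDegree_le_card _ _).trans (Tree.card_pairs _).le
  interval_cases (alternating ℓ).tree.degree i
  · rw [factMean_zero]; exact one_pos
  · rwa [factMean_one]

/-- The tree degrees add up to `2 m`, so the product is of order `d ^ (2 m)` before division by `d ^
m`: the weight drops by a factor `d` for each repeated node. -/
theorem weight_le {C : ℝ} (hC : 1 ≤ C) (hf : 0 < f) (hf1 : f ≤ 1) (hd : 0 < degMoment μ 1)
    (h : ∀ i, factMean μ (Q.tree.degree i) ≤ C * degMoment μ 1 ^ Q.tree.degree i) :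
    Q.weight f μ ≤ C ^ (m + 1) * degMoment μ 1 ^ m := by
  have h1 : (∏ i, factMean μ (Q.tree.degree i)) / degMoment μ 1 ^ m ≤
      C ^ (m + 1) * degMoment μ 1 ^ m := by
    rw [div_le_iff₀ (by positivity)]
    refine (Finset.prod_le_prod (fun i _ => factMean_nonneg _ _) fun i _ => h i).trans
      (le_of_eq ?_)
    rw [Finset.prod_mul_distrib, Finset.prod_const, Finset.card_fin, Finset.prod_pow_eq_pow_sum,
      sum_degree]
    ring
  rw [weight_eq]
  have h2 : 0 ≤ C ^ (m + 1) * degMoment μ 1 ^ m := by positivity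
  have h3 : 0 ≤ (∏ i, factMean μ (Q.tree.degree i)) / degMoment μ 1 ^ m :=
    div_nonneg (Finset.prod_nonneg fun i _ => factMean_nonneg _ _) (by positivity)
  have h4 : 0 ≤ ∏ i, markFactor f (Q.isEnd i) :=
    Finset.prod_nonneg fun i _ => markFactor_nonneg hf _
  calc _ ≤ (∏ i, factMean μ (Q.tree.degree i)) / degMoment μ 1 ^ m *
        ∏ i, markFactor f (Q.isEnd i) := mul_le_of_le_one_left (mul_nonneg h3 h4) (ind_le_one _)
    _ ≤ (∏ i, factMean μ (Q.tree.degree i)) / degMoment μ 1 ^ m :=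
        mul_le_of_le_one_right h3 (Q.prod_markFactor_le_one hf hf1)
    _ ≤ _ := h1

end Pattern

/-! ### Moment inequalities for the degree law -/

namespace Planted.IsRegular

variable {P : Planted k} {H : Matrix (Fin k) (Fin k) ℝ} {f : ℝ} {μ : PMF ℕ} {p : ℕ}

theorem degMean_add (h : P.IsRegular H f μ p) {ψ φ : ℕ → ℝ} {A B : ℝ}
    (hψ : ∀ j, 1 ≤ j → |ψ j| ≤ A * (j : ℝ) ^ p) (hφ : ∀ j, 1 ≤ j → |φ j| ≤ B * (j : ℝ) ^ p) :
    degMean μ (fun j => ψ j + φ j) = degMean μ ψ + degMean μ φ := by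
  simp only [degMean, add_mul]
  exact (h.summable_of_le hψ).tsum_add (h.summable_of_le hφ)

theorem degMean_mono (h : P.IsRegular H f μ p) {ψ φ : ℕ → ℝ} {A B : ℝ}
    (hψ : ∀ j, 1 ≤ j → |ψ j| ≤ A * (j : ℝ) ^ p) (hφ : ∀ j, 1 ≤ j → |φ j| ≤ B * (j : ℝ) ^ p)
    (hle : ∀ j, ψ j ≤ φ j) : degMean μ ψ ≤ degMean μ φ :=
  (h.summable_of_le hψ).tsum_le_tsum
    (fun j => mul_le_mul_of_nonneg_right (hle j) ENNReal.toReal_nonneg) (h.summable_of_le hφ)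

theorem abs_pow_le {δ j : ℕ} (hδ : δ ≤ p) (hj : 1 ≤ j) : |(j : ℝ) ^ δ| ≤ 1 * (j : ℝ) ^ p := by
  rw [one_mul, abs_of_nonneg (by positivity)]
  exact pow_le_pow_right₀ (by exact_mod_cast hj) hδ

theorem abs_descFactorial_le {δ j : ℕ} (hδ : δ ≤ p) (hj : 1 ≤ j) :
    |(j.descFactorial δ : ℝ)| ≤ 1 * (j : ℝ) ^ p := by
  refine le_trans ?_ (abs_pow_le hδ hj)
  rw [abs_of_nonneg (Nat.cast_nonneg _), abs_of_nonneg (by positivity)]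
  exact_mod_cast Nat.descFactorial_le_pow _ _

theorem factMean_two_pos (h : P.IsRegular H f μ p) (hp : 2 ≤ p) : 0 < factMean μ 2 := by
  obtain ⟨j, hj, hj'⟩ := h.degree_two
  have hs := h.summable_of_le (ψ := fun j => j.descFactorial 2) (C := 1)
    fun j hj => abs_descFactorial_le hp hj
  refine hs.tsum_pos (fun i => mul_nonneg (Nat.cast_nonneg _) ENNReal.toReal_nonneg) j ?_
  have h1 : 0 < (μ j).toReal := ENNReal.toReal_pos hj' (μ.apply_ne_top j)
  have h2 : (0 : ℝ) < (j.descFactorial 2 : ℕ) := by exact_mod_cast Nat.descFactorial_pos.2 hj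
  positivity

/-- Lower moments inherit the bound from `(j / d) ^ δ ≤ 1 + (j / d) ^ p`. -/
theorem degMoment_le (h : P.IsRegular H f μ p) (hp : 1 ≤ p) {K : ℝ}
    (hK : degMoment μ p ≤ K * degMoment μ 1 ^ p) {δ : ℕ} (hδ : δ ≤ p) :
    degMoment μ δ ≤ (1 + K) * degMoment μ 1 ^ δ := by
  have hd := h.degMoment_one_pos hp
  set d := degMoment μ 1
  have h0 : ∀ j : ℕ, 1 ≤ j → |d ^ δ| ≤ d ^ δ * (j : ℝ) ^ p := by
    intro j hj
    rw [abs_of_nonneg (by positivity)]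
    exact le_mul_of_one_le_right (by positivity) (one_le_pow₀ (by exact_mod_cast hj))
  have h1 : ∀ j : ℕ, 1 ≤ j → |d ^ δ / d ^ p * (j : ℝ) ^ p| ≤ d ^ δ / d ^ p * (j : ℝ) ^ p :=
    fun j _ => (abs_of_nonneg (by positivity)).le
  have key := h.degMean_mono (ψ := fun j => (j : ℝ) ^ δ)
    (φ := fun j => d ^ δ + d ^ δ / d ^ p * (j : ℝ) ^ p) (A := 1)
    (B := d ^ δ + d ^ δ / d ^ p) (fun j hj => abs_pow_le hδ hj)
    (fun j hj => (abs_add_le _ _).trans (by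
      rw [add_mul]; exact add_le_add (h0 j hj) (h1 j hj))) (fun j => by
      have hx : (0 : ℝ) ≤ j / d := by positivity
      have : ((j : ℝ) / d) ^ δ ≤ 1 + ((j : ℝ) / d) ^ p := by
        rcases le_total ((j : ℝ) / d) 1 with h | h
        · have := pow_le_one₀ (n := δ) hx h
          have : 0 ≤ ((j : ℝ) / d) ^ p := by positivity
          linarith
        · have := pow_le_pow_right₀ h hδ
          linarith
      calc (j : ℝ) ^ δ = d ^ δ * (j / d) ^ δ := by rw [← mul_pow, mul_div_cancel₀ _ hd.ne']
        _ ≤ d ^ δ * (1 + (j / d) ^ p) := by gcongr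
        _ = _ := by rw [div_pow]; ring)
  rw [h.degMean_add h0 h1, degMean_const, degMean_const_mul, ← degMoment_eq_degMean,
    ← degMoment_eq_degMean] at key
  calc _ ≤ _ := key
    _ ≤ d ^ δ + d ^ δ / d ^ p * (K * d ^ p) := by gcongr
    _ = _ := by field_simp

theorem factMean_le_degMoment (h : P.IsRegular H f μ p) {δ : ℕ} (hδ : δ ≤ p) :
    factMean μ δ ≤ degMoment μ δ :=
  h.degMean_mono (fun _ hj => abs_descFactorial_le hδ hj) (fun _ hj => abs_pow_le hδ hj)
    fun j => by exact_mod_cast Nat.descFactorial_le_pow _ _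

theorem cast_descFactorial_two (j : ℕ) : ((j.descFactorial 2 : ℕ) : ℝ) = (j : ℝ) ^ 2 - j := by
  cases j with
  | zero => simp
  | succ j => simp [Nat.descFactorial]; ring

theorem factMean_two_add (h : P.IsRegular H f μ p) (hp : 2 ≤ p) :
    factMean μ 2 + degMoment μ 1 = degMoment μ 2 := by
  rw [factMean, degMoment_eq_degMean μ 1, ← h.degMean_add (fun _ hj => abs_descFactorial_le hp hj)
    (fun _ hj => abs_pow_le (by omega) hj), degMoment_eq_degMean]
  congr 1
  funext j
  rw [cast_descFactorial_two]; ring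

/-- Jensen's inequality, obtained by integrating the tangent line of `j ^ 2` at `d`. -/
theorem le_factMean_two (h : P.IsRegular H f μ p) (hp : 2 ≤ p) :
    degMoment μ 1 ^ 2 - degMoment μ 1 ≤ factMean μ 2 := by
  have hd := h.degMoment_one_pos (by omega)
  set d := degMoment μ 1 with hd'
  have h0 : ∀ j : ℕ, 1 ≤ j → |-d ^ 2| ≤ d ^ 2 * (j : ℝ) ^ p := by
    intro j hj
    rw [abs_neg, abs_of_nonneg (by positivity)]
    exact le_mul_of_one_le_right (by positivity) (one_le_pow₀ (by exact_mod_cast hj))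
  have h1 : ∀ j : ℕ, 1 ≤ j → |(2 * d - 1) * (j : ℝ) ^ 1| ≤ |2 * d - 1| * (j : ℝ) ^ p := by
    intro j hj
    rw [abs_mul]
    exact mul_le_mul_of_nonneg_left ((abs_pow_le (by omega) hj).trans_eq (one_mul _))
      (abs_nonneg _)
  have key := h.degMean_mono (ψ := fun j => -d ^ 2 + (2 * d - 1) * (j : ℝ) ^ 1)
    (φ := fun j => j.descFactorial 2) (A := d ^ 2 + |2 * d - 1|) (B := 1)
    (fun j hj => (abs_add_le _ _).trans (by
      rw [add_mul]; exact add_le_add (h0 j hj) (h1 j hj)))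
    (fun j hj => abs_descFactorial_le hp hj) fun j => by
      rw [cast_descFactorial_two]
      nlinarith [sq_nonneg ((j : ℝ) - d)]
  rw [h.degMean_add h0 h1, degMean_const, degMean_const_mul, ← degMoment_eq_degMean, ← hd'] at key
  refine le_trans (le_of_eq ?_) key
  ring

end Planted.IsRegular

end CompatEst

/-! ### The limit of the path statistic and the size of its bias -/

namespace CompatEst

variable {k : ℕ}

theorem Pattern.degree_le {ℓ m : ℕ} (Q : Pattern ℓ m) (i : Fin (m + 1)) :
    Q.tree.degree i ≤ ℓ / 2 + 1 := by
  have := Q.two_mul_degree_le i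
  split_ifs at this <;> omega

/-- The mean of the powers of `H` in the limit of the statistic of all paths. -/
noncomputable def limitMatrix (H : Matrix (Fin k) (Fin k) ℝ) (f : ℝ) (μ : PMF ℕ) (ℓ : ℕ) :
    Matrix (Fin k) (Fin k) ℝ :=
  Matrix.of fun c e => (∑ Q : Sigma (Pattern ℓ), Q.2.weight f μ * (H ^ Q.2.endDist) c e) /
    ∑ Q : Sigma (Pattern ℓ), Q.2.weight f μ

/-- The share of the walks without repeated nodes. -/
noncomputable def straightShare (f : ℝ) (μ : PMF ℕ) (ℓ : ℕ) : ℝ :=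
  (Pattern.straight ℓ).weight f μ / ∑ Q : Sigma (Pattern ℓ), Q.2.weight f μ

theorem sum_mul_limitMatrix (H : Matrix (Fin k) (Fin k) ℝ) (hsymm : H.IsSymm) (f : ℝ) (μ : PMF ℕ)
    (ℓ : ℕ) : ∑ c, ∑ e, H c e * limitMatrix H f μ ℓ c e =
      (∑ Q : Sigma (Pattern ℓ), Q.2.weight f μ * (H ^ (Q.2.endDist + 1)).trace) /
        ∑ Q : Sigma (Pattern ℓ), Q.2.weight f μ := by
  simp only [limitMatrix, Matrix.of_apply, mul_div_assoc', ← Finset.sum_div, Finset.mul_sum,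
    ← trace_mul_pow hsymm]
  congr 1
  rw [Finset.sum_congr rfl fun c _ => Finset.sum_comm, Finset.sum_comm]
  exact Finset.sum_congr rfl fun Q _ => Finset.sum_congr rfl fun c _ =>
    Finset.sum_congr rfl fun e _ => by ring

theorem exists_pos_forall_le {ι : Type*} [Finite ι] (r : ι → ℝ) :
    ∃ g : ℝ, 0 < g ∧ ∀ i, 0 < r i → g ≤ r i := by
  have h : ∀ᶠ g in 𝓝[>] (0 : ℝ), ∀ i, 0 < r i → g ≤ r i :=
    eventually_all.2 fun i => by
      by_cases hi : 0 < r i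
      · filter_upwards [Ioo_mem_nhdsGT hi] with g hg _ using hg.2.le
      · exact Eventually.of_forall fun _ h => absurd h hi
  obtain ⟨g, hg, hg0⟩ := (h.and self_mem_nhdsWithin).exists
  exact ⟨g, hg0, hg⟩

namespace Planted.IsRegular

variable {P : Planted k} {H : Matrix (Fin k) (Fin k) ℝ} {f : ℝ} {μ : PMF ℕ} {p : ℕ}

theorem weight_straight_pos (h : P.IsRegular H f μ p) (hp : 2 ≤ p) (hf : 0 < f) (ℓ : ℕ) :
    0 < (Pattern.straight (ℓ + 1)).weight f μ := by
  have hd := h.degMoment_one_pos (by omega)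
  have h2 := h.factMean_two_pos hp
  rw [Pattern.weight_straight]
  positivity

theorem sum_weight_pos (h : P.IsRegular H f μ p) (hp : 2 ≤ p) (hf : 0 < f) (ℓ : ℕ) :
    0 < ∑ Q : Sigma (Pattern (ℓ + 1)), Q.2.weight f μ :=
  Finset.sum_pos' (fun Q _ => Q.2.weight_nonneg hf (h.degMoment_one_pos (by omega)))
    ⟨⟨_, Pattern.straight (ℓ + 1)⟩, Finset.mem_univ _, h.weight_straight_pos hp hf ℓ⟩

/-- The statistic of non-backtracking paths is consistent. -/
theorem convergesInProb_nbStatistic (h : P.IsRegular H f μ 2)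
    (hH : H ∈ doublyStochastic ℝ (Fin k)) (hsymm : H.IsSymm) (hf : 0 < f) (ℓ : ℕ) :
    P.ConvergesInProb (fun n => nbStatistic (P.label n) (ℓ + 1)) (H ^ (ℓ + 1)) := by
  set χ : Sigma (Pattern (ℓ + 1)) → Prop := fun Q => Q.2.IsReduced with hχ
  have hstraight : χ ⟨_, Pattern.straight (ℓ + 1)⟩ := by
    intro s t hst
    simp only [Pattern.path_straight]
    rintro rfl
    omega
  -- Non-straight reduced patterns are not tree walks, so their weight vanishes.
  have hzero : ∀ Q, Q ≠ ⟨_, Pattern.straight (ℓ + 1)⟩ → ind (χ Q) * Q.2.weight f μ = 0 := by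
    intro Q hne
    by_contra h0
    have h1 : χ Q := by
      by_contra h1
      exact h0 (by rw [ind_of_not h1, zero_mul])
    exact hne ((Pattern.isTreeWalk_of_weight_ne_zero
      (right_ne_zero_of_mul h0)).eq_straight_of_nonbacktracking h1)
  have hw := h.weight_straight_pos le_rfl hf ℓ
  have hsum : ∑ Q : Sigma (Pattern (ℓ + 1)), ind (χ Q) * Q.2.weight f μ =
      (Pattern.straight (ℓ + 1)).weight f μ := by
    rw [Fintype.sum_eq_single _ hzero, ind_of hstraight, one_mul]
  have main := h.convergesInProb_of_patterns le_rfl hsymm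
    (fun c => sum_row_of_mem_doublyStochastic hH c) (χ := χ) (A := fun n G => nbMatrix G (ℓ + 1))
    (fun Q hQ => Pattern.IsReduced.isAdmissible hQ) (fun n G S c e => ?_) (hsum ▸ hw)
  · suffices hlim : (Matrix.of fun c e => (∑ Q : Sigma (Pattern (ℓ + 1)), ind (χ Q) * Q.2.weight f μ *
        (H ^ Q.2.endDist) c e) / ∑ Q : Sigma (Pattern (ℓ + 1)), ind (χ Q) * Q.2.weight f μ) =
        H ^ (ℓ + 1) by rw [hlim] at main; exact main
    ext c e
    rw [Matrix.of_apply, hsum, Fintype.sum_eq_single (⟨_, Pattern.straight (ℓ + 1)⟩ :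
      Sigma (Pattern (ℓ + 1))) fun Q hQ => by rw [hzero Q hQ, zero_mul], ind_of hstraight, one_mul,
      mul_div_cancel_left₀ _ hw.ne', Pattern.endDist, Pattern.dist_straight]
  · refine classCounts_eq_sum_patternCount (ω := (G, S))
      (W := fun u => IsNonBacktracking G (ℓ + 1) u)
      (fun i j => by rw [nbMatrix, Matrix.of_apply, ← sum_ind_eq_ncard]) (fun Q x hx => ?_) c e
    rw [and_comm]
    refine and_congr Iff.rfl (forall₃_congr fun s t _ => ?_)
    exact hx.ne_iff

/-- The limit of the statistic of all paths. -/
theorem convergesInProb_pathStatistic {ℓ : ℕ} (h : P.IsRegular H f μ ((ℓ + 1) / 2 + 1))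
    (hℓ : 1 ≤ ℓ) (hH : H ∈ doublyStochastic ℝ (Fin k)) (hsymm : H.IsSymm) (hf : 0 < f) :
    P.ConvergesInProb (fun n => pathStatistic (P.label n) (ℓ + 1)) (limitMatrix H f μ (ℓ + 1)) := by
  have hp : 2 ≤ (ℓ + 1) / 2 + 1 := by omega
  have main := h.convergesInProb_of_patterns hp hsymm
    (fun c => sum_row_of_mem_doublyStochastic hH c) (χ := fun _ => True)
    (A := fun n G => adjacency G ^ (ℓ + 1)) (fun Q _ => Q.2.isAdmissible) (fun n G S c e => ?_) ?_
  · simp only [ind_of trivial, one_mul] at main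
    convert main using 1
    · funext n G S
      unfold pathStatistic
      congr!
    · rfl
  · refine classCounts_eq_sum_patternCount (ω := (G, S))
      (W := fun u => ∀ t : Fin (ℓ + 1), G.Adj (u t.castSucc) (u t.succ))
      (fun i j => adjacency_pow_apply G (ℓ + 1) i j) (fun Q x hx => ?_) c e
    rw [true_and]
  · simp only [ind_of trivial, one_mul]
    exact h.sum_weight_pos hp hf ℓ

/-- Already the walk turning back in its last step has a weight at least `d / factMean μ 2` times
the straight one. As `factMean μ 2 + d` is the second moment, the remaining share is at least `d /
m₂`, and `m₂ ≤ (1 + K) d²`. -/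
theorem le_one_sub_straightShare {ℓ : ℕ} (h : P.IsRegular H f μ p) (hp : 2 ≤ p) (hf : 0 < f)
    (hf1 : f ≤ 1) {K : ℝ} (hK0 : 0 ≤ K) (hK : degMoment μ p ≤ K * degMoment μ 1 ^ p) :
    1 / (1 + K) / degMoment μ 1 ≤ 1 - straightShare f μ (ℓ + 2) := by
  have hd := h.degMoment_one_pos (by omega)
  have h2 := h.factMean_two_pos hp
  have hadd := h.factMean_two_add hp
  have hm2 := h.degMoment_le (by omega) hK hp
  set d := degMoment μ 1 with hd'
  set S := ∑ Q : Sigma (Pattern (ℓ + 2)), Q.2.weight f μ with hS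
  set w₀ := (Pattern.straight (ℓ + 2)).weight f μ with hw₀
  set r := f ^ 2 * (d ^ 2 * factMean μ 2 ^ ℓ / d ^ (ℓ + 1)) with hr
  have hr0 : 0 < r := by positivity
  have hw : w₀ = factMean μ 2 / d * r := by
    rw [hw₀, Pattern.weight_straight, hr, ← hd']
    field_simp
    ring
  have hne : (⟨_, Pattern.straight (ℓ + 2)⟩ : Sigma (Pattern (ℓ + 2))) ≠
      ⟨_, Pattern.turnBack ℓ⟩ := fun e => by
    have := congrArg Sigma.fst e
    simp at this
  have hSle : w₀ + r ≤ S := by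
    classical
    have h1 := Finset.sum_le_sum_of_subset_of_nonneg (f := fun Q : Sigma (Pattern (ℓ + 2)) =>
      Q.2.weight f μ) (Finset.subset_univ {⟨_, Pattern.straight (ℓ + 2)⟩,
      ⟨_, Pattern.turnBack ℓ⟩}) fun Q _ _ => Q.2.weight_nonneg hf hd
    rw [Finset.sum_pair hne] at h1
    exact (add_le_add_right (Pattern.le_weight_turnBack ℓ hf hf1 hd) _).trans h1
  have hw0 : 0 < w₀ := by rw [hw]; positivity
  have hS0 : 0 < S := by linarith
  have e1 : straightShare f μ (ℓ + 2) ≤ w₀ / (w₀ + r) :=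
    div_le_div_of_nonneg_left hw0.le (by positivity) hSle
  have e2 : 1 - w₀ / (w₀ + r) = d / degMoment μ 2 := by
    rw [← hadd, hw]
    field_simp
    ring
  have hm2pos : 0 < degMoment μ 2 := by linarith
  calc 1 / (1 + K) / d = d / ((1 + K) * d ^ 2) := by field_simp
    _ ≤ d / degMoment μ 2 := div_le_div_of_nonneg_left hd.le hm2pos hm2
    _ ≤ _ := by rw [← e2]; linarith

/-- The straight weight is of order `d ^ (ℓ + 2)` once `factMean μ 2 ≥ d ^ 2 / 2`, while every other
pattern has at most `ℓ + 2` nodes and weight of order at most `d ^ (ℓ + 1)`. -/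
theorem one_sub_straightShare_le {ℓ : ℕ} (h : P.IsRegular H f μ ((ℓ + 2) / 2 + 1)) (hf : 0 < f)
    (hf1 : f ≤ 1) {K : ℝ} (hK0 : 0 ≤ K)
    (hK : degMoment μ ((ℓ + 2) / 2 + 1) ≤ K * degMoment μ 1 ^ ((ℓ + 2) / 2 + 1)) :
    1 - straightShare f μ (ℓ + 2) ≤ (2 + Fintype.card (Sigma (Pattern (ℓ + 2))) *
      (1 + K) ^ (ℓ + 2) * 2 ^ (ℓ + 1) / f ^ 2) / degMoment μ 1 := by
  classical
  have hp : 2 ≤ (ℓ + 2) / 2 + 1 := by omega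
  have hd := h.degMoment_one_pos (by omega)
  have h2 := h.le_factMean_two hp
  have hS0 := h.sum_weight_pos hp hf (ℓ + 1)
  have hw0 := h.weight_straight_pos hp hf (ℓ + 1)
  have hwn : ∀ Q : Sigma (Pattern (ℓ + 2)), 0 ≤ Q.2.weight f μ :=
    fun Q => Q.2.weight_nonneg hf hd
  have hwC : ∀ Q : Sigma (Pattern (ℓ + 2)), Q.2.weight f μ ≤
      (1 + K) ^ (Q.1 + 1) * degMoment μ 1 ^ Q.1 := fun Q =>
    Q.2.weight_le (by linarith) hf hf1 hd fun i =>
      (h.factMean_le_degMoment (Q.2.degree_le i)).trans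
        (h.degMoment_le (by omega) hK (Q.2.degree_le i))
  have hwst := Pattern.weight_straight (f := f) (μ := μ) (ℓ + 1)
  unfold straightShare
  set d := degMoment μ 1 with hd'
  set S := ∑ Q : Sigma (Pattern (ℓ + 2)), Q.2.weight f μ with hS
  set w₀ := (Pattern.straight (ℓ + 2)).weight f μ with hw₀
  set N : ℝ := ((Fintype.card (Sigma (Pattern (ℓ + 2))) : ℕ) : ℝ) with hN
  have hN0 : 0 ≤ N := Nat.cast_nonneg _
  -- For `d < 2` the share is trivially at most `2 / d`, the source of the summand `2`. For `d ≥ 2`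
  -- one has `d ^ 2 - d ≥ d ^ 2 / 2`, and powers of `d` increase with the exponent.
  rcases lt_or_ge d 2 with hd2 | hd2
  · have h1 : 0 ≤ w₀ / S := by positivity
    calc 1 - w₀ / S ≤ 2 / d := by rw [le_div_iff₀ hd]; nlinarith
      _ ≤ _ := by
        refine div_le_div_of_nonneg_right ?_ hd.le
        have : 0 ≤ N * (1 + K) ^ (ℓ + 2) * 2 ^ (ℓ + 1) / f ^ 2 := by positivity
        linarith
  · have hother : S - w₀ ≤ N * ((1 + K) ^ (ℓ + 2) * d ^ (ℓ + 1)) := by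
      rw [hS, ← Finset.add_sum_erase _ _ (Finset.mem_univ (⟨_, Pattern.straight (ℓ + 2)⟩ :
        Sigma (Pattern (ℓ + 2)))), add_sub_cancel_left, hN, ← Finset.card_univ, ← nsmul_eq_mul,
        ← Finset.sum_const]
      refine (Finset.sum_le_sum fun Q hQ => ?_).trans (Finset.sum_le_sum_of_subset_of_nonneg
        (Finset.erase_subset _ _) fun _ _ _ => by positivity)
      have h1 : Q.1 ≠ ℓ + 2 := fun e => Finset.ne_of_mem_erase hQ (Q.2.eq_straight e)
      have h2 := Q.2.le
      refine (hwC Q).trans (mul_le_mul (pow_le_pow_right₀ (by linarith) (by omega))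
        (pow_le_pow_right₀ (by linarith) (by omega)) (by positivity) (by positivity))
    have hw : f ^ 2 * d ^ (ℓ + 2) / 2 ^ (ℓ + 1) ≤ w₀ := by
      have h3 : d ^ 2 / 2 ≤ factMean μ 2 := by nlinarith
      calc _ = f ^ 2 * (d ^ 2 * (d ^ 2 / 2) ^ (ℓ + 1) / d ^ (ℓ + 1 + 1)) := by
            rw [div_pow]; field_simp; ring
        _ ≤ f ^ 2 * (d ^ 2 * factMean μ 2 ^ (ℓ + 1) / d ^ (ℓ + 1 + 1)) := by gcongr
        _ = w₀ := hwst.symm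
    have hwS : w₀ ≤ S := Finset.single_le_sum (f := fun Q : Sigma (Pattern (ℓ + 2)) =>
      Q.2.weight f μ) (fun Q _ => hwn Q) (Finset.mem_univ (⟨_, Pattern.straight (ℓ + 2)⟩ :
      Sigma (Pattern (ℓ + 2))))
    calc 1 - w₀ / S = (S - w₀) / S := by rw [sub_div, div_self hS0.ne']
      _ ≤ (S - w₀) / w₀ := div_le_div_of_nonneg_left (by linarith) hw0 hwS
      _ ≤ (N * ((1 + K) ^ (ℓ + 2) * d ^ (ℓ + 1))) / (f ^ 2 * d ^ (ℓ + 2) / 2 ^ (ℓ + 1)) := by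
          gcongr
      _ = (N * (1 + K) ^ (ℓ + 2) * 2 ^ (ℓ + 1) / f ^ 2) / d := by field_simp; ring
      _ ≤ _ := by
          refine div_le_div_of_nonneg_right ?_ hd.le
          linarith

theorem abs_limitMatrix_sub_le {ℓ : ℕ} (h : P.IsRegular H f μ p) (hp : 2 ≤ p)
    (hH : H ∈ doublyStochastic ℝ (Fin k)) (hf : 0 < f) (c e : Fin k) :
    |limitMatrix H f μ (ℓ + 1) c e - (H ^ (ℓ + 1)) c e| ≤ 1 - straightShare f μ (ℓ + 1) := by
  refine abs_mixture_sub_le (w := fun Q : Sigma (Pattern (ℓ + 1)) => Q.2.weight f μ)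
    (x := fun Q => (H ^ Q.2.endDist) c e) (i₀ := ⟨_, Pattern.straight (ℓ + 1)⟩)
    (fun Q => Q.2.weight_nonneg hf (h.degMoment_one_pos (by omega))) (h.sum_weight_pos hp hf ℓ)
    (by simp only [Pattern.endDist, Pattern.dist_straight]) fun Q => ?_
  rw [abs_le]
  constructor <;> linarith [pow_apply_nonneg hH Q.2.endDist c e, pow_apply_le_one hH Q.2.endDist c e,
    pow_apply_nonneg hH (ℓ + 1) c e, pow_apply_le_one hH (ℓ + 1) c e]

/-- All other tree walks end at an even distance at most `2 s`, where by monotonicity the diagonal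
entry is at least that of `H ^ (2 * s)`. -/
theorem le_limitMatrix_diag_sub {s : ℕ} (h : P.IsRegular H f μ p) (hp : 2 ≤ p)
    (hH : H ∈ doublyStochastic ℝ (Fin k)) (hsymm : H.IsSymm) (hf : 0 < f) (c : Fin k) :
    (1 - straightShare f μ (2 * s + 2)) * ((H ^ (2 * s)) c c - (H ^ (2 * s + 2)) c c) ≤
      limitMatrix H f μ (2 * s + 2) c c - (H ^ (2 * s + 2)) c c := by
  refine le_mixture_sub (w := fun Q : Sigma (Pattern (2 * s + 2)) => Q.2.weight f μ)
    (x := fun Q => (H ^ Q.2.endDist) c c) (i₀ := ⟨_, Pattern.straight (2 * s + 2)⟩)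
    (fun Q => Q.2.weight_nonneg hf (h.degMoment_one_pos (by omega)))
    (h.sum_weight_pos hp hf (2 * s + 1))
    (by simp only [Pattern.endDist, Pattern.dist_straight]) fun Q hQ hw => ?_
  obtain ⟨a, ha⟩ := (Pattern.isTreeWalk_of_weight_ne_zero hw).exists_dist_of_ne hQ
  have : Q.2.endDist = 2 * (s - a) := by rw [Pattern.endDist]; omega
  rw [this]
  exact sub_le_sub_right (pow_diag_antitone hH hsymm c (Nat.sub_le s a)) _

theorem le_sum_mul_limitMatrix_sub {s : ℕ} (h : P.IsRegular H f μ p) (hp : 2 ≤ p)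
    (hH : H ∈ doublyStochastic ℝ (Fin k)) (hsymm : H.IsSymm) (hf : 0 < f) :
    (1 - straightShare f μ (2 * s + 3)) *
        ((H ^ (2 * (s + 1))).trace - (H ^ (2 * (s + 2))).trace) ≤
      ∑ c, ∑ e, H c e * limitMatrix H f μ (2 * s + 3) c e - (H ^ (2 * (s + 2))).trace := by
  rw [sum_mul_limitMatrix H hsymm]
  refine le_mixture_sub (w := fun Q : Sigma (Pattern (2 * s + 3)) => Q.2.weight f μ)
    (x := fun Q => (H ^ (Q.2.endDist + 1)).trace) (i₀ := ⟨_, Pattern.straight (2 * s + 3)⟩)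
    (fun Q => Q.2.weight_nonneg hf (h.degMoment_one_pos (by omega)))
    (h.sum_weight_pos hp hf (2 * s + 2))
    (by simp only [Pattern.endDist, Pattern.dist_straight]; rfl) fun Q hQ hw => ?_
  obtain ⟨a, ha⟩ := (Pattern.isTreeWalk_of_weight_ne_zero hw).exists_dist_of_ne hQ
  have : Q.2.endDist + 1 = 2 * (s + 1 - a) := by rw [Pattern.endDist]; omega
  rw [this]
  exact sub_le_sub_right (trace_antitone hH hsymm (Nat.sub_le (s + 1) a)) _

/-- For even lengths, the walks between two nodes bias the limit unless `H ^ 2 = 1`. -/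
theorem limitMatrix_ne_of_even {s : ℕ} (h : P.IsRegular H f μ p) (hp : 2 ≤ p)
    (hH : H ∈ doublyStochastic ℝ (Fin k)) (hsymm : H.IsSymm) (hf : 0 < f) (hf1 : f ≤ 1)
    (hne : H ^ 2 ≠ 1) : limitMatrix H f μ (2 * s + 2) ≠ H ^ (2 * s + 2) := by
  intro heq
  have hd := h.degMoment_one_pos (by omega)
  obtain ⟨c, hc⟩ := exists_diag_lt hH hsymm (s := 0) (by simpa using hne)
  have hS := h.sum_weight_pos hp hf (2 * s + 1)
  have hA := Pattern.weight_alternating_pos (μ := μ) (2 * s + 1) hf hf1 hd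
  have key := single_le_mixture_sub (w := fun Q : Sigma (Pattern (2 * s + 2)) => Q.2.weight f μ)
    (x := fun Q => (H ^ Q.2.endDist) c c) (y := (H ^ (2 * s + 2)) c c)
    (fun Q => Q.2.weight_nonneg hf hd) hS (fun Q hQ => by
      obtain ⟨a, ha⟩ := (Pattern.isTreeWalk_of_weight_ne_zero hQ).exists_dist
      have : Q.2.endDist = 2 * (s + 1 - a) := by rw [Pattern.endDist]; omega
      rw [this]
      exact pow_diag_antitone hH hsymm c (Nat.sub_le (s + 1) a))
    ⟨_, Pattern.alternating (2 * s + 1)⟩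
  have h1 : limitMatrix H f μ (2 * s + 2) c c - (H ^ (2 * s + 2)) c c = 0 := by rw [heq, sub_self]
  rw [limitMatrix, Matrix.of_apply] at h1
  rw [h1] at key
  obtain ⟨a, ha, ha1⟩ := Pattern.exists_endDist_alternating (2 * s + 1)
  -- Parity and distance at most one force a closed walk, so the identity matrix enters the mean
  -- with positive weight.
  have hD : (Pattern.alternating (2 * s + 1)).endDist = 2 * 0 := by omega
  have h2 := pow_diag_antitone hH hsymm c (Nat.succ_le_succ (Nat.zero_le s))
  simp only [hD] at key
  have h3 : 0 < (H ^ (2 * 0)) c c - (H ^ (2 * s + 2)) c c := sub_pos.2 (h2.trans_lt hc)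
  exact absurd key (not_le.2 (mul_pos (div_pos hA hS) h3))

/-- For odd lengths, the walks between two nodes bias the limit unless `H ^ 3 = H`. -/
theorem limitMatrix_ne_of_odd {s : ℕ} (h : P.IsRegular H f μ p) (hp : 2 ≤ p)
    (hH : H ∈ doublyStochastic ℝ (Fin k)) (hsymm : H.IsSymm) (hf : 0 < f) (hf1 : f ≤ 1)
    (hne : H ^ 3 ≠ H) : limitMatrix H f μ (2 * s + 3) ≠ H ^ (2 * s + 3) := by
  intro heq
  have hd := h.degMoment_one_pos (by omega)
  have hlt := trace_lt hH hsymm (s := 1) (by simpa using hne)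
  have hS := h.sum_weight_pos hp hf (2 * s + 2)
  have hA := Pattern.weight_alternating_pos (μ := μ) (2 * s + 2) hf hf1 hd
  have key := single_le_mixture_sub (w := fun Q : Sigma (Pattern (2 * s + 3)) => Q.2.weight f μ)
    (x := fun Q => (H ^ (Q.2.endDist + 1)).trace) (y := (H ^ (2 * (s + 2))).trace)
    (fun Q => Q.2.weight_nonneg hf hd) hS (fun Q hQ => by
      obtain ⟨a, ha⟩ := (Pattern.isTreeWalk_of_weight_ne_zero hQ).exists_dist
      have : Q.2.endDist + 1 = 2 * (s + 2 - a) := by rw [Pattern.endDist]; omega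
      rw [this]
      exact trace_antitone hH hsymm (Nat.sub_le (s + 2) a))
    ⟨_, Pattern.alternating (2 * s + 2)⟩
  rw [← sum_mul_limitMatrix H hsymm, heq, trace_mul_pow hsymm,
    show 2 * s + 3 + 1 = 2 * (s + 2) by ring, sub_self] at key
  obtain ⟨a, ha, ha1⟩ := Pattern.exists_endDist_alternating (2 * s + 2)
  -- Parity makes the endpoints adjacent, so `H` itself enters and contributes the trace of `H ^ 2`.
  have hD : (Pattern.alternating (2 * s + 2)).endDist + 1 = 2 * 1 := by omega
  have h2 := trace_antitone hH hsymm (Nat.le_add_left 2 s)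
  simp only [hD] at key
  have h3 : 0 < (H ^ (2 * 1)).trace - (H ^ (2 * (s + 2))).trace := sub_pos.2 (h2.trans_lt hlt)
  exact absurd key (not_le.2 (mul_pos (div_pos hA hS) h3))

end Planted.IsRegular

end CompatEst

/-! ### The main theorem -/

theorem mainTheorem1 (k : ℕ) (H : Matrix (Fin k) (Fin k) ℝ) (hH : H ∈ doublyStochastic ℝ (Fin k))
    (hsymm : H.IsSymm) (f : ℝ) (hf0 : 0 < f) (hf1 : f ≤ 1) :
    -- the non-backtracking statistic is consistent
    (∀ (P : CompatEst.Planted k) (μ : PMF ℕ), P.IsRegular H f μ 2 → ∀ ℓ : ℕ, 1 ≤ ℓ →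
      P.ConvergesInProb (fun n => CompatEst.nbStatistic (P.label n) ℓ) (H ^ ℓ)) ∧
    -- the statistic of all paths has a limit, with a bias of order one over the mean degree
    (∀ ℓ : ℕ, 2 ≤ ℓ → ∀ K : ℝ, ∃ a b : ℝ, 0 < a ∧ 0 < b ∧
      ∀ (P : CompatEst.Planted k) (μ : PMF ℕ), P.IsRegular H f μ (ℓ / 2 + 1) →
        CompatEst.degMoment μ (ℓ / 2 + 1) ≤ K * CompatEst.degMoment μ 1 ^ (ℓ / 2 + 1) →
        -- it is not consistent
        ((if Even ℓ then H ^ 2 ≠ 1 else H ^ 3 ≠ H) →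
          ¬ P.ConvergesInProb (fun n => CompatEst.pathStatistic (P.label n) ℓ) (H ^ ℓ)) ∧
        ∃ B : Matrix (Fin k) (Fin k) ℝ,
          P.ConvergesInProb (fun n => CompatEst.pathStatistic (P.label n) ℓ) B ∧
          (∀ c e, |B c e - (H ^ ℓ) c e| ≤ b / CompatEst.degMoment μ 1) ∧
          (H ^ (ℓ - 2) ≠ H ^ ℓ →
            ∃ c e, a / CompatEst.degMoment μ 1 ≤ |B c e - (H ^ ℓ) c e|) ∧
          -- for even lengths the diagonal is overestimated
          (Even ℓ → ∀ c, (H ^ ℓ) c c ≤ B c c ∧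
            ((H ^ (ℓ - 2)) c c ≠ (H ^ ℓ) c c →
              a / CompatEst.degMoment μ 1 ≤ B c c - (H ^ ℓ) c c))) := by
  refine ⟨fun P μ h ℓ hℓ => ?_, fun ℓ hℓ K => ?_⟩
  · obtain ⟨ℓ, rfl⟩ := Nat.exists_eq_add_of_le' hℓ
    exact h.convergesInProb_nbStatistic hH hsymm hf0 ℓ
  obtain ⟨l, rfl⟩ := Nat.exists_eq_add_of_le' hℓ
  -- The least positive gap among the finitely many used below: the diagonal gaps for even lengths,
  -- and for odd lengths the trace gap. Dividing the latter by `k + 1` leaves room, since the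
  -- entries of `H` add up to `k`.
  obtain ⟨g, hg0, hg⟩ := CompatEst.exists_pos_forall_le fun o : Option (Fin k) =>
    o.elim (((H ^ (l + 1)).trace - (H ^ (l + 3)).trace) / (k + 1))
      fun c => (H ^ l) c c - (H ^ (l + 2)) c c
  refine ⟨1 / (1 + |K|) * g, 2 + Fintype.card (Sigma (CompatEst.Pattern (l + 2))) *
      (1 + |K|) ^ (l + 2) * 2 ^ (l + 1) / f ^ 2, by positivity, by positivity, ?_⟩
  intro P μ h hK
  have hp : 2 ≤ (l + 2) / 2 + 1 := by omega
  have hd := h.degMoment_one_pos (by omega)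
  have hK' : CompatEst.degMoment μ ((l + 2) / 2 + 1) ≤
      |K| * CompatEst.degMoment μ 1 ^ ((l + 2) / 2 + 1) :=
    hK.trans (mul_le_mul_of_nonneg_right (le_abs_self K) (by positivity))
  have hlim := h.convergesInProb_pathStatistic (by omega) hH hsymm hf0
  have hlow := h.le_one_sub_straightShare (ℓ := l) hp hf0 hf1 (abs_nonneg K) hK'
  have hup := h.one_sub_straightShare_le hf0 hf1 (abs_nonneg K) hK'
  have hshare : 0 ≤ 1 - CompatEst.straightShare f μ (l + 2) := le_trans (by positivity) hlow
  -- The bias is at least the share of non-straight walks, at least `1 / ((1 + |K|) d)`, times a gap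
  -- that is at least `g`.
  have hgap : ∀ {r : ℝ}, g ≤ r → 1 / (1 + |K|) * g / CompatEst.degMoment μ 1 ≤
      (1 - CompatEst.straightShare f μ (l + 2)) * r := by
    intro r hr
    rw [mul_div_right_comm]
    exact mul_le_mul hlow hr hg0.le hshare
  rw [Nat.add_sub_cancel]
  have hdiag : Even (l + 2) → ∀ c, (H ^ (l + 2)) c c ≤ CompatEst.limitMatrix H f μ (l + 2) c c ∧
      ((H ^ l) c c ≠ (H ^ (l + 2)) c c → 1 / (1 + |K|) * g / CompatEst.degMoment μ 1 ≤
        CompatEst.limitMatrix H f μ (l + 2) c c - (H ^ (l + 2)) c c) := by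
    intro hl c
    obtain ⟨s, rfl⟩ : ∃ s, l = 2 * s := by
      obtain ⟨s, hs⟩ := hl
      exact ⟨s - 1, by omega⟩
    have h1 := h.le_limitMatrix_diag_sub hp hH hsymm hf0 (s := s) c
    have h2 : (H ^ (2 * s + 2)) c c ≤ (H ^ (2 * s)) c c :=
      CompatEst.pow_diag_antitone hH hsymm c (Nat.le_succ s)
    refine ⟨sub_nonneg.1 (le_trans (mul_nonneg hshare (sub_nonneg.2 h2)) h1), fun hne => ?_⟩
    exact (hgap (hg (some c) (sub_pos.2 (lt_of_le_of_ne h2 hne.symm)))).trans h1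
  refine ⟨fun hne hconv => ?_, CompatEst.limitMatrix H f μ (l + 2), hlim,
    fun c e => (h.abs_limitMatrix_sub_le hp hH hf0 c e).trans hup, fun hne => ?_, hdiag⟩
  · have heq := hlim.unique h.nonempty hconv
    rcases Nat.even_or_odd' l with ⟨s, rfl | rfl⟩
    · rw [if_pos ⟨s + 1, by ring⟩] at hne
      exact h.limitMatrix_ne_of_even hp hH hsymm hf0 hf1 hne heq
    · rw [if_neg (by rw [Nat.not_even_iff_odd]; exact ⟨s + 1, by ring⟩)] at hne
      exact h.limitMatrix_ne_of_odd hp hH hsymm hf0 hf1 hne heq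
  · rcases Nat.even_or_odd' l with ⟨s, rfl | rfl⟩
    -- If `H ^ (s + 2)` equaled `H ^ s`, then `H ^ ℓ` would equal `H ^ (ℓ - 2)`; so some row of `H ^
    -- s` is not frozen and its diagonal gap is positive.
    · obtain ⟨c, hc⟩ := CompatEst.exists_diag_lt hH hsymm
        (CompatEst.pow_add_two_ne (show s ≤ 2 * s by omega) hne.symm)
      exact ⟨c, c, ((hdiag ⟨s + 1, by ring⟩ c).2 hc.ne').trans (le_abs_self _)⟩
    -- If every entry were biased by less than `x`, the mean bias weighted with `H` would be at most
    -- `k * x`, whereas the trace gap forces at least `(k + 1) * x`.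
    · by_contra! hcon
      have hlt := CompatEst.trace_lt hH hsymm
        (CompatEst.pow_add_two_ne (show s + 1 ≤ 2 * s + 1 by omega) hne.symm)
      have h1 := h.le_sum_mul_limitMatrix_sub hp hH hsymm hf0 (s := s)
      have hpos : 0 < (H ^ (2 * (s + 1))).trace - (H ^ (2 * (s + 2))).trace := sub_pos.2 hlt
      have h2 := hg none (div_pos hpos (by positivity))
      set x := 1 / (1 + |K|) * g / CompatEst.degMoment μ 1 with hx
      have hx0 : 0 < x := by positivity
      have h3 := hgap h2
      have h4 : ∑ c, ∑ e, H c e * CompatEst.limitMatrix H f μ (2 * s + 3) c e -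
          (H ^ (2 * (s + 2))).trace ≤ k * x := by
        rw [show 2 * (s + 2) = 2 * s + 3 + 1 by ring, ← CompatEst.trace_mul_pow hsymm (2 * s + 3), ← Finset.sum_sub_distrib]
        simp only [← Finset.sum_sub_distrib, ← mul_sub]
        calc _ ≤ ∑ c, ∑ e, H c e * x := Finset.sum_le_sum fun c _ => Finset.sum_le_sum fun e _ =>
              mul_le_mul_of_nonneg_left ((le_abs_self _).trans (hcon c e).le)
                (nonneg_of_mem_doublyStochastic hH)
          _ = _ := by
              simp only [← Finset.sum_mul, sum_row_of_mem_doublyStochastic hH]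
              simp
      have h5 : (k + 1) * x ≤ (1 - CompatEst.straightShare f μ (2 * s + 3)) *
          ((H ^ (2 * (s + 1))).trace - (H ^ (2 * (s + 2))).trace) := by
        have h6 := mul_le_mul_of_nonneg_left h3 (by positivity : (0 : ℝ) ≤ k + 1)
        refine h6.trans (le_of_eq ?_)
        change ((k : ℝ) + 1) * ((1 - CompatEst.straightShare f μ (2 * s + 3)) *
          (((H ^ (2 * (s + 1))).trace - (H ^ (2 * (s + 2))).trace) / (k + 1))) = _
        field_simp
      linarith
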